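/- Let $n\ge 1$ and let $\langle v,w\rangle=\sum_j v_j\overline{w_j}$ on $\mathbb{C}^n$. Let $\nu$ be a nonzero finite Borel measure on $\mathbb{C}P^{n-1}$ with total mass $|\nu|$, and put $R_\nu=n/|\nu|$. Suppose that $\nu$ is supported on a complex projective variety $Y\subset\mathbb{C}P^{n-1}$ (the common zero locus of homogeneous polynomials, possibly reducible), i.e. $\nu(\mathbb{C}P^{n-1}\setminus Y)=0$, and that $\nu$ is absolutely continuous on every irreducible component $Z$ of $Y$: a Borel set $N\subset Z$ whose trace on the smooth locus of $Z$ is Lebesgue-null in holomorphic charts satisfies $\nu(N)=0$ (in particular the singular locus of $Z$ is $\nu$-null). For a positive definite Hermitian $n\times n$ matrix $G$ put $$T_\nu(G)=R_\nu\int_{\mathbb{C}P^{n-1}}\Pi_z\,\frac{|z|^2}{\langle G^{-1}z,z\rangle}\,d\nu([z]),$$ where $\Pi_z$ is the orthogonal projector onto $\mathbb{C}z$ for $\langle\cdot,\cdot\rangle$. If $G$ is a positive definite fixed point of $T_\nu$, let $q_G^*(v,w)=\langle G^{-1}v,w\rangle$, let $F_G(z)$ be the $q_G^*$-orthogonal projector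 onto $\mathbb{C}z$, let $\mathscr{L}_G$ be the real vector space of operators on $\mathbb{C}^n$ that are Hermitian for $q_G^*$, and let the associated quantum channel be $$\mathcal{E}_G:\mathscr{L}_G\to\mathscr{L}_G,\qquad \mathcal{E}_G(A)=R_\nu\int_{\mathbb{C}P^{n-1}}\mathrm{tr}\big(F_G(z)A\big)\,F_G(z)\,d\nu([z]).$$ Its spectral gap is $1-\lambda_1$, where $\lambda_0\ge\lambda_1\ge\cdots$ are the eigenvalues of $\mathcal{E}_G$ listed with multiplicity (with $\lambda_1:=0$ if $n=1$). (i) Assume that $$\frac{\nu(\Sigma)}{\dim\Sigma+1}<\frac{|\nu|}{n}$$ for every nonempty proper projective subspace $\Sigma\subsetneq\mathbb{C}P^{n-1}$. Then $T_\nu$ maps positive definite Hermitian matrices to positive definite Hermitian matrices; for every positive definite Hermitian $G_0$ the iterates $T_\nu^r(G_0)$ converge as $r\to\infty$ to a positive definite fixed point of $T_\nu$; the positive definite fixed point of $T_\nu$ is unique up to multiplication by a positive scalar; and for every positive definite fixed point $G$ the channel $\mathcal{E}_G$ has positive spectral gap. (ii) Assume in addition that some irreducible component $Z$ of $Y$ with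 $\nu(Z)>0$ is not contained in any proper projective subspace of $\mathbb{C}P^{n-1}$. Then $\mathcal{E}_G$ is invertible for every positive definite fixed point $G$ of $T_\nu$. -/

import Mathlib

open scoped LinearAlgebra.Projectivization Matrix Topology ComplexOrder
open MeasureTheory Filter

noncomputable section

namespace Donaldson

variable {n d : ℕ}

/-! ### The projective space `ℂP^{n-1}` and its subvarieties -/

/-- `ProjSpace n` is the projective space `ℂP^{n-1}` of complex lines in `ℂ^n`. -/
abbrev ProjSpace (n : ℕ) : Type := ℙ ℂ (Fin n → ℂ)

/-- The usual (quotient) topology of `ℂP^{n-1}`. -/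
instance instTopologicalSpaceProjSpace : TopologicalSpace (ProjSpace n) :=
  inferInstanceAs (TopologicalSpace (Quotient (projectivizationSetoid ℂ (Fin n → ℂ))))

instance instMeasurableSpaceProjSpace : MeasurableSpace (ProjSpace n) := borel _

instance instBorelSpaceProjSpace : BorelSpace (ProjSpace n) := ⟨rfl⟩

/-- The projective subspace `ℙ(S)` attached to a linear subspace `S` of `ℂ^n`; its dimension is
`dim S - 1`, and it is proper iff `S ≠ ⊤`, nonempty iff `S ≠ ⊥`. -/
def projSubspace (S : Submodule ℂ (Fin n → ℂ)) : Set (ProjSpace n) :=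
  {x | x.submodule ≤ S}

/-- Common zero loci in `ℂP^{n-1}` of a set of homogeneous polynomials. -/
def IsAlgebraicSet (Y : Set (ProjSpace n)) : Prop :=
  ∃ I : Set (MvPolynomial (Fin n) ℂ), (∀ p ∈ I, ∃ k : ℕ, p.IsHomogeneous k) ∧
    Y = {x | ∀ p ∈ I, MvPolynomial.eval x.rep p = 0}

/-- Irreducible projective varieties. -/
def IsIrreducibleVariety (Z : Set (ProjSpace n)) : Prop :=
  IsAlgebraicSet Z ∧ Z.Nonempty ∧
    ∀ A B : Set (ProjSpace n), IsAlgebraicSet A → IsAlgebraicSet B → Z ⊆ A ∪ B → Z ⊆ A ∨ Z ⊆ B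

/-- `Z` is an irreducible component of `Y`: a maximal irreducible variety contained in `Y`. -/
def IsComponent (Z Y : Set (ProjSpace n)) : Prop :=
  IsIrreducibleVariety Z ∧ Z ⊆ Y ∧
    ∀ Z' : Set (ProjSpace n), IsIrreducibleVariety Z' → Z' ⊆ Y → Z ⊆ Z' → Z' = Z

/-- `φ : U → ℂP^{n-1}` is a local holomorphic parametrization (inverse of a holomorphic chart) of
the smooth locus of `Z`: it is a holomorphic immersion on the open set `U ⊆ ℂ^d` (expressed
through a lift `f` to `ℂ^n ∖ {0}`), and a homeomorphism of `U` onto a relatively open subset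
of `Z`. -/
structure IsLocalParam (Z : Set (ProjSpace n)) (U : Set (Fin d → ℂ))
    (φ : (Fin d → ℂ) → ProjSpace n) : Prop where
  isOpen : IsOpen U
  immersion : ∃ f : (Fin d → ℂ) → (Fin n → ℂ), DifferentiableOn ℂ f U ∧
    (∀ u ∈ U, ∃ h : f u ≠ 0, φ u = Projectivization.mk ℂ (f u) h) ∧
    (∀ u ∈ U, ∀ w : Fin d → ℂ, (∃ c : ℂ, fderiv ℂ f u w = c • f u) → w = 0)
  injOn : Set.InjOn φ U
  image_open : ∀ V ⊆ U, IsOpen V → ∃ O : Set (ProjSpace n), IsOpen O ∧ φ '' V = O ∩ Z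

/-- `N` is Lebesgue-null in `Z`: its trace on the smooth locus of `Z`, a complex manifold, is a
null set in all holomorphic charts. In particular the singular locus of `Z` is null. -/
def IsNullIn (Z N : Set (ProjSpace n)) : Prop :=
  ∀ (d : ℕ) (U : Set (Fin d → ℂ)) (φ : (Fin d → ℂ) → ProjSpace n),
    IsLocalParam Z U φ → volume (U ∩ φ ⁻¹' N) = 0

/-- `ν` is absolutely continuous on `Z`, with respect to the Lebesgue measure class of `Z`. -/
def IsAbsContOn (ν : Measure (ProjSpace n)) (Z : Set (ProjSpace n)) : Prop :=
  ∀ N : Set (ProjSpace n), MeasurableSet N → N ⊆ Z → IsNullIn Z N → ν N = 0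

/-! ### Hermitian products and Donaldson's map -/

/-- The standard Hermitian product `⟨v, w⟩ = ∑ v_j \bar{w_j}`. -/
def herm (v w : Fin n → ℂ) : ℂ := ∑ j, v j * star (w j)

/-- The Hermitian product `q*(v, w) = ⟨G⁻¹ v, w⟩` attached to a positive matrix `G`. -/
def dualProd (G : Matrix (Fin n) (Fin n) ℂ) (v w : Fin n → ℂ) : ℂ := herm (G⁻¹ *ᵥ v) w

/-- The projector `v ↦ (q*(v, z) / q*(z, z)) z` onto the line `x = [z]`, orthogonal for
`q* = dualProd G`; see `projector_mulVec`. -/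
def projector (G : Matrix (Fin n) (Fin n) ℂ) (x : ProjSpace n) : Matrix (Fin n) (Fin n) ℂ :=
  Matrix.of fun i j => dualProd G (Pi.single j 1) x.rep / dualProd G x.rep x.rep * x.rep i

/-- The constant `R_ν = n / |ν|`. -/
def ratio (ν : Measure (ProjSpace n)) : ℝ := n / ν.real Set.univ

/-- Donaldson's map `T_ν(G) = R_ν ∫ Π_z |z|² / ⟨G⁻¹ z, z⟩ dν([z])`, where `Π_z` is the orthogonal
projector onto `z` for the standard product; the integral is taken entrywise. -/
def donaldsonMap (ν : Measure (ProjSpace n)) (G : Matrix (Fin n) (Fin n) ℂ) :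
    Matrix (Fin n) (Fin n) ℂ :=
  Matrix.of fun i j => (ratio ν : ℂ) *
    ∫ x, projector 1 x i j * (herm x.rep x.rep / herm (G⁻¹ *ᵥ x.rep) x.rep) ∂ν

/-! ### The quantum channel -/

lemma herm_add_left (u v w : Fin n → ℂ) : herm (u + v) w = herm u w + herm v w := by
  simp [herm, add_mul, Finset.sum_add_distrib]

lemma herm_smul_left (c : ℂ) (v w : Fin n → ℂ) : herm (c • v) w = c * herm v w := by
  simp [herm, Finset.mul_sum, mul_assoc]

lemma star_herm (v w : Fin n → ℂ) : star (herm v w) = herm w v := by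
  simp [herm, mul_comm]

lemma herm_eq (v w : Fin n → ℂ) : herm v w = v ⬝ᵥ star w := by
  simp [herm, dotProduct]

lemma dualProd_add_left (G : Matrix (Fin n) (Fin n) ℂ) (u v w : Fin n → ℂ) :
    dualProd G (u + v) w = dualProd G u w + dualProd G v w := by
  simp [dualProd, Matrix.mulVec_add, herm_add_left]

lemma dualProd_smul_left (G : Matrix (Fin n) (Fin n) ℂ) (c : ℂ) (v w : Fin n → ℂ) :
    dualProd G (c • v) w = c * dualProd G v w := by
  simp [dualProd, Matrix.mulVec_smul, herm_smul_left]

lemma dualProd_star {G : Matrix (Fin n) (Fin n) ℂ} (hG : G.PosDef) (v w : Fin n → ℂ) :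
    star (dualProd G v w) = dualProd G w v := by
  have h : (G⁻¹)ᴴ = G⁻¹ := hG.inv.isHermitian
  rw [dualProd, star_herm, dualProd, herm_eq, herm_eq, Matrix.star_mulVec, h,
    dotProduct_comm, ← Matrix.dotProduct_mulVec, dotProduct_comm]

lemma dualProd_add_right {G : Matrix (Fin n) (Fin n) ℂ} (u v w : Fin n → ℂ) :
    dualProd G u (v + w) = dualProd G u v + dualProd G u w := by
  simp [dualProd, herm, mul_add, Finset.sum_add_distrib]

lemma dualProd_smul_right {G : Matrix (Fin n) (Fin n) ℂ} (c : ℂ) (v w : Fin n → ℂ) :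
    dualProd G v (c • w) = star c * dualProd G v w := by
  simp [dualProd, herm, Finset.mul_sum, mul_left_comm]

lemma dualProd_self_ne {G : Matrix (Fin n) (Fin n) ℂ} (hG : G.PosDef) {v : Fin n → ℂ}
    (hv : v ≠ 0) : dualProd G v v ≠ 0 := by
  have h := hG.inv.dotProduct_mulVec_pos hv
  rw [dualProd, herm_eq, dotProduct_comm]
  exact h.ne'

lemma projector_mulVec (G : Matrix (Fin n) (Fin n) ℂ) (x : ProjSpace n) (v : Fin n → ℂ) :
    projector G x *ᵥ v = (dualProd G v x.rep / dualProd G x.rep x.rep) • x.rep := by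
  have key : dualProd G v x.rep = ∑ j, v j * dualProd G (Pi.single j 1) x.rep := by
    let L : (Fin n → ℂ) →ₗ[ℂ] ℂ :=
      { toFun := fun v => dualProd G v x.rep
        map_add' := fun a b => dualProd_add_left G a b _
        map_smul' := fun c a => dualProd_smul_left G c a _ }
    have := LinearMap.pi_apply_eq_sum_univ L v
    have e : ∀ j : Fin n, (fun k => if j = k then (1 : ℂ) else 0) = Pi.single j 1 := by
      intro j
      ext k
      simp [Pi.single_apply, eq_comm]
    simpa [L, e] using this
  ext i
  simp only [Matrix.mulVec, dotProduct, projector, Matrix.of_apply, Pi.smul_apply, smul_eq_mul]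
  rw [key, Finset.sum_div, Finset.sum_mul]
  refine Finset.sum_congr rfl fun j _ => ?_
  ring

lemma dualProd_projector {G : Matrix (Fin n) (Fin n) ℂ} (hG : G.PosDef) (x : ProjSpace n)
    (v w : Fin n → ℂ) :
    dualProd G (projector G x *ᵥ v) w = dualProd G v (projector G x *ᵥ w) := by
  rw [projector_mulVec, projector_mulVec, dualProd_smul_left, dualProd_smul_right, star_div₀,
    dualProd_star hG, dualProd_star hG]
  ring

lemma projector_mk {G : Matrix (Fin n) (Fin n) ℂ} (v : Fin n → ℂ) (hv : v ≠ 0) (i j : Fin n) :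
    projector G (Projectivization.mk ℂ v hv) i j =
      dualProd G (Pi.single j 1) v / dualProd G v v * v i := by
  obtain ⟨a, ha⟩ := Projectivization.exists_smul_eq_mk_rep ℂ v hv
  have ha' : (Projectivization.mk ℂ v hv).rep = (a : ℂ) • v := by
    rw [← ha]
    rfl
  have h0 : (a : ℂ) ≠ 0 := a.ne_zero
  have h1 : star (a : ℂ) ≠ 0 := star_ne_zero.2 h0
  simp only [projector, Matrix.of_apply, ha', dualProd_smul_left, dualProd_smul_right,
    Pi.smul_apply, smul_eq_mul]
  by_cases hd : dualProd G v v = 0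
  · simp [hd]
  · field_simp

lemma continuous_projector {G : Matrix (Fin n) (Fin n) ℂ} (hG : G.PosDef) (i j : Fin n) :
    Continuous fun x : ProjSpace n => projector G x i j := by
  have hq : Topology.IsQuotientMap
      (fun v : {v : Fin n → ℂ // v ≠ 0} => (Projectivization.mk ℂ v.1 v.2 : ProjSpace n)) :=
    isQuotientMap_quot_mk
  rw [hq.continuous_iff]
  have : ((fun x : ProjSpace n => projector G x i j) ∘
      fun v : {v : Fin n → ℂ // v ≠ 0} => (Projectivization.mk ℂ v.1 v.2 : ProjSpace n)) =
      fun v => dualProd G (Pi.single j 1) v.1 / dualProd G v.1 v.1 * v.1 i :=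
    funext fun v => projector_mk v.1 v.2 i j
  rw [this]
  have hk : ∀ k : Fin n, Continuous fun v : {v : Fin n → ℂ // v ≠ 0} => v.1 k :=
    fun k => (continuous_apply k).comp continuous_subtype_val
  refine Continuous.mul (Continuous.div ?_ ?_ fun v => dualProd_self_ne hG v.2) (hk i)
  · simp only [dualProd, herm]
    exact continuous_finsetSum _ fun a _ => continuous_const.mul (hk a).star
  · simp only [dualProd, herm, Matrix.mulVec, dotProduct]
    exact continuous_finsetSum _ fun a _ =>
      (continuous_finsetSum _ fun b _ => continuous_const.mul (hk b)).mul (hk a).star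

instance instCompactSpaceProjSpace : CompactSpace (ProjSpace n) := by
  have hc : Continuous
      (fun v : {v : Fin n → ℂ // v ≠ 0} => (Projectivization.mk ℂ v.1 v.2 : ProjSpace n)) :=
    continuous_quot_mk
  let g : Metric.sphere (0 : Fin n → ℂ) 1 → ProjSpace n :=
    fun v => Projectivization.mk ℂ v.1 (Metric.ne_of_mem_sphere v.2 one_ne_zero)
  have hg : Continuous g :=
    hc.comp (f := fun v : Metric.sphere (0 : Fin n → ℂ) 1 =>
      (⟨v.1, Metric.ne_of_mem_sphere v.2 one_ne_zero⟩ : {v : Fin n → ℂ // v ≠ 0}))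
      (by fun_prop)
  have hs : Function.Surjective g := by
    intro x
    have h0 : x.rep ≠ 0 := x.rep_nonzero
    have hn : (‖x.rep‖ : ℂ) ≠ 0 := by simpa using h0
    refine ⟨⟨((‖x.rep‖ : ℂ)⁻¹) • x.rep, by simp [norm_smul, h0]⟩, ?_⟩
    conv_rhs => rw [← x.mk_rep]
    exact (Projectivization.mk_eq_mk_iff' ℂ _ _ _ _).2 ⟨_, rfl⟩
  have : CompactSpace (Metric.sphere (0 : Fin n → ℂ) 1) :=
    isCompact_iff_compactSpace.1 (isCompact_sphere _ _)
  exact ⟨by simpa [hs.range_eq] using isCompact_range hg⟩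

/-- The real vector space `ℒ(H)` of Hermitian operators of `H = (ℂ^n, q*)`, `q* = dualProd G`. -/
def hermOps (G : Matrix (Fin n) (Fin n) ℂ) : Submodule ℝ (Matrix (Fin n) (Fin n) ℂ) where
  carrier := {A | ∀ v w, dualProd G (A *ᵥ v) w = dualProd G v (A *ᵥ w)}
  zero_mem' v w := by simp [dualProd, herm]
  add_mem' {A B} hA hB v w := by
    simp [Matrix.add_mulVec, dualProd_add_left, dualProd_add_right, hA v w, hB v w]
  smul_mem' c A hA v w := by
    have h : ∀ u, (c • A) *ᵥ u = (c : ℂ) • (A *ᵥ u) := fun u => by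
      ext i
      simp [Matrix.mulVec, dotProduct, Finset.mul_sum, mul_assoc]
    rw [h, h, dualProd_smul_left, dualProd_smul_right, hA v w]
    simp

/-- `R_ν ∫ ((F, A)) F dν = n ∫ ((F, A)) F dα`, with `F` the `q*`-orthogonal projector,
`((F, A)) = tr (F A)` and `α = ν / |ν|`; the integral is taken entrywise. -/
def channelFun (ν : Measure (ProjSpace n)) (G A : Matrix (Fin n) (Fin n) ℂ) :
    Matrix (Fin n) (Fin n) ℂ :=
  Matrix.of fun i j => (ratio ν : ℂ) *
    ∫ x, (projector G x * A).trace * projector G x i j ∂ν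

lemma integrable_channel (ν : Measure (ProjSpace n)) [IsFiniteMeasure ν]
    {G : Matrix (Fin n) (Fin n) ℂ} (hG : G.PosDef) (A : Matrix (Fin n) (Fin n) ℂ) (i j : Fin n) :
    Integrable (fun x => (projector G x * A).trace * projector G x i j) ν := by
  have h := continuous_projector hG
  have hc : Continuous fun x : ProjSpace n =>
      (projector G x * A).trace * projector G x i j := by
    simp only [Matrix.trace, Matrix.diag, Matrix.mul_apply]
    exact Continuous.mul (continuous_finsetSum _ fun a _ => continuous_finsetSum _ fun b _ =>
      (h a b).mul continuous_const) (h i j)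
  exact hc.integrable_of_hasCompactSupport (HasCompactSupport.of_compactSpace _)

lemma mem_hermOps_iff {G : Matrix (Fin n) (Fin n) ℂ} (hG : G.PosDef)
    (A : Matrix (Fin n) (Fin n) ℂ) :
    A ∈ hermOps G ↔ ∀ i j, (G⁻¹ * A) i j = star ((G⁻¹ * A) j i) := by
  have key : ∀ v w, dualProd G v (A *ᵥ w) = herm v ((G⁻¹ * A) *ᵥ w) := fun v w => by
    rw [← dualProd_star hG, dualProd, star_herm, Matrix.mulVec_mulVec]
  have key2 : ∀ v w, dualProd G (A *ᵥ v) w = herm ((G⁻¹ * A) *ᵥ v) w := fun v w => by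
    rw [dualProd, Matrix.mulVec_mulVec]
  constructor
  · intro h i j
    have := h (Pi.single j 1) (Pi.single i 1)
    rw [key, key2] at this
    simpa [herm, Pi.single_apply, Matrix.mulVec, dotProduct] using this
  · intro h v w
    rw [key, key2]
    simp only [herm, Matrix.mulVec, dotProduct, Finset.sum_mul, star_sum, Finset.mul_sum, star_mul]
    rw [Finset.sum_comm]
    refine Finset.sum_congr rfl fun a _ => Finset.sum_congr rfl fun b _ => ?_
    rw [h b a]
    ring

lemma trace_projector_mul (G A : Matrix (Fin n) (Fin n) ℂ) (x : ProjSpace n) :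
    (projector G x * A).trace = dualProd G (A *ᵥ x.rep) x.rep / dualProd G x.rep x.rep := by
  have h : projector G x = Matrix.vecMulVec x.rep
      (fun j => dualProd G (Pi.single j 1) x.rep / dualProd G x.rep x.rep) := by
    ext i j
    simp [projector, Matrix.vecMulVec_apply, mul_comm]
  have h2 := projector_mulVec G x (A *ᵥ x.rep)
  rw [h, Matrix.vecMulVec_mulVec] at h2
  rw [h, Matrix.vecMulVec_mul, Matrix.trace_vecMulVec, dotProduct_comm,
    ← Matrix.dotProduct_mulVec]
  obtain ⟨i, hi⟩ := Function.ne_iff.1 x.rep_nonzero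
  have h3 := congrFun h2 i
  simp only [Pi.smul_apply, smul_eq_mul, MulOpposite.smul_eq_mul_unop, MulOpposite.unop_op] at h3
  rw [mul_comm] at h3
  exact mul_right_cancel₀ hi h3

lemma channelFun_mem (ν : Measure (ProjSpace n)) [IsFiniteMeasure ν]
    {G : Matrix (Fin n) (Fin n) ℂ} (hG : G.PosDef) {A : Matrix (Fin n) (Fin n) ℂ}
    (hA : A ∈ hermOps G) : channelFun ν G A ∈ hermOps G := by
  rw [mem_hermOps_iff hG]
  have key : ∀ i j, (G⁻¹ * channelFun ν G A) i j =
      (ratio ν : ℂ) * ∫ x, (projector G x * A).trace * (G⁻¹ * projector G x) i j ∂ν := by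
    intro i j
    simp only [Matrix.mul_apply, channelFun, Matrix.of_apply, Finset.mul_sum]
    rw [integral_finsetSum _ fun a _ => ?_, Finset.mul_sum]
    · refine Finset.sum_congr rfl fun a _ => ?_
      simp only [mul_left_comm _ (G⁻¹ i a)]
      rw [integral_const_mul]
      ring
    · simp only [mul_left_comm _ (G⁻¹ i a)]
      exact (integrable_channel ν hG A a j).const_mul _
  intro i j
  rw [key, key, star_mul', ← starRingEnd_apply (∫ x, _ ∂ν), ← integral_conj]
  congr 1
  · simp
  · refine integral_congr_ae (Eventually.of_forall fun x => ?_)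
    have hp : projector G x ∈ hermOps G := fun v w => dualProd_projector hG x v w
    have ht : star (projector G x * A).trace = (projector G x * A).trace := by
      rw [trace_projector_mul, star_div₀, dualProd_star hG, dualProd_star hG, hA]
    simp only [map_mul, starRingEnd_apply]
    rw [ht, (mem_hermOps_iff hG _).1 hp i j]

/-- The quantum channel `ℰ : ℒ(H) → ℒ(H)`, `ℰ(A) = n ∫ ((F, A)) F dα`, of the operator-valued
measure `dW = n F dα` on `H = (ℂ^n, q*)`, `q* = dualProd G`, where `F = projector G` and
`α = ν / |ν|`. -/
def quantumChannel (ν : Measure (ProjSpace n)) [IsFiniteMeasure ν]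
    (G : Matrix (Fin n) (Fin n) ℂ) (hG : G.PosDef) : hermOps G →ₗ[ℝ] hermOps G where
  toFun A := ⟨channelFun ν G A, channelFun_mem ν hG A.2⟩
  map_add' A B := by
    ext i j
    simp only [channelFun, Submodule.coe_add, Matrix.mul_add, Matrix.trace_add, add_mul,
      Matrix.of_apply, Matrix.add_apply]
    rw [integral_add (integrable_channel ν hG _ i j) (integrable_channel ν hG _ i j), mul_add]
  map_smul' c A := by
    ext i j
    simp only [channelFun, Submodule.coe_smul, Matrix.mul_smul, Matrix.trace_smul,
      Matrix.of_apply, Matrix.smul_apply, RingHom.id_apply, smul_mul_assoc]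
    rw [integral_smul, mul_smul_comm]

/-- The `k`-th eigenvalue (`k = 0, 1, …`) in the decreasing list `γ₀ ≥ γ₁ ≥ …` of the real
eigenvalues, repeated according to multiplicity; `0` beyond the end of the list. The quantum
channel is symmetric for the inner product `tr (A B)` on `ℒ(H)`, so all its eigenvalues are real. -/
def eigenvalueDesc {V : Type*} [AddCommGroup V] [Module ℝ V] [Module.Finite ℝ V]
    (E : V →ₗ[ℝ] V) (k : ℕ) : ℝ :=
  (E.charpoly.roots.sort (fun a b : ℝ => b ≤ a)).getD k 0

/-- The spectral gap `1 - γ₁`. -/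
def spectralGap {V : Type*} [AddCommGroup V] [Module ℝ V] [Module.Finite ℝ V]
    (E : V →ₗ[ℝ] V) : ℝ :=
  1 - eigenvalueDesc E 1

end Donaldson

end

open scoped LinearAlgebra.Projectivization Matrix Topology ComplexOrder
open MeasureTheory Filter

noncomputable section

namespace Donaldson

section HermitianForm

variable {n : ℕ}

/-! ### Hermitian forms of matrices -/

/-! Write z for a vector on a line and R for `ratio ν`. The factor |z|² cancels and T(G) = R ∫ z z*
/ ⟨G⁻¹z, z⟩ dν. This map is monotone for the Loewner order, homogeneous of degree one, and satisfies
tr(G⁻¹ T(G)) = n. Stability prevents ν from being carried by a proper subspace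
(`IsStable.not_ae_mem`), or by two subspaces of total dimension at most n, the first nonzero and
proper (`IsStable.not_ae_mem_or`).

Existence of a fixed point (`exists_fixed`): for the regularized map (1 - ε) T + ε, minimize tr G⁻¹
over the subsolutions G. Monotonicity turns the minimizer into a fixed point, and the trace identity
gives tr G⁻¹ = n whatever ε is. Then ε tends to 0. Both limits stay invertible by
`posDef_of_tendsto`: if the matrices G⁻¹ degenerated to a matrix with kernel K, testing the
inequality on K would give dim K ≤ R ν(ℙ(K)), against stability.

Convergence and uniqueness: fix a fixed point P and let b be the least number with G ≤ bP. By
monotonicity b decreases along the orbit, so it is constant along the orbit of any limit point. The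
contact space ker(bP - G) is nonzero and can only shrink under T. Once it stops shrinking, almost
every line is either orthogonal to it or inside its image under P, so stability forces G = bP
(`eq_smul_of_matKer_eq`). An iterate that comes close to bP stays close, by monotonicity.

Spectral gap: for the trace form, ⟨A, A⟩ - ⟨A, ℰA⟩ is R times the integral over ν of the variance of
A in the state of the line (`trace_sub_channelFun`). Hence eigenvalues are at most 1, and if ℰA = A
then almost every line is an eigenline of A; stability makes A scalar. Symmetry of ℰ excludes Jordan
blocks, so 1 is a simple root.

Invertibility: ⟨A, ℰA⟩ is R times the integral of the squared expectation, so ℰA = 0 makes the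
expectation of A vanish almost everywhere. By absolute continuity it vanishes on a set of positive
measure in some chart f of the component Z. It is real analytic there, so it vanishes on an open
set, and polarization separates the two occurrences of f. Euclidean open subsets of Z are Zariski
dense (`mem_of_eval_eq_zero_near`, by Noether normalization), hence span ℂ^n, and A = 0. -/

/-- The real part of the Hermitian form of a matrix. -/
def quad (A : Matrix (Fin n) (Fin n) ℂ) (v : Fin n → ℂ) : ℝ := (star v ⬝ᵥ A *ᵥ v).re

lemma quad_add (A B : Matrix (Fin n) (Fin n) ℂ) (v : Fin n → ℂ) :
    quad (A + B) v = quad A v + quad B v := by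
  simp [quad, Matrix.add_mulVec]

lemma quad_sub (A B : Matrix (Fin n) (Fin n) ℂ) (v : Fin n → ℂ) :
    quad (A - B) v = quad A v - quad B v := by
  simp [quad, Matrix.sub_mulVec]

lemma quad_smul (c : ℝ) (A : Matrix (Fin n) (Fin n) ℂ) (v : Fin n → ℂ) :
    quad (c • A) v = c * quad A v := by
  simp [quad, Matrix.smul_mulVec]

lemma quad_one (v : Fin n → ℂ) : quad 1 v = ∑ i, ‖v i‖ ^ 2 := by
  simp only [quad, Matrix.one_mulVec, dotProduct, Pi.star_apply, Complex.re_sum]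
  refine Finset.sum_congr rfl fun i _ => ?_
  rw [Complex.star_def, mul_comm, Complex.mul_conj, Complex.ofReal_re, Complex.normSq_eq_norm_sq]

lemma quad_smul_vec (A : Matrix (Fin n) (Fin n) ℂ) (c : ℂ) (v : Fin n → ℂ) :
    quad A (c • v) = ‖c‖ ^ 2 * quad A v := by
  have : star (c • v) ⬝ᵥ A *ᵥ (c • v) = ((‖c‖ ^ 2 : ℝ) : ℂ) * (star v ⬝ᵥ A *ᵥ v) := by
    rw [Matrix.mulVec_smul, star_smul, smul_dotProduct, dotProduct_smul, smul_eq_mul, smul_eq_mul,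
      ← mul_assoc, Complex.star_def, mul_comm (starRingEnd ℂ c), Complex.mul_conj,
      Complex.normSq_eq_norm_sq]
  rw [quad, this, Complex.re_ofReal_mul, quad]

lemma ofReal_quad {A : Matrix (Fin n) (Fin n) ℂ} (hA : A.IsHermitian) (v : Fin n → ℂ) :
    (quad A v : ℂ) = star v ⬝ᵥ A *ᵥ v := by
  apply Complex.conj_eq_iff_re.1
  rw [← Complex.star_def]
  conv_rhs => rw [Matrix.dotProduct_mulVec, ← hA.eq, ← Matrix.star_mulVec, Matrix.star_dotProduct]

lemma quad_pos {A : Matrix (Fin n) (Fin n) ℂ} (hA : A.PosDef) {v : Fin n → ℂ} (hv : v ≠ 0) :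
    0 < quad A v := hA.re_dotProduct_pos hv

lemma quad_nonneg {A : Matrix (Fin n) (Fin n) ℂ} (hA : A.PosSemidef) (v : Fin n → ℂ) :
    0 ≤ quad A v := hA.re_dotProduct_nonneg v

lemma posSemidef_of_quad {A : Matrix (Fin n) (Fin n) ℂ} (hA : A.IsHermitian)
    (h : ∀ v, 0 ≤ quad A v) : A.PosSemidef :=
  Matrix.PosSemidef.of_dotProduct_mulVec_nonneg hA fun v => by
    rw [← ofReal_quad hA]; exact_mod_cast h v

lemma posDef_of_quad {A : Matrix (Fin n) (Fin n) ℂ} (hA : A.IsHermitian)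
    (h : ∀ v, v ≠ 0 → 0 < quad A v) : A.PosDef :=
  Matrix.PosDef.of_dotProduct_mulVec_pos hA fun v hv => by
    rw [← ofReal_quad hA]; exact_mod_cast h v hv

lemma posDef_of_le {A B : Matrix (Fin n) (Fin n) ℂ} (hA : A.PosDef) (hB : B.IsHermitian)
    (h : ∀ v, quad A v ≤ quad B v) : B.PosDef :=
  posDef_of_quad hB fun v hv => (quad_pos hA hv).trans_le (h v)

lemma mulVec_eq_zero_of_quad {A : Matrix (Fin n) (Fin n) ℂ} (hA : A.PosSemidef)
    {v : Fin n → ℂ} (h : quad A v = 0) : A *ᵥ v = 0 := by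
  rw [← hA.dotProduct_mulVec_zero_iff, ← ofReal_quad hA.1, h, Complex.ofReal_zero]

lemma posDef_smul {A : Matrix (Fin n) (Fin n) ℂ} (hA : A.PosDef) {c : ℝ} (hc : 0 < c) :
    (c • A).PosDef := by
  refine posDef_of_quad ?_ fun v hv => ?_
  · rw [Matrix.IsHermitian, Matrix.conjTranspose_smul, hA.1.eq, star_trivial]
  · rw [quad_smul]
    exact mul_pos hc (quad_pos hA hv)

lemma isHermitian_smul {A : Matrix (Fin n) (Fin n) ℂ} (hA : A.IsHermitian) (c : ℝ) :
    (c • A).IsHermitian := by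
  rw [Matrix.IsHermitian, Matrix.conjTranspose_smul, hA.eq, star_trivial]

lemma eq_of_mulVec_eq {A B : Matrix (Fin n) (Fin n) ℂ} (h : ∀ v, A *ᵥ v = B *ᵥ v) : A = B :=
  Matrix.toLin'.injective (LinearMap.ext fun v => by simpa using h v)

lemma eq_of_quad_eq {A B : Matrix (Fin n) (Fin n) ℂ} (hA : A.IsHermitian) (hB : B.IsHermitian)
    (h : ∀ v, quad A v = quad B v) : A = B := by
  refine eq_of_mulVec_eq fun v => ?_
  have hp : (A - B).PosSemidef := posSemidef_of_quad (hA.sub hB) fun v => by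
    rw [quad_sub, h, sub_self]
  have := mulVec_eq_zero_of_quad hp (v := v) (by rw [quad_sub, h, sub_self])
  rwa [Matrix.sub_mulVec, sub_eq_zero] at this

lemma mul_inv_of_posDef {G : Matrix (Fin n) (Fin n) ℂ} (hG : G.PosDef) : G * G⁻¹ = 1 :=
  Matrix.mul_nonsing_inv _ ((Matrix.isUnit_iff_isUnit_det _).1 hG.isUnit)

lemma inv_mul_of_posDef {G : Matrix (Fin n) (Fin n) ℂ} (hG : G.PosDef) : G⁻¹ * G = 1 :=
  Matrix.nonsing_inv_mul _ ((Matrix.isUnit_iff_isUnit_det _).1 hG.isUnit)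

lemma inv_inv_of_posDef {G : Matrix (Fin n) (Fin n) ℂ} (hG : G.PosDef) : G⁻¹⁻¹ = G :=
  Matrix.nonsing_inv_nonsing_inv _ ((Matrix.isUnit_iff_isUnit_det _).1 hG.isUnit)

lemma inv_real_smul {G : Matrix (Fin n) (Fin n) ℂ} (hG : G.PosDef) {c : ℝ} (hc : c ≠ 0) :
    (c • G)⁻¹ = c⁻¹ • G⁻¹ := by
  refine Matrix.inv_eq_left_inv ?_
  rw [Matrix.smul_mul, Matrix.mul_smul, smul_smul, inv_mul_cancel₀ hc, one_smul,
    inv_mul_of_posDef hG]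

/-! ### Legendre duality and order reversal under inversion. -/

lemma quad_sub_vec {G : Matrix (Fin n) (Fin n) ℂ} (hG : G.IsHermitian) (u w : Fin n → ℂ) :
    quad G (u - w) = quad G u - 2 * (star w ⬝ᵥ G *ᵥ u).re + quad G w := by
  have h : star u ⬝ᵥ G *ᵥ w = star (star w ⬝ᵥ G *ᵥ u) := by
    rw [Matrix.star_dotProduct, Matrix.star_mulVec, hG.eq, ← Matrix.dotProduct_mulVec]
  simp only [quad, star_sub, Matrix.mulVec_sub, sub_dotProduct, dotProduct_sub, h,
    Complex.sub_re, Complex.star_def, Complex.conj_re]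
  ring

/-- The Legendre duality between `G` and `G⁻¹`. -/
lemma two_re_sub_quad_le {G : Matrix (Fin n) (Fin n) ℂ} (hG : G.PosDef) (z w : Fin n → ℂ) :
    2 * (star w ⬝ᵥ z).re - quad G w ≤ quad G⁻¹ z := by
  have h0 := quad_nonneg hG.posSemidef (G⁻¹ *ᵥ z - w)
  have h1 : G *ᵥ (G⁻¹ *ᵥ z) = z := by
    rw [Matrix.mulVec_mulVec, mul_inv_of_posDef hG, Matrix.one_mulVec]
  have h2 : quad G (G⁻¹ *ᵥ z) = quad G⁻¹ z := by
    rw [quad, h1, Matrix.star_mulVec, hG.inv.1.eq, ← Matrix.dotProduct_mulVec]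
    rfl
  rw [quad_sub_vec hG.1, h1, h2] at h0
  linarith

lemma two_re_sub_quad_eq {G : Matrix (Fin n) (Fin n) ℂ} (hG : G.PosDef) (z : Fin n → ℂ) :
    2 * (star (G⁻¹ *ᵥ z) ⬝ᵥ z).re - quad G (G⁻¹ *ᵥ z) = quad G⁻¹ z := by
  have h1 : G *ᵥ (G⁻¹ *ᵥ z) = z := by
    rw [Matrix.mulVec_mulVec, mul_inv_of_posDef hG, Matrix.one_mulVec]
  rw [quad, h1, Matrix.star_mulVec, hG.inv.1.eq, ← Matrix.dotProduct_mulVec, quad]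
  ring

/-- The form of G⁻¹ is a supremum, over w, of expressions that decrease with G; it suffices to
insert the maximizer belonging to G'. -/
lemma quad_inv_anti {G G' : Matrix (Fin n) (Fin n) ℂ} (hG : G.PosDef) (hG' : G'.PosDef)
    (h : ∀ v, quad G v ≤ quad G' v) (z : Fin n → ℂ) : quad G'⁻¹ z ≤ quad G⁻¹ z := by
  rw [← two_re_sub_quad_eq hG']
  have := two_re_sub_quad_le hG z (G'⁻¹ *ᵥ z)
  have hz := h (G'⁻¹ *ᵥ z)
  linarith

/-! ### Entry bounds and convergence read off quadratic forms. -/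

/-- The sum of the norms of the entries. -/
def entrySum (A : Matrix (Fin n) (Fin n) ℂ) : ℝ := ∑ i, ∑ j, ‖A i j‖

lemma entrySum_nonneg (A : Matrix (Fin n) (Fin n) ℂ) : 0 ≤ entrySum A := by
  unfold entrySum; positivity

lemma continuous_entrySum : Continuous (entrySum (n := n)) := by
  unfold entrySum
  fun_prop

lemma abs_quad_le (A : Matrix (Fin n) (Fin n) ℂ) (v : Fin n → ℂ) :
    |quad A v| ≤ entrySum A * quad 1 v := by
  rw [quad_one, entrySum]
  refine (Complex.abs_re_le_norm _).trans ?_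
  simp only [dotProduct, Matrix.mulVec, Finset.mul_sum, Pi.star_apply]
  rw [← Finset.mul_sum, Finset.sum_mul]
  refine (norm_sum_le _ _).trans ?_
  have hs : ∀ i, ‖v i‖ ^ 2 ≤ ∑ k, ‖v k‖ ^ 2 := fun i =>
    Finset.single_le_sum (f := fun k => ‖v k‖ ^ 2) (fun _ _ => by positivity) (Finset.mem_univ i)
  refine Finset.sum_le_sum fun i _ => (norm_sum_le _ _).trans ?_
  rw [Finset.sum_mul]
  refine Finset.sum_le_sum fun j _ => ?_
  rw [norm_mul, norm_mul, norm_star]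
  have h1 : ‖v i‖ * ‖v j‖ ≤ ∑ k, ‖v k‖ ^ 2 := by
    nlinarith [sq_nonneg (‖v i‖ - ‖v j‖), hs i, hs j]
  nlinarith [norm_nonneg (A i j)]

/-- The upper bound of G⁻¹ by a multiple of the identity is inverted. -/
lemma quad_one_le {G : Matrix (Fin n) (Fin n) ℂ} (hG : G.PosDef) :
    ∃ c : ℝ, 0 < c ∧ ∀ v, c * quad 1 v ≤ quad G v := by
  have hC : 0 < entrySum G⁻¹ + 1 := by linarith [entrySum_nonneg G⁻¹]
  refine ⟨(entrySum G⁻¹ + 1)⁻¹, inv_pos.2 hC, fun v => ?_⟩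
  have h := quad_inv_anti hG.inv (posDef_smul (Matrix.PosDef.one (n := Fin n) (R := ℂ)) hC)
    (fun w => ?_) v
  · rwa [inv_inv_of_posDef hG, inv_real_smul Matrix.PosDef.one hC.ne', inv_one, quad_smul] at h
  · rw [quad_smul]
    have h1 := (le_abs_self _).trans (abs_quad_le G⁻¹ w)
    have h2 := quad_nonneg (Matrix.PosSemidef.one (n := Fin n) (R := ℂ)) w
    linarith

/-- The 2 × 2 principal minor gives |M i j|² ≤ M i i · M j j, and each diagonal entry is at most the
trace. -/
lemma norm_apply_le_trace {M : Matrix (Fin n) (Fin n) ℂ} (hM : M.PosSemidef) (i j : Fin n) :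
    ‖M i j‖ ≤ M.trace.re := by
  have hd : ∀ k, 0 ≤ (M k k).re := fun k => (Complex.le_def.1 hM.diag_nonneg).1
  have him : ∀ k, (M k k).im = 0 := fun k => (Complex.le_def.1 hM.diag_nonneg).2.symm
  have htr : ∀ k, (M k k).re ≤ M.trace.re := fun k => by
    simp only [Matrix.trace, Matrix.diag, Complex.re_sum]
    exact Finset.single_le_sum (f := fun k => (M k k).re) (fun k _ => hd k) (Finset.mem_univ k)
  have h := (hM.submatrix ![i, j]).det_nonneg
  rw [Matrix.det_fin_two] at h
  simp only [Matrix.submatrix_apply, Matrix.cons_val_zero, Matrix.cons_val_one] at h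
  have h2 : M j i = star (M i j) := by rw [← Matrix.conjTranspose_apply, hM.1.eq]
  have h3 := (Complex.le_def.1 h).1
  rw [h2, Complex.star_def, Complex.mul_conj, Complex.sub_re, Complex.mul_re, him, him,
    Complex.ofReal_re, Complex.normSq_eq_norm_sq] at h3
  simp only [Complex.zero_re, mul_zero, sub_zero] at h3
  refine abs_le_of_sq_le_sq' ?_ ((hd i).trans (htr i)) |>.2
  nlinarith [hd i, hd j, htr i, htr j]

lemma trace_eq_sum_quad (M : Matrix (Fin n) (Fin n) ℂ) :
    M.trace.re = ∑ i, quad M (Pi.single i 1) := by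
  simp [Matrix.trace, quad, Matrix.diag, Complex.re_sum]

lemma trace_mono {A B : Matrix (Fin n) (Fin n) ℂ} (h : ∀ v, quad A v ≤ quad B v) :
    A.trace.re ≤ B.trace.re := by
  rw [trace_eq_sum_quad, trace_eq_sum_quad]
  exact Finset.sum_le_sum fun i _ => h _

/-- M + δC is positive semidefinite with trace at most 2δ tr C, and removing δC costs another δ tr
C; hence the factor 3. -/
lemma norm_apply_le_of_abs_quad {M C : Matrix (Fin n) (Fin n) ℂ} (hM : M.IsHermitian)
    (hC : C.PosSemidef) {δ : ℝ} (hδ : 0 ≤ δ) (h : ∀ v, |quad M v| ≤ δ * quad C v) (i j : Fin n) :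
    ‖M i j‖ ≤ 3 * C.trace.re * δ := by
  have hp : (M + δ • C).PosSemidef :=
    posSemidef_of_quad (hM.add (isHermitian_smul hC.1 δ)) fun v => by
      rw [quad_add, quad_smul]; linarith [neg_le_of_abs_le (h v)]
  have h1 := norm_apply_le_trace hp i j
  have h2 : (M + δ • C).trace.re ≤ ((2 * δ) • C).trace.re := trace_mono fun v => by
    rw [quad_add, quad_smul, quad_smul]; linarith [le_of_abs_le (h v)]
  have h3 := norm_apply_le_trace hC i j
  have h4 : M i j = (M + δ • C) i j - (δ : ℂ) * C i j := by simp
  rw [Matrix.trace_smul, Complex.smul_re, smul_eq_mul] at h2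
  rw [h4]
  refine (norm_sub_le _ _).trans ?_
  rw [norm_mul, Complex.norm_real, Real.norm_of_nonneg hδ]
  nlinarith

lemma tendsto_matrix_iff {ι : Type*} {l : Filter ι} {M : ι → Matrix (Fin n) (Fin n) ℂ}
    {N : Matrix (Fin n) (Fin n) ℂ} :
    Tendsto M l (𝓝 N) ↔ ∀ i j, Tendsto (fun k => M k i j) l (𝓝 (N i j)) := by
  constructor
  · intro h i j
    exact ((continuous_apply j).comp (continuous_apply i) : Continuous fun A : Fin n → Fin n → ℂ =>
      A i j).continuousAt.tendsto.comp h
  · intro h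
    exact tendsto_pi_nhds.2 fun i => tendsto_pi_nhds.2 fun j => h i j

/-- Together with `tendsto_of_abs_quad_sub_le` this rewrites convergence to a positive definite
matrix as (1 - ε)G ≤ M ≤ (1 + ε)G, the form that monotone homogeneous maps preserve. -/
lemma eventually_abs_quad_sub_le {ι : Type*} {l : Filter ι} {M : ι → Matrix (Fin n) (Fin n) ℂ}
    {G : Matrix (Fin n) (Fin n) ℂ} (hG : G.PosDef) (h : Tendsto M l (𝓝 G)) {ε : ℝ} (hε : 0 < ε) :
    ∀ᶠ k in l, ∀ v, |quad (M k) v - quad G v| ≤ ε * quad G v := by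
  obtain ⟨c, hc, hcG⟩ := quad_one_le hG
  have h0 : Tendsto (fun k => entrySum (M k - G)) l (𝓝 0) := by
    have := (continuous_entrySum (n := n)).continuousAt.tendsto.comp
      (h.sub (tendsto_const_nhds (x := G)))
    rw [sub_self, show entrySum (0 : Matrix (Fin n) (Fin n) ℂ) = 0 by simp [entrySum]] at this
    exact this
  filter_upwards [h0.eventually_lt_const (mul_pos hε hc)] with k hk v
  rw [← quad_sub]
  refine (abs_quad_le _ v).trans ?_
  have h2 := quad_nonneg (Matrix.PosSemidef.one (n := Fin n) (R := ℂ)) v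
  nlinarith [hcG v]

lemma tendsto_of_abs_quad_sub_le {ι : Type*} {l : Filter ι} {M : ι → Matrix (Fin n) (Fin n) ℂ}
    {G : Matrix (Fin n) (Fin n) ℂ} (hG : G.PosDef) (hM : ∀ᶠ k in l, (M k).IsHermitian)
    (h : ∀ ε : ℝ, 0 < ε → ∀ᶠ k in l, ∀ v, |quad (M k) v - quad G v| ≤ ε * quad G v) :
    Tendsto M l (𝓝 G) := by
  refine tendsto_matrix_iff.2 fun i j => Metric.tendsto_nhds.2 fun ε hε => ?_
  have ht : 0 ≤ G.trace.re := by
    rw [trace_eq_sum_quad]; exact Finset.sum_nonneg fun i _ => quad_nonneg hG.posSemidef _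
  have hpos : 0 < 3 * G.trace.re + 1 := by linarith
  filter_upwards [h (ε / (3 * G.trace.re + 1)) (by positivity), hM] with k hk hkM
  have := norm_apply_le_of_abs_quad (hkM.sub hG.1) hG.posSemidef
    (δ := ε / (3 * G.trace.re + 1)) (by positivity) (fun v => by rw [quad_sub]; exact hk v) i j
  rw [dist_eq_norm]
  refine lt_of_le_of_lt (by simpa using this) ?_
  rw [mul_div_assoc', div_lt_iff₀ hpos]
  nlinarith

lemma continuous_quad (v : Fin n → ℂ) :
    Continuous fun A : Matrix (Fin n) (Fin n) ℂ => quad A v := by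
  unfold quad
  fun_prop

lemma isHermitian_of_tendsto {M : ℕ → Matrix (Fin n) (Fin n) ℂ} {N : Matrix (Fin n) (Fin n) ℂ}
    (h : Tendsto M atTop (𝓝 N)) (hM : ∀ k, (M k).IsHermitian) : N.IsHermitian := by
  have h1 : Tendsto (fun k => (M k)ᴴ) atTop (𝓝 Nᴴ) :=
    (continuous_id.matrix_conjTranspose).continuousAt.tendsto.comp h
  exact tendsto_nhds_unique h1 (by simpa only [(hM _).eq] using h)

lemma tendsto_inv {M : ℕ → Matrix (Fin n) (Fin n) ℂ} {N : Matrix (Fin n) (Fin n) ℂ}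
    (h : Tendsto M atTop (𝓝 N)) (hN : N.PosDef) : Tendsto (fun k => (M k)⁻¹) atTop (𝓝 N⁻¹) := by
  have hd : N.det ≠ 0 := ((Matrix.isUnit_iff_isUnit_det _).1 hN.isUnit).ne_zero
  simp only [Matrix.inv_def, Ring.inverse_eq_inv']
  exact (((continuous_id.matrix_det).continuousAt.tendsto.comp h).inv₀ hd).smul
    ((continuous_id.matrix_adjugate).continuousAt.tendsto.comp h)

lemma exists_subseq_tendsto {M : ℕ → Matrix (Fin n) (Fin n) ℂ} {C : ℝ}
    (hM : ∀ k i j, ‖M k i j‖ ≤ C) :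
    ∃ (N : Matrix (Fin n) (Fin n) ℂ) (φ : ℕ → ℕ), StrictMono φ ∧
      Tendsto (M ∘ φ) atTop (𝓝 N) := by
  have hC : ∀ k, (M k : Fin n → Fin n → ℂ) ∈ Set.univ.pi fun _ : Fin n => Set.univ.pi
      fun _ : Fin n => Metric.closedBall (0 : ℂ) C := fun k i _ j _ => by
    simpa using hM k i j
  have hK : IsCompact (Set.univ.pi fun _ : Fin n => Set.univ.pi
      fun _ : Fin n => Metric.closedBall (0 : ℂ) C) :=
    isCompact_univ_pi fun _ => isCompact_univ_pi fun _ => isCompact_closedBall _ _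
  obtain ⟨N, -, φ, hφ, h⟩ := hK.tendsto_subseq hC
  exact ⟨N, φ, hφ, h⟩

end HermitianForm

section Stability

variable {n : ℕ}

/-! ### Integrals of matrix valued functions on the projective space -/

lemma herm_mulVec (B : Matrix (Fin n) (Fin n) ℂ) (z : Fin n → ℂ) :
    herm (B *ᵥ z) z = star z ⬝ᵥ B *ᵥ z := by
  rw [herm_eq, dotProduct_comm]

lemma isQuotientMap_mk : Topology.IsQuotientMap
    (fun v : {v : Fin n → ℂ // v ≠ 0} => (Projectivization.mk ℂ v.1 v.2 : ProjSpace n)) :=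
  isQuotientMap_quot_mk

lemma mem_projSubspace {S : Submodule ℂ (Fin n → ℂ)} {x : ProjSpace n} :
    x ∈ projSubspace S ↔ x.rep ∈ S := by
  rw [projSubspace, Set.mem_ofPred_eq, Projectivization.submodule_eq,
    Submodule.span_singleton_le_iff_mem]

lemma projSubspace_bot : projSubspace (⊥ : Submodule ℂ (Fin n → ℂ)) = ∅ := by
  ext x
  simp [mem_projSubspace, x.rep_nonzero]

lemma isClosed_projSubspace (S : Submodule ℂ (Fin n → ℂ)) : IsClosed (projSubspace S) := by
  rw [← isQuotientMap_mk.isClosed_preimage]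
  have : (fun v : {v : Fin n → ℂ // v ≠ 0} => (Projectivization.mk ℂ v.1 v.2 : ProjSpace n)) ⁻¹'
      projSubspace S = Subtype.val ⁻¹' (S : Set (Fin n → ℂ)) := by
    ext v
    simp [projSubspace, Projectivization.submodule_mk, Submodule.span_singleton_le_iff_mem]
  rw [this]
  exact S.closed_of_finiteDimensional.preimage continuous_subtype_val

lemma integrable_of_continuous (ν : Measure (ProjSpace n)) [IsFiniteMeasure ν] {E : Type*}
    [NormedAddCommGroup E] {f : ProjSpace n → E} (hf : Continuous f) : Integrable f ν :=
  hf.integrable_of_hasCompactSupport (HasCompactSupport.of_compactSpace _)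

/-- Linear functionals commute with entrywise integrals. -/
lemma map_entry_integral (ν : Measure (ProjSpace n)) [IsFiniteMeasure ν]
    {Φ : ProjSpace n → Matrix (Fin n) (Fin n) ℂ} (hΦ : ∀ i j, Continuous fun x => Φ x i j) (c : ℂ)
    (L : Matrix (Fin n) (Fin n) ℂ →ₗ[ℂ] ℂ) :
    L (Matrix.of fun i j => c * ∫ x, Φ x i j ∂ν) = c * ∫ x, L (Φ x) ∂ν := by
  have h : ∀ M : Matrix (Fin n) (Fin n) ℂ,
      L M = ∑ i, ∑ j, L (Matrix.single i j 1) * M i j := by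
    intro M
    conv_lhs => rw [Matrix.matrix_eq_sum_single M]
    simp only [map_sum]
    refine Finset.sum_congr rfl fun i _ => Finset.sum_congr rfl fun j _ => ?_
    rw [← mul_one (M i j), ← smul_eq_mul, ← Matrix.smul_single, map_smul, smul_eq_mul,
      smul_eq_mul, mul_comm, mul_one]
  rw [h]
  have h2 : ∀ x, L (Φ x) = ∑ i, ∑ j, L (Matrix.single i j 1) * Φ x i j := fun x => h _
  simp only [h2, Matrix.of_apply]
  rw [integral_finsetSum _ fun i _ => integrable_finsetSum _ fun j _ =>
    (integrable_of_continuous ν (hΦ i j)).const_mul _, Finset.mul_sum]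
  refine Finset.sum_congr rfl fun i _ => ?_
  rw [integral_finsetSum _ fun j _ => (integrable_of_continuous ν (hΦ i j)).const_mul _,
    Finset.mul_sum]
  refine Finset.sum_congr rfl fun j _ => ?_
  rw [integral_const_mul]
  ring

/-- The integrand `z z^* / ⟨G⁻¹ z, z⟩` of Donaldson's map. -/
def kern (G : Matrix (Fin n) (Fin n) ℂ) (x : ProjSpace n) : Matrix (Fin n) (Fin n) ℂ :=
  (herm (G⁻¹ *ᵥ x.rep) x.rep)⁻¹ • Matrix.vecMulVec x.rep (star x.rep)

lemma projector_eq_kern_mul (G : Matrix (Fin n) (Fin n) ℂ) (x : ProjSpace n) :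
    projector G x = kern G x * G⁻¹ := by
  ext i j
  simp only [projector, kern, dualProd, Matrix.of_apply, Matrix.smul_mul, Matrix.smul_apply,
    Matrix.vecMulVec_mul, Matrix.vecMulVec_apply, smul_eq_mul]
  have : herm (G⁻¹ *ᵥ Pi.single j 1) x.rep = (star x.rep ᵥ* G⁻¹) j := by
    simp [herm, Matrix.vecMul, dotProduct, mul_comm]
  rw [this]
  ring

lemma herm_inv_ne {G : Matrix (Fin n) (Fin n) ℂ} (hG : G.PosDef) (x : ProjSpace n) :
    herm (G⁻¹ *ᵥ x.rep) x.rep ≠ 0 := dualProd_self_ne hG x.rep_nonzero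

lemma kern_eq_projector_mul {G : Matrix (Fin n) (Fin n) ℂ} (hG : G.PosDef) (x : ProjSpace n) :
    kern G x = projector G x * G := by
  rw [projector_eq_kern_mul, Matrix.mul_assoc, inv_mul_of_posDef hG, Matrix.mul_one]

lemma continuous_kern {G : Matrix (Fin n) (Fin n) ℂ} (hG : G.PosDef) (i j : Fin n) :
    Continuous fun x => kern G x i j := by
  simp only [kern_eq_projector_mul hG, Matrix.mul_apply]
  exact continuous_finsetSum _ fun k _ => (continuous_projector hG i k).mul continuous_const

lemma herm_inv_eq_quad {G : Matrix (Fin n) (Fin n) ℂ} (hG : G.PosDef) (z : Fin n → ℂ) :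
    herm (G⁻¹ *ᵥ z) z = (quad G⁻¹ z : ℂ) := by
  rw [ofReal_quad hG.inv.1, herm_mulVec]

/-- The projector for the standard product is z z* / |z|², so |z|² cancels. -/
lemma donaldsonMap_eq (ν : Measure (ProjSpace n)) (G : Matrix (Fin n) (Fin n) ℂ) :
    donaldsonMap ν G = Matrix.of fun i j => (ratio ν : ℂ) * ∫ x, kern G x i j ∂ν := by
  ext i j
  simp only [donaldsonMap, Matrix.of_apply]
  congr 2
  ext x
  have h1 := herm_inv_ne (Matrix.PosDef.one (n := Fin n) (R := ℂ)) x
  rw [projector_eq_kern_mul, kern, kern]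
  simp only [inv_one, Matrix.one_mulVec, Matrix.mul_one, Matrix.smul_apply, smul_eq_mul] at h1 ⊢
  rw [div_eq_mul_inv]
  linear_combination (Matrix.vecMulVec x.rep (star x.rep) i j *
    (herm (G⁻¹ *ᵥ x.rep) x.rep)⁻¹) * inv_mul_cancel₀ h1

lemma map_donaldsonMap (ν : Measure (ProjSpace n)) [IsFiniteMeasure ν]
    {G : Matrix (Fin n) (Fin n) ℂ} (hG : G.PosDef) (L : Matrix (Fin n) (Fin n) ℂ →ₗ[ℂ] ℂ) :
    L (donaldsonMap ν G) = ratio ν * ∫ x, L (kern G x) ∂ν := by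
  rw [donaldsonMap_eq, map_entry_integral ν (continuous_kern hG)]

/-- The functional `M ↦ tr (B M)`. -/
def traceMul (B : Matrix (Fin n) (Fin n) ℂ) : Matrix (Fin n) (Fin n) ℂ →ₗ[ℂ] ℂ :=
  Matrix.traceLinearMap (Fin n) ℂ ℂ ∘ₗ LinearMap.mulLeft ℂ B

lemma traceMul_apply (B M : Matrix (Fin n) (Fin n) ℂ) : traceMul B M = (B * M).trace := rfl

lemma traceMul_kern {G : Matrix (Fin n) (Fin n) ℂ} (hG : G.PosDef) (B : Matrix (Fin n) (Fin n) ℂ)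
    (x : ProjSpace n) :
    traceMul B (kern G x) = (quad G⁻¹ x.rep : ℂ)⁻¹ * (star x.rep ⬝ᵥ B *ᵥ x.rep) := by
  rw [traceMul_apply, kern, Matrix.mul_smul, Matrix.trace_smul, Matrix.mul_vecMulVec,
    Matrix.trace_vecMulVec, herm_inv_eq_quad hG, dotProduct_comm, smul_eq_mul]

lemma continuous_map_kern {G : Matrix (Fin n) (Fin n) ℂ} (hG : G.PosDef)
    (L : Matrix (Fin n) (Fin n) ℂ →ₗ[ℂ] ℂ) : Continuous fun x => L (kern G x) := by
  have h1 : Continuous (fun x => (kern G x : Matrix (Fin n) (Fin n) ℂ)) :=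
    continuous_matrix fun i j => continuous_kern hG i j
  exact L.continuous_of_finiteDimensional.comp h1

lemma re_traceMul_kern {G : Matrix (Fin n) (Fin n) ℂ} (hG : G.PosDef)
    (B : Matrix (Fin n) (Fin n) ℂ) (x : ProjSpace n) :
    (traceMul B (kern G x)).re = quad B x.rep / quad G⁻¹ x.rep := by
  rw [traceMul_kern hG, ← Complex.ofReal_inv, Complex.re_ofReal_mul, quad, quad, div_eq_inv_mul]

lemma continuous_quad_div {G : Matrix (Fin n) (Fin n) ℂ} (hG : G.PosDef)
    (B : Matrix (Fin n) (Fin n) ℂ) :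
    Continuous fun x : ProjSpace n => quad B x.rep / quad G⁻¹ x.rep := by
  simp only [← re_traceMul_kern hG]
  exact Complex.continuous_re.comp (continuous_map_kern hG _)

/-- All information about T is extracted by pairing with a matrix B: rank one B gives the quadratic
form, B = G⁻¹ the trace identity. -/
lemma trace_mul_donaldsonMap (ν : Measure (ProjSpace n)) [IsFiniteMeasure ν]
    {G : Matrix (Fin n) (Fin n) ℂ} (hG : G.PosDef) (B : Matrix (Fin n) (Fin n) ℂ) :
    (B * donaldsonMap ν G).trace.re = ratio ν * ∫ x, quad B x.rep / quad G⁻¹ x.rep ∂ν := by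
  rw [← traceMul_apply, map_donaldsonMap ν hG, Complex.re_ofReal_mul]
  simp only [← re_traceMul_kern hG]
  congr 1
  exact (integral_re (integrable_of_continuous ν (continuous_map_kern hG (traceMul B)))).symm

lemma quad_eq_trace (M : Matrix (Fin n) (Fin n) ℂ) (v : Fin n → ℂ) :
    quad M v = (Matrix.vecMulVec v (star v) * M).trace.re := by
  rw [Matrix.vecMulVec_mul, Matrix.trace_vecMulVec, dotProduct_comm, ← Matrix.dotProduct_mulVec,
    quad]

lemma quad_vecMulVec (v z : Fin n → ℂ) :
    quad (Matrix.vecMulVec v (star v)) z = ‖star v ⬝ᵥ z‖ ^ 2 := by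
  have h : star z ⬝ᵥ v = star (star v ⬝ᵥ z) := by
    rw [Matrix.star_dotProduct]
  rw [quad, Matrix.vecMulVec_mulVec, dotProduct_smul, h, MulOpposite.smul_eq_mul_unop,
    MulOpposite.unop_op, Complex.star_def, mul_comm, Complex.mul_conj, Complex.ofReal_re,
    Complex.normSq_eq_norm_sq]

lemma quad_donaldsonMap (ν : Measure (ProjSpace n)) [IsFiniteMeasure ν]
    {G : Matrix (Fin n) (Fin n) ℂ} (hG : G.PosDef) (v : Fin n → ℂ) :
    quad (donaldsonMap ν G) v = ratio ν * ∫ x, ‖star v ⬝ᵥ x.rep‖ ^ 2 / quad G⁻¹ x.rep ∂ν := by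
  rw [quad_eq_trace, trace_mul_donaldsonMap ν hG]
  simp only [quad_vecMulVec]

lemma continuous_norm_sq_div {G : Matrix (Fin n) (Fin n) ℂ} (hG : G.PosDef) (v : Fin n → ℂ) :
    Continuous fun x : ProjSpace n => ‖star v ⬝ᵥ x.rep‖ ^ 2 / quad G⁻¹ x.rep := by
  simp only [← quad_vecMulVec]
  exact continuous_quad_div hG _

lemma donaldsonMap_isHermitian (ν : Measure (ProjSpace n))
    {G : Matrix (Fin n) (Fin n) ℂ} (hG : G.PosDef) : (donaldsonMap ν G).IsHermitian := by
  ext i j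
  rw [Matrix.conjTranspose_apply, donaldsonMap_eq]
  simp only [Matrix.of_apply]
  rw [star_mul', ← starRingEnd_apply (∫ x, _ ∂ν), ← integral_conj]
  congr 1
  · simp
  · congr 1
    ext x
    rw [kern, herm_inv_eq_quad hG]
    simp [Matrix.vecMulVec_apply, mul_comm]

lemma ratio_pos (ν : Measure (ProjSpace n)) [IsFiniteMeasure ν] (hn : n ≠ 0) (hν : ν ≠ 0) :
    0 < ratio ν := by
  have : 0 < ν.real Set.univ := by
    rw [measureReal_def, ENNReal.toReal_pos_iff]
    exact ⟨by simpa [pos_iff_ne_zero] using hν, measure_lt_top _ _⟩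
  have : 0 < (n : ℝ) := by positivity
  unfold ratio; positivity

lemma real_univ_pos (ν : Measure (ProjSpace n)) [IsFiniteMeasure ν] (hν : ν ≠ 0) :
    0 < ν.real Set.univ := by
  rw [measureReal_def, ENNReal.toReal_pos_iff]
  exact ⟨by simpa [pos_iff_ne_zero] using hν, measure_lt_top _ _⟩

lemma ratio_mul_real_univ (ν : Measure (ProjSpace n)) [IsFiniteMeasure ν] (hν : ν ≠ 0) :
    ratio ν * ν.real Set.univ = n := by
  rw [ratio, div_mul_cancel₀ _ (real_univ_pos ν hν).ne']

/-- The integrand is identically 1; this is where the normalization R = n / |ν| matters. -/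
lemma trace_inv_mul_donaldsonMap (ν : Measure (ProjSpace n)) [IsFiniteMeasure ν] (hν : ν ≠ 0)
    {G : Matrix (Fin n) (Fin n) ℂ} (hG : G.PosDef) : (G⁻¹ * donaldsonMap ν G).trace.re = n := by
  rw [trace_mul_donaldsonMap ν hG]
  have : ∀ x : ProjSpace n, quad G⁻¹ x.rep / quad G⁻¹ x.rep = 1 := fun x =>
    div_self (quad_pos hG.inv x.rep_nonzero).ne'
  simp only [this]
  rw [integral_const, smul_eq_mul, mul_one, ratio_mul_real_univ ν hν]

/-! ### Stable measures -/

/-- The stability condition `ν(Σ) / (dim Σ + 1) < |ν| / n` for proper projective subspaces. -/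
def IsStable (ν : Measure (ProjSpace n)) : Prop :=
  ∀ S : Submodule ℂ (Fin n → ℂ), S ≠ ⊥ → S ≠ ⊤ →
    ν.real (projSubspace S) / (Module.finrank ℂ S : ℝ) < ν.real Set.univ / (n : ℝ)

variable {ν : Measure (ProjSpace n)} [IsFiniteMeasure ν]

lemma ne_zero_of_measure_ne_zero (hν : ν ≠ 0) : n ≠ 0 := by
  rintro rfl
  apply hν
  have : IsEmpty (ProjSpace 0) := ⟨fun x => x.rep_nonzero (Subsingleton.elim _ _)⟩
  exact Measure.eq_zero_of_isEmpty ν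

lemma IsStable.real_lt (hs : IsStable ν) (hν : ν ≠ 0) {S : Submodule ℂ (Fin n → ℂ)} (h0 : S ≠ ⊥)
    (h1 : S ≠ ⊤) : ratio ν * ν.real (projSubspace S) < Module.finrank ℂ S := by
  have hn : (0 : ℝ) < n := by exact_mod_cast Nat.pos_of_ne_zero (ne_zero_of_measure_ne_zero hν)
  have hS : (0 : ℝ) < Module.finrank ℂ S := by
    have : 0 < Module.finrank ℂ S :=
      Module.finrank_pos_iff.2 (Submodule.nontrivial_iff_ne_bot.2 h0)
    exact_mod_cast this
  have h := hs S h0 h1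
  rw [div_lt_div_iff₀ hS hn] at h
  rw [ratio, div_mul_eq_mul_div, div_lt_iff₀ (real_univ_pos ν hν)]
  linarith

lemma IsStable.not_ae_mem (hs : IsStable ν) (hν : ν ≠ 0) {S : Submodule ℂ (Fin n → ℂ)}
    (h1 : S ≠ ⊤) : ¬ ∀ᵐ x ∂ν, x ∈ projSubspace S := by
  intro h
  have hfull : ν.real (projSubspace S) = ν.real Set.univ := by
    refine measureReal_congr ?_
    filter_upwards [h] with x hx
    exact propext ⟨fun _ => trivial, fun _ => hx⟩
  by_cases h0 : S = ⊥
  · subst h0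
    rw [projSubspace_bot, measureReal_empty] at hfull
    exact (real_univ_pos ν hν).ne hfull
  · have := hs.real_lt hν h0 h1
    rw [hfull, ratio_mul_real_univ ν hν] at this
    have hle := Submodule.finrank_le S
    simp only [Module.finrank_fin_fun] at hle
    exact absurd this (not_lt.2 (by exact_mod_cast hle))

/-- Stability bounds R times each mass by the dimension, strictly for S, so together the two
subspaces carry less than R⁻¹ n = |ν|. -/
lemma IsStable.not_ae_mem_or (hs : IsStable ν) (hν : ν ≠ 0) {S S' : Submodule ℂ (Fin n → ℂ)}
    (h0 : S ≠ ⊥) (h1 : S ≠ ⊤) (hd : Module.finrank ℂ S + Module.finrank ℂ S' ≤ n) :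
    ¬ ∀ᵐ x ∂ν, x ∈ projSubspace S ∨ x ∈ projSubspace S' := by
  intro h
  have hS : 0 < Module.finrank ℂ S :=
    Module.finrank_pos_iff.2 (Submodule.nontrivial_iff_ne_bot.2 h0)
  have h1' : S' ≠ ⊤ := by
    rintro rfl
    simp only [finrank_top, Module.finrank_fin_fun] at hd
    omega
  have hfull : ν.real (projSubspace S ∪ projSubspace S') = ν.real Set.univ := by
    refine measureReal_congr ?_
    filter_upwards [h] with x hx
    exact propext ⟨fun _ => trivial, fun _ => hx⟩
  have hu := measureReal_union_le (μ := ν) (projSubspace S) (projSubspace S')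
  rw [hfull] at hu
  have hR := ratio_pos ν (ne_zero_of_measure_ne_zero hν) hν
  have h3 := hs.real_lt hν h0 h1
  have h4 : ratio ν * ν.real (projSubspace S') ≤ Module.finrank ℂ S' := by
    by_cases h0' : S' = ⊥
    · simp [h0', projSubspace_bot]
    · exact (hs.real_lt hν h0' h1').le
  have h5 := ratio_mul_real_univ ν hν
  have h6 := mul_le_mul_of_nonneg_left hu hR.le
  have h7 : (Module.finrank ℂ S : ℝ) + Module.finrank ℂ S' ≤ n := by exact_mod_cast hd
  linarith

/-- The kernel of a matrix. -/
abbrev matKer (A : Matrix (Fin n) (Fin n) ℂ) : Submodule ℂ (Fin n → ℂ) := LinearMap.ker A.mulVecLin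

lemma mem_matKer {A : Matrix (Fin n) (Fin n) ℂ} {v : Fin n → ℂ} : v ∈ matKer A ↔ A *ᵥ v = 0 := by
  simp [matKer]

lemma matKer_eq_top {A : Matrix (Fin n) (Fin n) ℂ} : matKer A = ⊤ ↔ A = 0 := by
  constructor
  · intro h
    refine eq_of_mulVec_eq fun v => ?_
    rw [Matrix.zero_mulVec, ← mem_matKer, h]
    trivial
  · rintro rfl
    ext v
    simp

/-- The orthogonal of a set for the standard Hermitian product. -/
def orth (s : Set (Fin n → ℂ)) : Submodule ℂ (Fin n → ℂ) where
  carrier := {z | ∀ v ∈ s, star v ⬝ᵥ z = 0}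
  zero_mem' v _ := dotProduct_zero _
  add_mem' ha hb v hv := by rw [dotProduct_add, ha v hv, hb v hv, add_zero]
  smul_mem' c z hz v hv := by rw [dotProduct_smul, hz v hv, smul_zero]

lemma mem_orth {s : Set (Fin n → ℂ)} {z : Fin n → ℂ} :
    z ∈ orth s ↔ ∀ v ∈ s, star v ⬝ᵥ z = 0 := Iff.rfl

lemma orth_ne_top {s : Set (Fin n → ℂ)} {v : Fin n → ℂ} (hs : v ∈ s) (hv : v ≠ 0) :
    orth s ≠ ⊤ := by
  intro h
  have : v ∈ orth s := h ▸ Submodule.mem_top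
  exact hv (dotProduct_star_self_eq_zero.1 (this v hs))

/-- A null vector v of T(G) would be orthogonal to almost every line, putting ν on a proper
subspace. -/
lemma donaldsonMap_posDef (hs : IsStable ν) (hν : ν ≠ 0)
    {G : Matrix (Fin n) (Fin n) ℂ} (hG : G.PosDef) : (donaldsonMap ν G).PosDef := by
  refine posDef_of_quad (donaldsonMap_isHermitian ν hG) fun v hv => ?_
  rw [quad_donaldsonMap ν hG]
  refine mul_pos (ratio_pos ν (ne_zero_of_measure_ne_zero hν) hν) ?_
  have hnn : ∀ x : ProjSpace n, 0 ≤ ‖star v ⬝ᵥ x.rep‖ ^ 2 / quad G⁻¹ x.rep := fun x =>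
    div_nonneg (by positivity) (quad_pos hG.inv x.rep_nonzero).le
  refine lt_of_le_of_ne (integral_nonneg hnn) fun h => ?_
  refine hs.not_ae_mem hν (orth_ne_top (Set.mem_singleton v) hv) ?_
  have := (integral_eq_zero_iff_of_nonneg hnn
    (integrable_of_continuous ν (continuous_norm_sq_div hG v))).1 h.symm
  filter_upwards [this] with x hx
  rw [mem_projSubspace, mem_orth]
  rintro _ rfl
  simpa [(quad_pos hG.inv x.rep_nonzero).ne'] using hx

lemma donaldsonMap_mono (hν : ν ≠ 0) {G G' : Matrix (Fin n) (Fin n) ℂ} (hG : G.PosDef)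
    (hG' : G'.PosDef) (h : ∀ v, quad G v ≤ quad G' v) (v : Fin n → ℂ) :
    quad (donaldsonMap ν G) v ≤ quad (donaldsonMap ν G') v := by
  rw [quad_donaldsonMap ν hG, quad_donaldsonMap ν hG']
  refine mul_le_mul_of_nonneg_left (integral_mono
    (integrable_of_continuous ν (continuous_norm_sq_div hG v))
    (integrable_of_continuous ν (continuous_norm_sq_div hG' v)) fun x => ?_)
    (ratio_pos ν (ne_zero_of_measure_ne_zero hν) hν).le
  exact div_le_div_of_nonneg_left (by positivity) (quad_pos hG'.inv x.rep_nonzero)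
    (quad_inv_anti hG hG' h _)

lemma donaldsonMap_smul {G : Matrix (Fin n) (Fin n) ℂ} (hG : G.PosDef) {c : ℝ} (hc : 0 < c) :
    donaldsonMap ν (c • G) = c • donaldsonMap ν G := by
  refine eq_of_quad_eq (donaldsonMap_isHermitian ν (posDef_smul hG hc))
    (isHermitian_smul (donaldsonMap_isHermitian ν hG) c) fun v => ?_
  rw [quad_smul, quad_donaldsonMap ν (posDef_smul hG hc), quad_donaldsonMap ν hG, mul_left_comm]
  refine congrArg (ratio ν * ·) ((integral_congr_ae (Eventually.of_forall fun x => ?_)).trans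
    (integral_const_mul c _))
  rw [inv_real_smul hG hc.ne', quad_smul]
  have := (quad_pos hG.inv x.rep_nonzero).ne'
  field_simp

/-- Continuity comes from order alone: (1 - δ)G ≤ M ≤ (1 + δ)G passes through T by monotonicity and
homogeneity. -/
lemma tendsto_donaldsonMap (hs : IsStable ν) (hν : ν ≠ 0) {ι : Type*} {l : Filter ι}
    {M : ι → Matrix (Fin n) (Fin n) ℂ} {G : Matrix (Fin n) (Fin n) ℂ} (hG : G.PosDef)
    (hM : ∀ k, (M k).PosDef) (h : Tendsto M l (𝓝 G)) :
    Tendsto (fun k => donaldsonMap ν (M k)) l (𝓝 (donaldsonMap ν G)) := by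
  refine tendsto_of_abs_quad_sub_le (donaldsonMap_posDef hs hν hG)
    (Eventually.of_forall fun k => donaldsonMap_isHermitian ν (hM k)) fun ε hε => ?_
  -- The cap 1/2 keeps 1 - δ positive, so that (1 - δ)G is positive definite.
  have hδ : 0 < min ε (1 / 2) := by positivity
  have hδ1 : 0 < 1 - min ε (1 / 2) := by linarith [min_le_right ε (1 / 2)]
  have hδ2 : 0 < 1 + min ε (1 / 2) := by linarith
  filter_upwards [eventually_abs_quad_sub_le hG h hδ] with k hk v
  have h1 := donaldsonMap_mono hν (posDef_smul hG hδ1) (hM k)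
    (fun w => by rw [quad_smul]; linarith [abs_le.1 (hk w)]) v
  have h2 := donaldsonMap_mono hν (hM k) (posDef_smul hG hδ2)
    (fun w => by rw [quad_smul]; linarith [abs_le.1 (hk w)]) v
  rw [donaldsonMap_smul hG hδ1, quad_smul] at h1
  rw [donaldsonMap_smul hG hδ2, quad_smul] at h2
  have h3 := quad_nonneg (donaldsonMap_posDef hs hν hG).posSemidef v
  have h4 := mul_le_mul_of_nonneg_right (min_le_left ε (1 / 2)) h3
  rw [abs_le]
  constructor <;> linarith

end Stability

section Existence

variable {n m : ℕ}

/-! ### Compactness -/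

/-- With A = C*C, the trace is that of the positive semidefinite matrix C B C*. -/
lemma trace_mul_nonneg {A B : Matrix (Fin n) (Fin n) ℂ} (hA : A.PosSemidef) (hB : B.PosSemidef) :
    0 ≤ (A * B).trace.re := by
  obtain ⟨C, rfl⟩ : ∃ C : Matrix (Fin n) (Fin n) ℂ, A = Cᴴ * C := by
    open scoped MatrixOrder in
    exact CStarAlgebra.nonneg_iff_eq_star_mul_self.mp hA.nonneg
  rw [Matrix.mul_assoc, Matrix.trace_mul_comm]
  exact (Complex.le_def.1 (hB.mul_mul_conjTranspose_same C).trace_nonneg).1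

lemma trace_mul_mono {A B B' : Matrix (Fin n) (Fin n) ℂ} (hA : A.PosSemidef) (hB : B.IsHermitian)
    (hB' : B'.IsHermitian) (h : ∀ v, quad B v ≤ quad B' v) :
    (A * B).trace.re ≤ (A * B').trace.re := by
  have := trace_mul_nonneg hA (posSemidef_of_quad (hB'.sub hB) fun v => by
    rw [quad_sub]; linarith [h v])
  rw [Matrix.mul_sub, Matrix.trace_sub, Complex.sub_re] at this
  linarith

/-! ### Compressions to the kernel of a Hermitian matrix. -/

/-- The kernel of a Hermitian matrix is spanned by the orthonormal columns of a matrix. -/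
lemma exists_isometry_onto_ker {N : Matrix (Fin n) (Fin n) ℂ} (hN : N.IsHermitian) :
    ∃ V : Matrix (Fin n) (Fin (Module.finrank ℂ (matKer N))) ℂ, Vᴴ * V = 1 ∧ N * V = 0 := by
  classical
  have hcard : Fintype.card {i // hN.eigenvalues i = 0} = Module.finrank ℂ (matKer N) := by
    have h1 : N.rank + Module.finrank ℂ (matKer N) = _ :=
      LinearMap.finrank_range_add_finrank_ker N.mulVecLin
    rw [hN.rank_eq_card_non_zero_eigs, Fintype.card_subtype_compl, Module.finrank_fin_fun,
      Fintype.card_fin] at h1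
    have h3 := Fintype.card_subtype_le fun i => hN.eigenvalues i = 0
    rw [Fintype.card_fin] at h3
    omega
  let e := (Fintype.equivFinOfCardEq hcard).symm
  let U : Matrix (Fin n) (Fin n) ℂ := hN.eigenvectorUnitary
  have hU : Uᴴ * U = 1 := Unitary.coe_star_mul_self hN.eigenvectorUnitary
  refine ⟨U.submatrix id fun k => (e k).1, ?_, ?_⟩
  · ext i j
    have := congrFun (congrFun hU (e i).1) (e j).1
    rw [Matrix.mul_apply] at this ⊢
    simp only [Matrix.conjTranspose_apply, Matrix.submatrix_apply, id] at this ⊢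
    rw [this, Matrix.one_apply, Matrix.one_apply]
    simp [Subtype.ext_iff.symm]
  · ext i j
    have h1 := hN.mulVec_eigenvectorBasis (e j).1
    rw [(e j).2, zero_smul, ← hN.eigenvectorUnitary_col_eq] at h1
    exact congrFun h1 i

lemma isometry_injective {V : Matrix (Fin n) (Fin m) ℂ} (hV : Vᴴ * V = 1) :
    Function.Injective V.mulVec := by
  intro a b h
  have := congrArg (Vᴴ *ᵥ ·) h
  simpa [Matrix.mulVec_mulVec, hV] using this

/-- The extension by zero of the inverse of the compression of `G` to the range of `V`. -/
def compInv (G : Matrix (Fin n) (Fin n) ℂ) (V : Matrix (Fin n) (Fin m) ℂ) :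
    Matrix (Fin n) (Fin n) ℂ := V * (Vᴴ * G * V)⁻¹ * Vᴴ

lemma compInv_posSemidef {G : Matrix (Fin n) (Fin n) ℂ} (hG : G.PosDef)
    {V : Matrix (Fin n) (Fin m) ℂ} (hV : Vᴴ * V = 1) : (compInv G V).PosSemidef :=
  (hG.conjTranspose_mul_mul_same
    (isometry_injective hV)).inv.posSemidef.mul_mul_conjTranspose_same V

lemma quad_compInv (G : Matrix (Fin n) (Fin n) ℂ) (V : Matrix (Fin n) (Fin m) ℂ) (z : Fin n → ℂ) :
    quad (compInv G V) z = quad (Vᴴ * G * V)⁻¹ (Vᴴ *ᵥ z) := by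
  rw [quad, quad, compInv, ← Matrix.mulVec_mulVec, ← Matrix.mulVec_mulVec, Matrix.dotProduct_mulVec,
    Matrix.star_mulVec, Matrix.conjTranspose_conjTranspose]

lemma trace_compInv_mul {G : Matrix (Fin n) (Fin n) ℂ} (hG : G.PosDef)
    {V : Matrix (Fin n) (Fin m) ℂ} (hV : Vᴴ * V = 1) : (compInv G V * G).trace = m := by
  have hP := hG.conjTranspose_mul_mul_same (isometry_injective hV)
  rw [compInv, Matrix.mul_assoc, Matrix.mul_assoc, Matrix.trace_mul_comm, Matrix.mul_assoc,
    inv_mul_of_posDef hP, Matrix.trace_one, Fintype.card_fin]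

/-- The left side is the Legendre supremum restricted to the range of V, the right side the same
supremum over all vectors. -/
lemma quad_compInv_le {G : Matrix (Fin n) (Fin n) ℂ} (hG : G.PosDef)
    {V : Matrix (Fin n) (Fin m) ℂ} (hV : Vᴴ * V = 1) (z : Fin n → ℂ) :
    quad (compInv G V) z ≤ quad G⁻¹ z := by
  have hP := hG.conjTranspose_mul_mul_same (isometry_injective hV)
  rw [quad_compInv, ← two_re_sub_quad_eq hP]
  set w := (Vᴴ * G * V)⁻¹ *ᵥ (Vᴴ *ᵥ z)
  have h := two_re_sub_quad_le hG z (V *ᵥ w)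
  have h1 : star (V *ᵥ w) ⬝ᵥ z = star w ⬝ᵥ Vᴴ *ᵥ z := by
    rw [Matrix.star_mulVec, Matrix.dotProduct_mulVec]
  have h2 : quad G (V *ᵥ w) = quad (Vᴴ * G * V) w := by
    rw [quad, quad, ← Matrix.mulVec_mulVec, ← Matrix.mulVec_mulVec, Matrix.star_mulVec,
      ← Matrix.dotProduct_mulVec]
  rwa [h1, h2] at h

/-- `compInv G V` depends on z only through its projection V V* z, to which the previous bound
applies. -/
lemma quad_compInv_le_comp {G : Matrix (Fin n) (Fin n) ℂ} (hG : G.PosDef)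
    {V : Matrix (Fin n) (Fin m) ℂ} (hV : Vᴴ * V = 1) (z : Fin n → ℂ) :
    quad (compInv G V) z ≤ quad G⁻¹ (V *ᵥ (Vᴴ *ᵥ z)) := by
  refine le_trans (le_of_eq ?_) (quad_compInv_le hG hV _)
  rw [quad_compInv, quad_compInv, Matrix.mulVec_mulVec (Vᴴ *ᵥ z), hV, Matrix.one_mulVec]

/-! ### The regularized equation and degenerating sequences. -/

/-- The regularized map `(1 - ε) T_ν(G) + ε`. -/
def regMap (ν : Measure (ProjSpace n)) (ε : ℝ) (G : Matrix (Fin n) (Fin n) ℂ) :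
    Matrix (Fin n) (Fin n) ℂ := (1 - ε) • donaldsonMap ν G + ε • (1 : Matrix (Fin n) (Fin n) ℂ)

lemma quad_regMap (ν : Measure (ProjSpace n)) (ε : ℝ) (G : Matrix (Fin n) (Fin n) ℂ)
    (v : Fin n → ℂ) :
    quad (regMap ν ε G) v = (1 - ε) * quad (donaldsonMap ν G) v + ε * quad 1 v := by
  rw [regMap, quad_add, quad_smul, quad_smul]

lemma regMap_isHermitian (ν : Measure (ProjSpace n)) (ε : ℝ) {G : Matrix (Fin n) (Fin n) ℂ}
    (hG : G.PosDef) :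
    (regMap ν ε G).IsHermitian :=
  (isHermitian_smul (donaldsonMap_isHermitian ν hG) _).add
        (isHermitian_smul Matrix.isHermitian_one _)

variable {ν : Measure (ProjSpace n)} [IsFiniteMeasure ν]

lemma posSemidef_of_tendsto {H : ℕ → Matrix (Fin n) (Fin n) ℂ} {N : Matrix (Fin n) (Fin n) ℂ}
    (hH : ∀ k, (H k).PosDef) (hN : Tendsto H atTop (𝓝 N)) : N.PosSemidef :=
  posSemidef_of_quad (isHermitian_of_tendsto hN fun k => (hH k).1) fun v =>
    ge_of_tendsto' ((continuous_quad v).continuousAt.tendsto.comp hN)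
      fun k => quad_nonneg (hH k).posSemidef v

/-- A degenerate limit of (regularized) subsolutions contradicts stability. -/
lemma posDef_of_tendsto (hs : IsStable ν) (hν : ν ≠ 0) {H : ℕ → Matrix (Fin n) (Fin n) ℂ}
    {N : Matrix (Fin n) (Fin n) ℂ} (hH : ∀ k, (H k).PosDef) (hN : Tendsto H atTop (𝓝 N))
    (hN0 : N ≠ 0) {ε : ℕ → ℝ} (hε0 : ∀ k, 0 ≤ ε k) (hε1 : ∀ k, ε k ≤ 1)
    (hle : ∀ k v, quad (H k)⁻¹ v ≤
      quad ((1 - ε k) • donaldsonMap ν (H k)⁻¹ + ε k • (1 : Matrix (Fin n) (Fin n) ℂ)) v) :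
    N.PosDef := by
  have hNs := posSemidef_of_tendsto hH hN
  have hq : ∀ v, Tendsto (fun k => quad (H k) v) atTop (𝓝 (quad N v)) := fun v =>
    (continuous_quad v).continuousAt.tendsto.comp hN
  by_contra hnd
  have hbot : matKer N ≠ ⊥ := by
    intro h
    refine hnd (posDef_of_quad hNs.1 fun v hv => lt_of_le_of_ne (quad_nonneg hNs v) fun h0 => hv ?_)
    have : v ∈ matKer N := mem_matKer.2 (mulVec_eq_zero_of_quad hNs h0.symm)
    rwa [h, Submodule.mem_bot] at this
  have htop : matKer N ≠ ⊤ := fun h => hN0 (matKer_eq_top.1 h)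
  obtain ⟨V, hV, hNV⟩ := exists_isometry_onto_ker hNs.1
  -- The test matrix: it is supported on ker N, pairs with (H k)⁻¹ to exactly dim ker N, is
  -- dominated by H k, and tends to 0.
  let W := fun k => compInv (H k)⁻¹ V
  have hW0 : ∀ k z, 0 ≤ quad (W k) z := fun k => quad_nonneg (compInv_posSemidef (hH k).inv hV)
  have hWH : ∀ k z, quad (W k) z ≤ quad (H k) z := fun k z => by
    have := quad_compInv_le (hH k).inv hV z
    rwa [inv_inv_of_posDef (hH k)] at this
  have hWlim : ∀ z, Tendsto (fun k => quad (W k) z) atTop (𝓝 0) := fun z => by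
    have h0 : quad N (V *ᵥ (Vᴴ *ᵥ z)) = 0 := by
      rw [quad, Matrix.mulVec_mulVec (Vᴴ *ᵥ z), hNV, Matrix.zero_mulVec, dotProduct_zero,
        Complex.zero_re]
    refine squeeze_zero (fun k => hW0 k z) (fun k => ?_) (h0 ▸ hq (V *ᵥ (Vᴴ *ᵥ z)))
    have := quad_compInv_le_comp (hH k).inv hV z
    rwa [inv_inv_of_posDef (hH k)] at this
  have htr : Tendsto (fun k => (W k).trace.re) atTop (𝓝 0) := by
    simp only [trace_eq_sum_quad]
    simpa using tendsto_finsetSum Finset.univ fun i _ => hWlim (Pi.single i 1)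
  let K := projSubspace (matKer N)
  have hKm : MeasurableSet K := (isClosed_projSubspace _).measurableSet
  let g : ℕ → ProjSpace n → ℝ := fun k x => quad (W k) x.rep / quad (H k) x.rep
  have hgc : ∀ k, Continuous (g k) := fun k => by
    have := continuous_quad_div (hH k).inv (W k)
    rwa [inv_inv_of_posDef (hH k)] at this
  have hg0 : ∀ k x, 0 ≤ g k x := fun k x =>
    div_nonneg (hW0 k _) (quad_pos (hH k) x.rep_nonzero).le
  have hg1 : ∀ k x, g k x ≤ 1 := fun k x =>
    (div_le_one (quad_pos (hH k) x.rep_nonzero)).2 (hWH k _)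
  have hint : ∀ k, Integrable (g k) ν := fun k => integrable_of_continuous ν (hgc k)
  -- Off ℙ(ker N) the denominator has a positive limit while the numerator tends to 0; the constant
  -- 1 dominates.
  have hcompl : Tendsto (fun k => ∫ x in Kᶜ, g k x ∂ν) atTop (𝓝 0) := by
    have := MeasureTheory.tendsto_integral_of_dominated_convergence (μ := ν.restrict Kᶜ) (F := g)
      (f := fun _ => 0) (fun _ => (1 : ℝ)) (fun k => (hgc k).aestronglyMeasurable)
      (integrable_const 1) (fun k => Eventually.of_forall fun x => by
        rw [Real.norm_of_nonneg (hg0 k x)]; exact hg1 k x) ?_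
    · simpa using this
    · filter_upwards [ae_restrict_mem hKm.compl] with x hx
      have hx' : quad N x.rep ≠ 0 := fun h => hx (mem_projSubspace.2 (mem_matKer.2
        (mulVec_eq_zero_of_quad hNs h)))
      have h := (hWlim x.rep).div (hq x.rep) hx'
      rw [zero_div] at h
      exact h
  have hR := ratio_pos ν (ne_zero_of_measure_ne_zero hν) hν
  -- The subsolution inequality is paired with W k. On ℙ(ker N) the integrand is only bounded by 1,
  -- which produces the mass ν(ℙ(ker N)); in the limit nothing else survives, against stability.
  have hbound : ∀ k, (Module.finrank ℂ (matKer N) : ℝ) ≤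
      ratio ν * (ν.real K + ∫ x in Kᶜ, g k x ∂ν) + (W k).trace.re := by
    intro k
    have h1 : ((W k) * (H k)⁻¹).trace.re = Module.finrank ℂ (matKer N) := by
      rw [trace_compInv_mul (hH k).inv hV, Complex.natCast_re]
    have h2 := trace_mul_mono (compInv_posSemidef (hH k).inv hV) (hH k).inv.1
      ((isHermitian_smul (donaldsonMap_isHermitian ν (hH k).inv) _).add
        (isHermitian_smul Matrix.isHermitian_one _)) (hle k)
    change ((W k) * _).trace.re ≤ ((W k) * _).trace.re at h2
    rw [h1, Matrix.mul_add, Matrix.mul_smul, Matrix.mul_smul, Matrix.trace_add, Matrix.trace_smul,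
      Matrix.trace_smul, Matrix.mul_one, Complex.add_re, Complex.smul_re, Complex.smul_re,
      trace_mul_donaldsonMap ν (hH k).inv, inv_inv_of_posDef (hH k), smul_eq_mul,
      smul_eq_mul] at h2
    change _ ≤ (1 - ε k) * (ratio ν * ∫ x, g k x ∂ν) + ε k * (W k).trace.re at h2
    have h3 : 0 ≤ ∫ x, g k x ∂ν := integral_nonneg (hg0 k)
    have h4 : 0 ≤ (W k).trace.re := by
      rw [trace_eq_sum_quad]; exact Finset.sum_nonneg fun i _ => hW0 k _
    have h5 : ∫ x, g k x ∂ν ≤ ν.real K + ∫ x in Kᶜ, g k x ∂ν := by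
      rw [← integral_add_compl hKm (hint k)]
      gcongr
      calc ∫ x in K, g k x ∂ν ≤ ∫ x in K, (1 : ℝ) ∂ν :=
            setIntegral_mono (hint k).integrableOn (integrable_const _).integrableOn (hg1 k)
        _ = ν.real K := by simp
    have h6 := mul_le_mul_of_nonneg_left h5 hR.le
    nlinarith [mul_nonneg (hε0 k) (mul_nonneg hR.le h3), mul_nonneg (sub_nonneg.2 (hε1 k)) h4]
  have hlim := ge_of_tendsto' (((tendsto_const_nhds (x := ν.real K)).add hcompl).const_mul
    (ratio ν) |>.add htr) hbound
  rw [add_zero, add_zero] at hlim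
  exact absurd (hs.real_lt hν hbot htop) (not_lt.2 hlim)

/-! ### Existence of a fixed point -/

lemma trace_mul_regMap (hν : ν ≠ 0) (ε : ℝ) {H : Matrix (Fin n) (Fin n) ℂ} (hH : H.PosDef) :
    (H * regMap ν ε H⁻¹).trace.re = (1 - ε) * n + ε * H.trace.re := by
  have := trace_inv_mul_donaldsonMap ν hν hH.inv
  rw [inv_inv_of_posDef hH] at this
  rw [regMap, Matrix.mul_add, Matrix.mul_smul, Matrix.mul_smul, Matrix.trace_add, Matrix.trace_smul,
    Matrix.trace_smul, Matrix.mul_one, Complex.add_re, Complex.smul_re, Complex.smul_re, this,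
    smul_eq_mul, smul_eq_mul]

/-- Inverses of subsolutions of the regularized equation. -/
def subsolutions (ν : Measure (ProjSpace n)) (ε : ℝ) : Set (Matrix (Fin n) (Fin n) ℂ) :=
  {H | H.PosDef ∧ (∀ v, quad H v ≤ ε⁻¹ * quad 1 v) ∧ ∀ v, quad H⁻¹ v ≤ quad (regMap ν ε H⁻¹) v}

/-- Pairing the inequality with H gives n ≤ (1 - ε) n + ε tr H. The term ε is what makes this
informative: at ε = 0 it reads n ≤ n. -/
lemma le_trace_of_mem_subsolutions (hν : ν ≠ 0) {ε : ℝ} (hε : 0 < ε)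
    {H : Matrix (Fin n) (Fin n) ℂ} (hH : H ∈ subsolutions ν ε) : (n : ℝ) ≤ H.trace.re := by
  obtain ⟨hp, -, h⟩ := hH
  have h1 := trace_mul_mono hp.posSemidef hp.inv.1 (regMap_isHermitian ν ε hp.inv) h
  rw [mul_inv_of_posDef hp, trace_mul_regMap hν ε hp, Matrix.trace_one, Fintype.card_fin,
    Complex.natCast_re] at h1
  by_contra hlt
  push Not at hlt
  nlinarith

lemma tendsto_quad_regMap (hs : IsStable ν) (hν : ν ≠ 0) {H : ℕ → Matrix (Fin n) (Fin n) ℂ}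
    {N : Matrix (Fin n) (Fin n) ℂ} (hH : ∀ k, (H k).PosDef) (hN : Tendsto H atTop (𝓝 N))
    (hNp : N.PosDef) {ε : ℕ → ℝ} {δ : ℝ} (hε : Tendsto ε atTop (𝓝 δ)) (v : Fin n → ℂ) :
    Tendsto (fun k => quad (regMap ν (ε k) (H k)⁻¹) v) atTop (𝓝 (quad (regMap ν δ N⁻¹) v)) := by
  simp only [quad_regMap]
  have h1 := tendsto_donaldsonMap hs hν hNp.inv (fun k => (hH k).inv) (tendsto_inv hN hNp)
  exact (((tendsto_const_nhds.sub hε).mul ((continuous_quad v).continuousAt.tendsto.comp h1)).add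
    (hε.mul tendsto_const_nhds))

/-- The bound by ε⁻¹ makes a minimizing sequence precompact, the trace bound keeps its limit
nonzero, and `posDef_of_tendsto` keeps it invertible. -/
lemma exists_min_subsolution (hs : IsStable ν) (hν : ν ≠ 0) {ε : ℝ} (hε : 0 < ε) (hε1 : ε ≤ 1) :
    ∃ H ∈ subsolutions ν ε, ∀ H' ∈ subsolutions ν ε, H.trace.re ≤ H'.trace.re := by
  have hn := ne_zero_of_measure_ne_zero hν
  let t : Set ℝ := (fun H : Matrix (Fin n) (Fin n) ℂ => H.trace.re) '' subsolutions ν ε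
  have hne : t.Nonempty := by
    -- The witness corresponds to G = ε, a subsolution because the regularized map always dominates
    -- ε.
    have hp := posDef_smul (Matrix.PosDef.one (n := Fin n) (R := ℂ)) (inv_pos.2 hε)
    refine ⟨_, ε⁻¹ • (1 : Matrix (Fin n) (Fin n) ℂ), ⟨hp, fun v => ?_, fun v => ?_⟩, rfl⟩
    · rw [quad_smul]
    · rw [quad_regMap, inv_real_smul Matrix.PosDef.one (inv_pos.2 hε).ne', inv_inv, inv_one,
        quad_smul]
      have := quad_nonneg (donaldsonMap_posDef hs hν
        (posDef_smul (Matrix.PosDef.one (n := Fin n) (R := ℂ)) hε)).posSemidef v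
      nlinarith
  have hbdd : BddBelow t := ⟨n, by
    rintro _ ⟨H, hH, rfl⟩
    exact le_trace_of_mem_subsolutions hν hε hH⟩
  obtain ⟨u, -, hu, hut⟩ := exists_seq_tendsto_sInf hne hbdd
  choose H hH hHu using hut
  have hb : ∀ k i j, ‖H k i j‖ ≤ (ε⁻¹ • (1 : Matrix (Fin n) (Fin n) ℂ)).trace.re := fun k i j =>
    (norm_apply_le_trace (hH k).1.posSemidef i j).trans
      (trace_mono fun v => by rw [quad_smul]; exact (hH k).2.1 v)
  obtain ⟨N, φ, hφ, hN⟩ := exists_subseq_tendsto hb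
  have htrN : Tendsto (fun k => ((H ∘ φ) k).trace.re) atTop (𝓝 N.trace.re) :=
    (Complex.continuous_re.comp (continuous_id.matrix_trace)).continuousAt.tendsto.comp hN
  have hNn : (n : ℝ) ≤ N.trace.re := ge_of_tendsto' htrN fun k =>
    le_trace_of_mem_subsolutions hν hε (hH _)
  have hN0 : N ≠ 0 := by
    rintro rfl
    simp at hNn
    exact hn hNn
  have hNp : N.PosDef := posDef_of_tendsto hs hν (fun k => (hH (φ k)).1) hN hN0
    (ε := fun _ => ε) (fun _ => hε.le) (fun _ => hε1) fun k v => (hH (φ k)).2.2 v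
  refine ⟨N, ⟨hNp, fun v => ?_, fun v => ?_⟩, fun H' hH' => ?_⟩
  · exact le_of_tendsto' ((continuous_quad v).continuousAt.tendsto.comp hN)
      fun k => (hH (φ k)).2.1 v
  · exact le_of_tendsto_of_tendsto'
      ((continuous_quad v).continuousAt.tendsto.comp (tendsto_inv hN hNp))
      (tendsto_quad_regMap hs hν (fun k => (hH (φ k)).1) hN hNp tendsto_const_nhds v)
      fun k => (hH (φ k)).2.2 v
  · have : N.trace.re = sInf t := by
      refine tendsto_nhds_unique htrN ?_
      simp only [Function.comp, hHu]
      exact hu.comp hφ.tendsto_atTop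
    rw [this]
    exact csInf_le hbdd ⟨H', hH', rfl⟩

/-- Applying the monotone regularized map to a subsolution gives a larger subsolution, whose inverse
is smaller; minimality of the trace forces equality. The trace normalization, uniform in ε, supplies
the compactness needed as ε tends to 0. -/
lemma exists_regMap_fixed (hs : IsStable ν) (hν : ν ≠ 0) {ε : ℝ} (hε : 0 < ε) (hε1 : ε < 1) :
    ∃ H : Matrix (Fin n) (Fin n) ℂ, H.PosDef ∧ H.trace.re = n ∧ regMap ν ε H⁻¹ = H⁻¹ := by
  obtain ⟨H, ⟨hp, hb, hsub⟩, hmin⟩ := exists_min_subsolution hs hν hε hε1.le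
  have hp' : (regMap ν ε H⁻¹).PosDef := posDef_of_le hp.inv (regMap_isHermitian ν ε hp.inv) hsub
  have hle : ∀ v, quad (regMap ν ε H⁻¹)⁻¹ v ≤ quad H v := fun v => by
    have := quad_inv_anti hp.inv hp' hsub v
    rwa [inv_inv_of_posDef hp] at this
  have hmem : (regMap ν ε H⁻¹)⁻¹ ∈ subsolutions ν ε := by
    refine ⟨hp'.inv, fun v => (hle v).trans (hb v), fun v => ?_⟩
    rw [inv_inv_of_posDef hp', quad_regMap, quad_regMap]
    have := donaldsonMap_mono hν hp.inv hp' hsub v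
    nlinarith
  have hpsd : (H - (regMap ν ε H⁻¹)⁻¹).PosSemidef :=
    posSemidef_of_quad (hp.1.sub hp'.inv.1) fun v => by rw [quad_sub]; linarith [hle v]
  have heq : H = (regMap ν ε H⁻¹)⁻¹ := by
    rw [← sub_eq_zero, ← hpsd.trace_eq_zero_iff]
    refine Complex.ext ?_ ((Complex.le_def.1 hpsd.trace_nonneg).2.symm)
    refine le_antisymm ?_ (Complex.le_def.1 hpsd.trace_nonneg).1
    rw [Matrix.trace_sub, Complex.sub_re, Complex.zero_re]
    linarith [hmin _ hmem]
  have hfix : regMap ν ε H⁻¹ = H⁻¹ := by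
    conv_rhs => rw [heq]
    rw [inv_inv_of_posDef hp']
  refine ⟨H, hp, ?_, hfix⟩
  have := trace_mul_regMap hν ε hp
  rw [hfix, mul_inv_of_posDef hp, Matrix.trace_one, Fintype.card_fin, Complex.natCast_re] at this
  have h2 : ε * (H.trace.re - n) = 0 := by linarith
  linarith [(mul_eq_zero.1 h2).resolve_left (ne_of_gt hε)]

/-- A stable measure has a balanced metric. -/
lemma exists_fixed (hs : IsStable ν) (hν : ν ≠ 0) :
    ∃ G : Matrix (Fin n) (Fin n) ℂ, G.PosDef ∧ donaldsonMap ν G = G := by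
  have hn := ne_zero_of_measure_ne_zero hν
  -- The index is shifted by one so that the first value is 1/2 rather than 1, as ε < 1 is required.
  let ε : ℕ → ℝ := fun k => 1 / ((k + 1 : ℕ) + 1 : ℝ)
  have hε0 : ∀ k, 0 < ε k := fun k => by positivity
  have hε1 : ∀ k, ε k < 1 := fun k => by
    rw [div_lt_one (by positivity)]
    push_cast
    have : (0 : ℝ) ≤ k := by positivity
    linarith
  have hεlim : Tendsto ε atTop (𝓝 0) :=
    (tendsto_one_div_add_atTop_nhds_zero_nat (𝕜 := ℝ)).comp (tendsto_add_atTop_nat 1)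
  choose H hp htr hfix using fun k => exists_regMap_fixed hs hν (hε0 k) (hε1 k)
  obtain ⟨N, φ, hφ, hN⟩ := exists_subseq_tendsto (M := H) (C := n) fun k i j =>
    (norm_apply_le_trace (hp k).posSemidef i j).trans (htr k).le
  have htrN : Tendsto (fun k => ((H ∘ φ) k).trace.re) atTop (𝓝 N.trace.re) :=
    (Complex.continuous_re.comp (continuous_id.matrix_trace)).continuousAt.tendsto.comp hN
  have hNn : (n : ℝ) ≤ N.trace.re := ge_of_tendsto' htrN fun k => (htr _).ge
  have hN0 : N ≠ 0 := by
    rintro rfl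
    simp at hNn
    exact hn hNn
  have hNp : N.PosDef := posDef_of_tendsto hs hν (fun k => hp (φ k)) hN hN0
    (ε := ε ∘ φ) (fun k => (hε0 _).le) (fun k => (hε1 _).le)
    fun k v => by
      have := congrArg (quad · v) (hfix (φ k))
      exact this.ge
  refine ⟨N⁻¹, hNp.inv, ?_⟩
  refine eq_of_quad_eq (donaldsonMap_isHermitian ν hNp.inv) hNp.inv.1 fun v => ?_
  have h1 := tendsto_quad_regMap hs hν (fun k => hp (φ k)) hN hNp (hεlim.comp hφ.tendsto_atTop) v
  have h2 : Tendsto (fun k => quad ((H ∘ φ) k)⁻¹ v) atTop (𝓝 (quad N⁻¹ v)) :=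
    (continuous_quad v).continuousAt.tendsto.comp (tendsto_inv hN hNp)
  rw [quad_regMap, sub_zero, one_mul, zero_mul, add_zero] at h1
  refine tendsto_nhds_unique h1 (h2.congr fun k => ?_)
  exact (congrArg (quad · v) (hfix (φ k))).symm

end Existence

section Convergence

variable {n : ℕ}

/-! ### Convergence of the iterations -/

lemma continuous_quad_vec (A : Matrix (Fin n) (Fin n) ℂ) : Continuous (quad A) := by
  unfold quad
  fun_prop

/-- The largest eigenvalue of `G` relative to `P`. -/
def topRatio (P G : Matrix (Fin n) (Fin n) ℂ) : ℝ :=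
  sSup ((fun v : Metric.sphere (0 : Fin n → ℂ) 1 => quad G v / quad P v) '' Set.univ)

lemma sphere_ne_zero (v : Metric.sphere (0 : Fin n → ℂ) 1) : (v : Fin n → ℂ) ≠ 0 :=
  Metric.ne_of_mem_sphere v.2 one_ne_zero

/-- A supremum of a jointly continuous function over a compact set. The sphere is that of the sup
norm, which is harmless because the quotient is invariant under scaling. -/
lemma continuous_topRatio {P : Matrix (Fin n) (Fin n) ℂ} (hP : P.PosDef) :
    Continuous (topRatio P) := by
  refine isCompact_univ.continuous_sSup (f := fun (G : Matrix (Fin n) (Fin n) ℂ)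
    (v : Metric.sphere (0 : Fin n → ℂ) 1) => quad G v / quad P v) ?_
  refine Continuous.div ?_ ?_ fun p => (quad_pos hP (sphere_ne_zero p.2)).ne'
  · unfold quad
    fun_prop
  · exact (continuous_quad_vec P).comp (continuous_subtype_val.comp continuous_snd)

lemma exists_topRatio_eq {P : Matrix (Fin n) (Fin n) ℂ} (hP : P.PosDef) (hn : n ≠ 0)
    (G : Matrix (Fin n) (Fin n) ℂ) :
    ∃ v : Fin n → ℂ, v ≠ 0 ∧ quad G v = topRatio P G * quad P v ∧
      ∀ w, quad G w ≤ topRatio P G * quad P w := by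
  have hne : (Set.univ : Set (Metric.sphere (0 : Fin n → ℂ) 1)).Nonempty := by
    have : Nonempty (Fin n) := Fin.pos_iff_nonempty.1 (Nat.pos_of_ne_zero hn)
    obtain ⟨v, hv⟩ := NormedSpace.sphere_nonempty (x := (0 : Fin n → ℂ)) (r := 1) |>.2 zero_le_one
    exact ⟨⟨v, hv⟩, trivial⟩
  have hc : Continuous fun v : Metric.sphere (0 : Fin n → ℂ) 1 => quad G v / quad P v :=
    Continuous.div ((continuous_quad_vec G).comp continuous_subtype_val)
      ((continuous_quad_vec P).comp continuous_subtype_val)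
      fun v => (quad_pos hP (sphere_ne_zero v)).ne'
  obtain ⟨v, -, hv, hmax⟩ := isCompact_univ.exists_sSup_image_eq_and_ge hne hc.continuousOn
  change topRatio P G = _ at hv
  refine ⟨v, sphere_ne_zero v, ?_, fun w => ?_⟩
  · rw [hv, div_mul_cancel₀ _ (quad_pos hP (sphere_ne_zero v)).ne']
  · by_cases hw : w = 0
    · simp [hw, quad]
    have hw' : ‖w‖ ≠ 0 := norm_ne_zero_iff.2 hw
    have h1 := hmax ⟨((‖w‖ : ℂ)⁻¹) • w, by simp [norm_smul, hw]⟩ trivial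
    rw [← hv] at h1
    simp only [quad_smul_vec] at h1
    have h2 : ‖((‖w‖ : ℂ)⁻¹)‖ ^ 2 ≠ 0 := by simpa using hw
    rw [mul_div_mul_left _ _ h2, div_le_iff₀ (quad_pos hP hw)] at h1
    exact h1

lemma topRatio_le {P : Matrix (Fin n) (Fin n) ℂ} (hP : P.PosDef) (hn : n ≠ 0)
    {G : Matrix (Fin n) (Fin n) ℂ} {b : ℝ} (h : ∀ v, quad G v ≤ b * quad P v) :
    topRatio P G ≤ b := by
  obtain ⟨v, hv, h1, -⟩ := exists_topRatio_eq hP hn G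
  exact le_of_mul_le_mul_right (h1 ▸ h v) (quad_pos hP hv)

lemma le_topRatio_mul {P : Matrix (Fin n) (Fin n) ℂ} (hP : P.PosDef) (hn : n ≠ 0)
    (G : Matrix (Fin n) (Fin n) ℂ) (v : Fin n → ℂ) : quad G v ≤ topRatio P G * quad P v := by
  obtain ⟨-, -, -, h⟩ := exists_topRatio_eq hP hn G
  exact h v

lemma topRatio_pos {P G : Matrix (Fin n) (Fin n) ℂ} (hP : P.PosDef) (hn : n ≠ 0) (hG : G.PosDef) :
    0 < topRatio P G := by
  obtain ⟨v, hv, h1, -⟩ := exists_topRatio_eq hP hn G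
  exact pos_of_mul_pos_left (h1 ▸ quad_pos hG hv) (quad_pos hP hv).le

lemma posSemidef_smul_sub {P G : Matrix (Fin n) (Fin n) ℂ} (hP : P.PosDef) (hG : G.PosDef) {b : ℝ}
    (h : ∀ v, quad G v ≤ b * quad P v) : (b • P - G).PosSemidef :=
  posSemidef_of_quad ((isHermitian_smul hP.1 b).sub hG.1) fun v => by
    rw [quad_sub, quad_smul]; linarith [h v]

/-- The supremum is attained, and a null vector of a semidefinite form lies in its kernel. -/
lemma matKer_topRatio_ne_bot {P G : Matrix (Fin n) (Fin n) ℂ} (hP : P.PosDef) (hn : n ≠ 0)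
    (hG : G.PosDef) : matKer (topRatio P G • P - G) ≠ ⊥ := by
  obtain ⟨v, hv, h1, h2⟩ := exists_topRatio_eq hP hn G
  intro h
  have : v ∈ matKer (topRatio P G • P - G) := mem_matKer.2
    (mulVec_eq_zero_of_quad (posSemidef_smul_sub hP hG h2)
      (by rw [quad_sub, quad_smul, h1, sub_self]))
  rw [h, Submodule.mem_bot] at this
  exact hv this

variable {ν : Measure (ProjSpace n)} [IsFiniteMeasure ν]

lemma donaldsonMap_le_smul (hν : ν ≠ 0) {P G : Matrix (Fin n) (Fin n) ℂ} (hP : P.PosDef)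
    (hfix : donaldsonMap ν P = P) (hG : G.PosDef) {b : ℝ} (hb : 0 < b)
    (h : ∀ v, quad G v ≤ b * quad P v) (v : Fin n → ℂ) :
    quad (donaldsonMap ν G) v ≤ b * quad P v := by
  have := donaldsonMap_mono hν hG (posDef_smul hP hb) (fun w => by rw [quad_smul]; exact h w) v
  rwa [donaldsonMap_smul hP hb, hfix, quad_smul] at this

lemma smul_le_donaldsonMap (hν : ν ≠ 0) {P G : Matrix (Fin n) (Fin n) ℂ} (hP : P.PosDef)
    (hfix : donaldsonMap ν P = P) (hG : G.PosDef) {a : ℝ} (ha : 0 < a)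
    (h : ∀ v, a * quad P v ≤ quad G v) (v : Fin n → ℂ) :
    a * quad P v ≤ quad (donaldsonMap ν G) v := by
  have := donaldsonMap_mono hν (posDef_smul hP ha) hG (fun w => by rw [quad_smul]; exact h w) v
  rwa [donaldsonMap_smul hP ha, hfix, quad_smul] at this

/-- If `T_ν(G)` touches `b P` from below in the direction `v`, then almost every line is orthogonal
to `v` or contained in the image under `P` of the space where `G` touches `b P`. -/
lemma ae_of_mem_matKer (hν : ν ≠ 0) {P G : Matrix (Fin n) (Fin n) ℂ}
    (hP : P.PosDef) (hfix : donaldsonMap ν P = P) (hG : G.PosDef) {b : ℝ} (hb : 0 < b)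
    (h : ∀ v, quad G v ≤ b * quad P v) {v : Fin n → ℂ}
    (hv : v ∈ matKer (b • P - donaldsonMap ν G)) :
    ∀ᵐ x ∂ν, star v ⬝ᵥ x.rep = 0 ∨ P⁻¹ *ᵥ x.rep ∈ matKer (b • P - G) := by
  have hbP := posDef_smul hP hb
  have hle : ∀ z, quad (b • P)⁻¹ z ≤ quad G⁻¹ z := quad_inv_anti hG hbP fun w => by
    rw [quad_smul]; exact h w
  have hnn : ∀ x : ProjSpace n, 0 ≤ ‖star v ⬝ᵥ x.rep‖ ^ 2 / quad (b • P)⁻¹ x.rep -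
      ‖star v ⬝ᵥ x.rep‖ ^ 2 / quad G⁻¹ x.rep := fun x => sub_nonneg.2 <|
    div_le_div_of_nonneg_left (by positivity) (quad_pos hbP.inv x.rep_nonzero) (hle _)
  have hc1 := integrable_of_continuous ν (continuous_norm_sq_div hbP v)
  have hc2 := integrable_of_continuous ν (continuous_norm_sq_div hG v)
  -- Both maps have the same form at v, so a nonnegative integrand has integral 0 and vanishes
  -- almost everywhere.
  have h0 : ∫ x : ProjSpace n, (‖star v ⬝ᵥ x.rep‖ ^ 2 / quad (b • P)⁻¹ x.rep -
      ‖star v ⬝ᵥ x.rep‖ ^ 2 / quad G⁻¹ x.rep) ∂ν = 0 := by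
    have h1 : quad (donaldsonMap ν (b • P)) v = quad (donaldsonMap ν G) v := by
      rw [donaldsonMap_smul hP hb, hfix, ← sub_eq_zero, ← quad_sub, quad, mem_matKer.1 hv,
        dotProduct_zero, Complex.zero_re]
    rw [quad_donaldsonMap ν hbP, quad_donaldsonMap ν hG] at h1
    rw [integral_sub hc1 hc2, sub_eq_zero]
    exact mul_left_cancel₀ (ratio_pos ν (ne_zero_of_measure_ne_zero hν) hν).ne' h1
  filter_upwards [(integral_eq_zero_iff_of_nonneg hnn (hc1.sub hc2)).1 h0] with x hx
  by_cases hz : star v ⬝ᵥ x.rep = 0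
  · exact Or.inl hz
  right
  have hq1 := quad_pos hbP.inv x.rep_nonzero
  have hq2 := quad_pos hG.inv x.rep_nonzero
  have hne : ‖star v ⬝ᵥ x.rep‖ ^ 2 ≠ 0 := by positivity
  have heq : quad G⁻¹ x.rep = quad (b • P)⁻¹ x.rep := by
    have hx' := sub_eq_zero.1 hx
    rw [div_eq_div_iff hq1.ne' hq2.ne'] at hx'
    exact mul_left_cancel₀ hne hx'
  -- Equality of the two forms at z means that z is a null vector of a semidefinite difference, so
  -- the two inverses agree on z.
  have hker : (G⁻¹ - (b • P)⁻¹) *ᵥ x.rep = 0 :=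
    mulVec_eq_zero_of_quad (posSemidef_of_quad (hG.inv.1.sub hbP.inv.1) fun w => by
      rw [quad_sub]; linarith [hle w]) (by rw [quad_sub, heq, sub_self])
  rw [Matrix.sub_mulVec, sub_eq_zero, inv_real_smul hP hb.ne', Matrix.smul_mulVec] at hker
  have h3 : P⁻¹ *ᵥ x.rep = b • (G⁻¹ *ᵥ x.rep) := by
    rw [hker, smul_smul, mul_inv_cancel₀ hb.ne', one_smul]
  rw [mem_matKer, Matrix.sub_mulVec, sub_eq_zero, Matrix.smul_mulVec, Matrix.mulVec_mulVec,
    mul_inv_of_posDef hP, Matrix.one_mulVec, h3, Matrix.mulVec_smul, Matrix.mulVec_mulVec,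
    mul_inv_of_posDef hG, Matrix.one_mulVec]

/-- Expand Pv = T(P)v as an integral of multiples of z. Almost everywhere the coefficient ⟨v, z⟩
vanishes or z lies in the image under P of the contact space of G; hence Pv lies there and v is in
that contact space. -/
lemma matKer_donaldsonMap_le (hν : ν ≠ 0) {P G : Matrix (Fin n) (Fin n) ℂ}
    (hP : P.PosDef) (hfix : donaldsonMap ν P = P) (hG : G.PosDef) {b : ℝ} (hb : 0 < b)
    (h : ∀ v, quad G v ≤ b * quad P v) :
    matKer (b • P - donaldsonMap ν G) ≤ matKer (b • P - G) := by
  intro v hv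
  rw [mem_matKer]
  ext i
  let L : Matrix (Fin n) (Fin n) ℂ →ₗ[ℂ] ℂ :=
    { toFun := fun M => ((b • P - G) *ᵥ (P⁻¹ *ᵥ (M *ᵥ v))) i
      map_add' := fun M N => by simp [Matrix.add_mulVec, Matrix.mulVec_add]
      map_smul' := fun c M => by simp [Matrix.smul_mulVec, Matrix.mulVec_smul] }
  have h1 : ((b • P - G) *ᵥ v) i = L P := by
    change _ = ((b • P - G) *ᵥ (P⁻¹ *ᵥ (P *ᵥ v))) i
    rw [Matrix.mulVec_mulVec v, inv_mul_of_posDef hP, Matrix.one_mulVec]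
  rw [h1, ← hfix, map_donaldsonMap ν hP]
  rw [integral_eq_zero_of_ae, mul_zero, Pi.zero_apply]
  filter_upwards [ae_of_mem_matKer hν hP hfix hG hb h hv] with x hx
  change ((b • P - G) *ᵥ (P⁻¹ *ᵥ (kern P x *ᵥ v))) i = 0
  rw [kern, Matrix.smul_mulVec, Matrix.vecMulVec_mulVec]
  rcases hx with hx | hx
  · have : star x.rep ⬝ᵥ v = 0 := by
      rw [← star_star v, Matrix.star_dotProduct_star, hx, star_zero]
    simp [this]
  · rw [mem_matKer] at hx
    rw [op_smul_eq_smul, Matrix.mulVec_smul, Matrix.mulVec_smul, Matrix.mulVec_smul,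
      Matrix.mulVec_smul, hx, smul_zero, smul_zero, Pi.zero_apply]

/-- When the contact space S does not shrink, almost every line lies in P(S) or in the orthogonal of
S. These meet only in 0, since the form of P is definite, so their dimensions add up to at most n
and stability leaves only S = ⊤. -/
lemma eq_smul_of_matKer_eq (hs : IsStable ν) (hν : ν ≠ 0) {P G : Matrix (Fin n) (Fin n) ℂ}
    (hP : P.PosDef) (hfix : donaldsonMap ν P = P) (hG : G.PosDef) {b : ℝ} (hb : 0 < b)
    (h : ∀ v, quad G v ≤ b * quad P v)
    (heq : matKer (b • P - donaldsonMap ν G) = matKer (b • P - G))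
    (hbot : matKer (b • P - G) ≠ ⊥) : G = b • P := by
  set S := matKer (b • P - G) with hS
  by_cases htop : S = ⊤
  · exact (sub_eq_zero.1 (matKer_eq_top.1 htop)).symm
  exfalso
  have hinj : Function.Injective P.mulVecLin := by
    intro a c hac
    have := congrArg (P⁻¹ *ᵥ ·) hac
    simpa [Matrix.mulVec_mulVec, inv_mul_of_posDef hP] using this
  have h0 : S.map P.mulVecLin ≠ ⊥ := by
    obtain ⟨v, hv, hv0⟩ := Submodule.exists_mem_ne_zero_of_ne_bot hbot
    intro hb0
    have : P.mulVecLin v ∈ S.map P.mulVecLin := ⟨v, hv, rfl⟩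
    rw [hb0, Submodule.mem_bot] at this
    exact hv0 (hinj (this.trans (map_zero _).symm))
  have h1 : S.map P.mulVecLin ≠ ⊤ := by
    intro ht
    refine htop (eq_top_iff.2 fun u _ => ?_)
    have : P.mulVecLin u ∈ S.map P.mulVecLin := ht ▸ Submodule.mem_top
    obtain ⟨w, hw, hwu⟩ := this
    exact hinj hwu ▸ hw
  have hdisj : Disjoint (S.map P.mulVecLin) (orth (S : Set (Fin n → ℂ))) := by
    rw [Submodule.disjoint_def]
    rintro _ ⟨v, hv, rfl⟩ hz
    have hq : quad P v = 0 := by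
      have := hz v hv
      rw [Matrix.mulVecLin_apply] at this
      rw [quad, this, Complex.zero_re]
    by_contra hne
    exact (quad_pos hP (v := v) (by rintro rfl; simp at hne)).ne' hq
  refine hs.not_ae_mem_or hν h0 h1 (S' := orth (S : Set (Fin n → ℂ))) ?_ ?_
  · simpa using Submodule.finrank_add_finrank_le_of_disjoint hdisj
  -- The exceptional null set depends on the vector, so only the finitely many vectors of a basis
  -- are used.
  let B := Module.finBasis ℂ S
  have hall : ∀ᵐ x ∂ν, ∀ i, star (B i : Fin n → ℂ) ⬝ᵥ x.rep = 0 ∨ P⁻¹ *ᵥ x.rep ∈ S :=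
    ae_all_iff.2 fun i => ae_of_mem_matKer hν hP hfix hG hb h (by rw [heq]; exact (B i).2)
  filter_upwards [hall] with x hx
  by_cases hxS : P⁻¹ *ᵥ x.rep ∈ S
  · left
    rw [mem_projSubspace]
    exact ⟨_, hxS, by simp [Matrix.mulVec_mulVec, mul_inv_of_posDef hP]⟩
  · right
    rw [mem_projSubspace]
    intro v hv
    have hsum := congrArg Subtype.val (B.sum_repr ⟨v, hv⟩)
    simp only [Submodule.coe_sum, Submodule.coe_smul] at hsum
    rw [← hsum, star_sum, sum_dotProduct]
    refine Finset.sum_eq_zero fun i _ => ?_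
    rw [star_smul, smul_dotProduct, (hx i).resolve_right hxS, smul_zero]

/-- For a fixed point the contact spaces before and after T coincide trivially. -/
lemma fixed_unique (hs : IsStable ν) (hν : ν ≠ 0) {P G : Matrix (Fin n) (Fin n) ℂ}
    (hP : P.PosDef) (hG : G.PosDef) (hfix : donaldsonMap ν P = P) (hfixG : donaldsonMap ν G = G) :
    ∃ c : ℝ, 0 < c ∧ G = c • P := by
  have hn := ne_zero_of_measure_ne_zero hν
  exact ⟨topRatio P G, topRatio_pos hP hn hG, eq_smul_of_matKer_eq hs hν hP hfix hG
    (topRatio_pos hP hn hG) (le_topRatio_mul hP hn G) (by rw [hfixG])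
    (matKer_topRatio_ne_bot hP hn hG)⟩

lemma iterate_posDef (hs : IsStable ν) (hν : ν ≠ 0) {G : Matrix (Fin n) (Fin n) ℂ} (hG : G.PosDef)
    (r : ℕ) : ((donaldsonMap ν)^[r] G).PosDef := by
  induction r with
  | zero => exact hG
  | succ r ih => rw [Function.iterate_succ_apply']; exact donaldsonMap_posDef hs hν ih

lemma iterate_le (hs : IsStable ν) (hν : ν ≠ 0) {P G : Matrix (Fin n) (Fin n) ℂ} (hP : P.PosDef)
    (hfix : donaldsonMap ν P = P) (hG : G.PosDef) {b : ℝ} (hb : 0 < b)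
    (h : ∀ v, quad G v ≤ b * quad P v) (r : ℕ) (v : Fin n → ℂ) :
    quad ((donaldsonMap ν)^[r] G) v ≤ b * quad P v := by
  induction r generalizing v with
  | zero => exact h v
  | succ r ih =>
    rw [Function.iterate_succ_apply']
    exact donaldsonMap_le_smul hν hP hfix (iterate_posDef hs hν hG r) hb ih v

lemma le_iterate (hs : IsStable ν) (hν : ν ≠ 0) {P G : Matrix (Fin n) (Fin n) ℂ} (hP : P.PosDef)
    (hfix : donaldsonMap ν P = P) (hG : G.PosDef) {a : ℝ} (ha : 0 < a)
    (h : ∀ v, a * quad P v ≤ quad G v) (r : ℕ) (v : Fin n → ℂ) :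
    a * quad P v ≤ quad ((donaldsonMap ν)^[r] G) v := by
  induction r generalizing v with
  | zero => exact h v
  | succ r ih =>
    rw [Function.iterate_succ_apply']
    exact smul_le_donaldsonMap hν hP hfix (iterate_posDef hs hν hG r) ha ih v

lemma tendsto_iterate_comp (hs : IsStable ν) (hν : ν ≠ 0) {M : ℕ → Matrix (Fin n) (Fin n) ℂ}
    {X : Matrix (Fin n) (Fin n) ℂ} (hX : X.PosDef) (hM : ∀ k, (M k).PosDef)
    (h : Tendsto M atTop (𝓝 X)) (j : ℕ) :
    Tendsto (fun k => (donaldsonMap ν)^[j] (M k)) atTop (𝓝 ((donaldsonMap ν)^[j] X)) := by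
  induction j with
  | zero => exact h
  | succ j ih =>
    simp only [Function.iterate_succ_apply']
    exact tendsto_donaldsonMap hs hν (iterate_posDef hs hν hX j)
      (fun k => iterate_posDef hs hν (hM k) j) ih

lemma exists_pos_smul_le (P : Matrix (Fin n) (Fin n) ℂ) {G : Matrix (Fin n) (Fin n) ℂ}
    (hG : G.PosDef) : ∃ a : ℝ, 0 < a ∧ ∀ v, a * quad P v ≤ quad G v := by
  obtain ⟨c, hc, h⟩ := quad_one_le hG
  have hC : 0 < entrySum P + 1 := by linarith [entrySum_nonneg P]
  refine ⟨c / (entrySum P + 1), by positivity, fun v => ?_⟩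
  have h1 := (le_abs_self _).trans (abs_quad_le P v)
  have h2 := quad_nonneg (Matrix.PosSemidef.one (n := Fin n) (R := ℂ)) v
  rw [div_mul_eq_mul_div, div_le_iff₀ hC]
  nlinarith [h v]

/-- An antitone sequence of subspaces has two equal consecutive terms. -/
lemma exists_succ_eq_of_antitone {S : ℕ → Submodule ℂ (Fin n → ℂ)}
    (h : ∀ j, S (j + 1) ≤ S j) : ∃ j, S (j + 1) = S j := by
  let f : ℕ →o (Submodule ℂ (Fin n → ℂ))ᵒᵈ :=
    ⟨fun j => OrderDual.toDual (S j), fun _ _ hij => antitone_nat_of_succ_le h hij⟩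
  obtain ⟨j, hj⟩ := IsArtinian.monotone_stabilizes f
  exact ⟨j, (congrArg OrderDual.ofDual (hj (j + 1) (Nat.le_succ j))).symm⟩

/-- `topRatio` is a Lyapunov function: it is constant on the orbit of a limit point X, where the
shrinking contact spaces must stabilize and so make some iterate of X a multiple of P. -/
lemma exists_tendsto_iterate (hs : IsStable ν) (hν : ν ≠ 0) {P G₀ : Matrix (Fin n) (Fin n) ℂ}
    (hP : P.PosDef) (hfix : donaldsonMap ν P = P) (hG₀ : G₀.PosDef) :
    ∃ G : Matrix (Fin n) (Fin n) ℂ, G.PosDef ∧ donaldsonMap ν G = G ∧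
        Tendsto (fun r : ℕ => (donaldsonMap ν)^[r] G₀) atTop (𝓝 G) := by
  have hn := ne_zero_of_measure_ne_zero hν
  set g : ℕ → Matrix (Fin n) (Fin n) ℂ := fun r => (donaldsonMap ν)^[r] G₀ with hg
  have hgp : ∀ r, (g r).PosDef := iterate_posDef hs hν hG₀
  obtain ⟨a, ha, haG⟩ := exists_pos_smul_le P hG₀
  have hlow := le_iterate hs hν hP hfix hG₀ ha haG
  have hup := iterate_le hs hν hP hfix hG₀ (topRatio_pos hP hn hG₀) (le_topRatio_mul hP hn G₀)
  have hb : ∀ k i j, ‖g k i j‖ ≤ (topRatio P G₀ • P).trace.re := fun k i j =>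
    (norm_apply_le_trace (hgp k).posSemidef i j).trans
      (trace_mono fun v => by rw [quad_smul]; exact hup k v)
  obtain ⟨X, φ, hφ, hX⟩ := exists_subseq_tendsto hb
  have hXp : X.PosDef := posDef_of_le (posDef_smul hP ha)
    (isHermitian_of_tendsto hX fun k => (hgp _).1) fun v => by
      rw [quad_smul]
      exact ge_of_tendsto' ((continuous_quad v).continuousAt.tendsto.comp hX) fun k => hlow (φ k) v
  have hanti : Antitone fun r => topRatio P (g r) := by
    refine antitone_nat_of_succ_le fun r => topRatio_le hP hn ?_
    simp only [hg, Function.iterate_succ_apply']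
    exact donaldsonMap_le_smul hν hP hfix (hgp r) (topRatio_pos hP hn (hgp r))
      (le_topRatio_mul hP hn _)
  have hbdd : BddBelow (Set.range fun r => topRatio P (g r)) := ⟨0, by
    rintro _ ⟨r, rfl⟩
    exact (topRatio_pos hP hn (hgp r)).le⟩
  have hconv := tendsto_atTop_ciInf hanti hbdd
  set b := ⨅ r, topRatio P (g r)
  have hshift : ∀ j, Tendsto (fun k => g (φ k + j)) atTop (𝓝 ((donaldsonMap ν)^[j] X)) := by
    intro j
    refine (tendsto_iterate_comp hs hν hXp (fun k => hgp (φ k)) hX j).congr fun k => ?_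
    simp only [hg]
    rw [← Function.iterate_add_apply, add_comm]
  -- Each iterate of X is the limit of a shifted subsequence, and the whole monotone sequence of
  -- ratios tends to b.
  have htop : ∀ j, topRatio P ((donaldsonMap ν)^[j] X) = b := by
    intro j
    refine tendsto_nhds_unique
      ((continuous_topRatio hP).continuousAt.tendsto.comp (hshift j)) ?_
    exact hconv.comp ((tendsto_add_atTop_nat j).comp hφ.tendsto_atTop)
  have hXj := iterate_posDef hs hν hXp
  have hb0 : 0 < b := htop 0 ▸ topRatio_pos hP hn (hXj 0)
  have hleb : ∀ j v, quad ((donaldsonMap ν)^[j] X) v ≤ b * quad P v := fun j v =>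
    htop j ▸ le_topRatio_mul hP hn _ v
  obtain ⟨j, hj⟩ := exists_succ_eq_of_antitone
    (S := fun j => matKer (b • P - (donaldsonMap ν)^[j] X)) fun j => by
      rw [Function.iterate_succ_apply']
      exact matKer_donaldsonMap_le hν hP hfix (hXj j) hb0 (hleb j)
  rw [Function.iterate_succ_apply'] at hj
  have hXb : (donaldsonMap ν)^[j] X = b • P := eq_smul_of_matKer_eq hs hν hP hfix (hXj j) hb0
    (hleb j) hj (by have := matKer_topRatio_ne_bot hP hn (hXj j); rwa [htop j] at this)
  have hbP := posDef_smul hP hb0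
  have hbfix : donaldsonMap ν (b • P) = b • P := by rw [donaldsonMap_smul hP hb0, hfix]
  refine ⟨b • P, hbP, hbfix, ?_⟩
  refine tendsto_of_abs_quad_sub_le hbP (Eventually.of_forall fun r => (hgp r).1) fun ε hε => ?_
  have hδ : 0 < min ε (1 / 2) := by positivity
  have hδ1 : 0 < 1 - min ε (1 / 2) := by linarith [min_le_right ε (1 / 2)]
  have hδ2 : 0 < 1 + min ε (1 / 2) := by linarith
  have hlim := hshift j
  rw [hXb] at hlim
  -- A single iterate within the factors 1 ± δ of the fixed point bP traps all later ones.
  obtain ⟨k, hk⟩ := (eventually_abs_quad_sub_le hbP hlim hδ).exists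
  filter_upwards [eventually_ge_atTop (φ k + j)] with r hr v
  obtain ⟨s, rfl⟩ := Nat.exists_eq_add_of_le hr
  have hiter : g (φ k + j + s) = (donaldsonMap ν)^[s] (g (φ k + j)) := by
    simp only [hg]
    rw [← Function.iterate_add_apply, add_comm s]
  rw [hiter]
  have h1 := le_iterate hs hν hbP hbfix (hgp (φ k + j)) hδ1
    (fun w => by linarith [abs_le.1 (hk w)]) s v
  have h2 := iterate_le hs hν hbP hbfix (hgp (φ k + j)) hδ2
    (fun w => by linarith [abs_le.1 (hk w)]) s v
  have h4 := mul_le_mul_of_nonneg_right (min_le_left ε (1 / 2)) (quad_nonneg hbP.posSemidef v)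
  rw [abs_le]
  constructor <;> linarith

end Convergence

section Spectrum

variable {n : ℕ}

/-! ### The spectrum of the quantum channel -/

lemma dualProd_eq (G : Matrix (Fin n) (Fin n) ℂ) (v w : Fin n → ℂ) :
    dualProd G v w = star w ⬝ᵥ G⁻¹ *ᵥ v := by
  rw [dualProd, herm_eq, dotProduct_comm]

lemma dualProd_self {G : Matrix (Fin n) (Fin n) ℂ} (hG : G.PosDef) (v : Fin n → ℂ) :
    dualProd G v v = (quad G⁻¹ v : ℂ) := by
  rw [dualProd_eq, ofReal_quad hG.inv.1]

/-- The expectation `tr (F A)` of an operator in the coherent state of a line. -/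
def expect (G A : Matrix (Fin n) (Fin n) ℂ) (x : ProjSpace n) : ℝ := (projector G x * A).trace.re

lemma ofReal_expect {G A : Matrix (Fin n) (Fin n) ℂ} (hG : G.PosDef) (hA : A ∈ hermOps G)
    (x : ProjSpace n) : (expect G A x : ℂ) = (projector G x * A).trace := by
  apply Complex.conj_eq_iff_re.1
  rw [← Complex.star_def, trace_projector_mul, star_div₀, dualProd_star hG, dualProd_star hG, hA]

lemma dualProd_mulVec_rep {G A : Matrix (Fin n) (Fin n) ℂ} (hG : G.PosDef) (hA : A ∈ hermOps G)
    (x : ProjSpace n) :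
    dualProd G (A *ᵥ x.rep) x.rep = ((expect G A x * quad G⁻¹ x.rep : ℝ) : ℂ) := by
  rw [Complex.ofReal_mul, ofReal_expect hG hA, trace_projector_mul, ← dualProd_self hG,
    div_mul_cancel₀ _ (dualProd_self_ne hG x.rep_nonzero)]

lemma continuous_trace_projector_mul {G : Matrix (Fin n) (Fin n) ℂ} (hG : G.PosDef)
    (A : Matrix (Fin n) (Fin n) ℂ) : Continuous fun x => (projector G x * A).trace := by
  have h1 : Continuous (fun x => projector G x) := continuous_matrix (continuous_projector hG)
  exact (h1.matrix_mul continuous_const).matrix_trace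

lemma continuous_expect {G : Matrix (Fin n) (Fin n) ℂ} (hG : G.PosDef)
    (A : Matrix (Fin n) (Fin n) ℂ) : Continuous (expect G A) :=
  Complex.continuous_re.comp (continuous_trace_projector_mul hG A)

/-- This is the variance of A in the state of the line: mean square minus squared mean. -/
lemma quad_sub_expect_smul {G A : Matrix (Fin n) (Fin n) ℂ} (hG : G.PosDef) (hA : A ∈ hermOps G)
    (x : ProjSpace n) :
    quad G⁻¹ (A *ᵥ x.rep - (expect G A x : ℂ) • x.rep) / quad G⁻¹ x.rep =
      quad G⁻¹ (A *ᵥ x.rep) / quad G⁻¹ x.rep - expect G A x * expect G A x := by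
  have hq := (quad_pos hG.inv x.rep_nonzero).ne'
  have h1 : star ((expect G A x : ℂ) • x.rep) ⬝ᵥ G⁻¹ *ᵥ (A *ᵥ x.rep) =
      ((expect G A x * (expect G A x * quad G⁻¹ x.rep) : ℝ) : ℂ) := by
    rw [star_smul, smul_dotProduct, ← dualProd_eq, dualProd_mulVec_rep hG hA]
    simp
  rw [quad_sub_vec hG.inv.1, h1, Complex.ofReal_re, quad_smul_vec, Complex.norm_real,
    Real.norm_eq_abs, sq_abs]
  field_simp
  ring

variable {ν : Measure (ProjSpace n)} [IsFiniteMeasure ν]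

lemma trace_mul_channelFun {G A B : Matrix (Fin n) (Fin n) ℂ} (hG : G.PosDef) (hA : A ∈ hermOps G)
    (hB : B ∈ hermOps G) :
    (B * channelFun ν G A).trace.re = ratio ν * ∫ x, expect G A x * expect G B x ∂ν := by
  have h1 := map_entry_integral ν (Φ := fun x => (projector G x * A).trace • projector G x)
    (fun i j => by
      simp only [Matrix.smul_apply, smul_eq_mul]
      exact (continuous_trace_projector_mul hG A).mul (continuous_projector hG i j))
    (ratio ν) (traceMul B)
  simp only [Matrix.smul_apply, smul_eq_mul] at h1
  change (traceMul B (Matrix.of fun i j => (ratio ν : ℂ) *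
    ∫ x, (projector G x * A).trace * projector G x i j ∂ν)).re = _
  rw [h1]
  have h2 : ∀ x, traceMul B ((projector G x * A).trace • projector G x) =
      ((expect G A x * expect G B x : ℝ) : ℂ) := fun x => by
    rw [map_smul, traceMul_apply, Matrix.trace_mul_comm B, ← ofReal_expect hG hA,
      ← ofReal_expect hG hB, smul_eq_mul, Complex.ofReal_mul]
  simp only [h2]
  rw [integral_complex_ofReal, ← Complex.ofReal_mul, Complex.ofReal_re]

lemma quad_inv_mul_mul {G A : Matrix (Fin n) (Fin n) ℂ} (hA : A ∈ hermOps G) (z : Fin n → ℂ) :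
    quad (G⁻¹ * (A * A)) z = quad G⁻¹ (A *ᵥ z) := by
  have := hA (A *ᵥ z) z
  rw [dualProd_eq, dualProd_eq] at this
  rw [quad, quad, ← this, Matrix.mulVec_mulVec z A, Matrix.mulVec_mulVec]

/-- At a fixed point G may be replaced by T(G) in tr(G⁻¹ A² G). -/
lemma trace_mul_self {G A : Matrix (Fin n) (Fin n) ℂ} (hG : G.PosDef)
    (hfix : donaldsonMap ν G = G) (hA : A ∈ hermOps G) :
    (A * A).trace.re = ratio ν * ∫ x, quad G⁻¹ (A *ᵥ x.rep) / quad G⁻¹ x.rep ∂ν := by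
  have h := trace_mul_donaldsonMap ν hG (G⁻¹ * (A * A))
  rw [hfix, Matrix.trace_mul_comm, ← Matrix.mul_assoc, mul_inv_of_posDef hG, Matrix.one_mul] at h
  simpa only [quad_inv_mul_mul hA] using h

lemma continuous_quad_mulVec_div {G A : Matrix (Fin n) (Fin n) ℂ} (hG : G.PosDef)
    (hA : A ∈ hermOps G) :
    Continuous fun x : ProjSpace n => quad G⁻¹ (A *ᵥ x.rep) / quad G⁻¹ x.rep := by
  simpa only [quad_inv_mul_mul hA] using continuous_quad_div hG (G⁻¹ * (A * A))

lemma quad_div_nonneg {G : Matrix (Fin n) (Fin n) ℂ} (hG : G.PosDef) (v : Fin n → ℂ)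
    (x : ProjSpace n) : 0 ≤ quad G⁻¹ v / quad G⁻¹ x.rep :=
  div_nonneg (quad_nonneg hG.inv.posSemidef _) (quad_nonneg hG.inv.posSemidef _)

lemma eq_zero_of_quad_div {G : Matrix (Fin n) (Fin n) ℂ} (hG : G.PosDef) {v : Fin n → ℂ}
    {x : ProjSpace n} (h : quad G⁻¹ v / quad G⁻¹ x.rep = 0) : v = 0 := by
  by_contra hv
  exact (div_pos (quad_pos hG.inv hv) (quad_pos hG.inv x.rep_nonzero)).ne' h

lemma trace_mul_self_pos (hs : IsStable ν) (hν : ν ≠ 0) {G A : Matrix (Fin n) (Fin n) ℂ}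
    (hG : G.PosDef) (hfix : donaldsonMap ν G = G) (hA : A ∈ hermOps G) (hA0 : A ≠ 0) :
    0 < (A * A).trace.re := by
  rw [trace_mul_self hG hfix hA]
  refine mul_pos (ratio_pos ν (ne_zero_of_measure_ne_zero hν) hν) ?_
  have hnn := fun x : ProjSpace n => quad_div_nonneg hG (A *ᵥ x.rep) x
  refine lt_of_le_of_ne (integral_nonneg hnn) fun h => ?_
  refine hs.not_ae_mem hν (fun ht => hA0 (matKer_eq_top.1 ht)) ?_
  filter_upwards [(integral_eq_zero_iff_of_nonneg hnn
    (integrable_of_continuous ν (continuous_quad_mulVec_div hG hA))).1 h.symm] with x hx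
  rw [mem_projSubspace, mem_matKer]
  exact eq_zero_of_quad_div hG hx

/-- The difference of the two quadratic quantities is a total variance, which gives at once the
bound 1 for the spectrum and the equality case. -/
lemma trace_sub_channelFun {G A : Matrix (Fin n) (Fin n) ℂ} (hG : G.PosDef)
    (hfix : donaldsonMap ν G = G) (hA : A ∈ hermOps G) :
    (A * A).trace.re - (A * channelFun ν G A).trace.re = ratio ν * ∫ x,
      quad G⁻¹ (A *ᵥ x.rep - (expect G A x : ℂ) • x.rep) / quad G⁻¹ x.rep ∂ν := by
  have h1 := integrable_of_continuous ν (continuous_quad_mulVec_div hG hA)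
  have h2 : Integrable (fun x => expect G A x * expect G A x) ν :=
    integrable_of_continuous ν ((continuous_expect hG A).mul (continuous_expect hG A))
  simp only [quad_sub_expect_smul hG hA]
  rw [trace_mul_self hG hfix hA, trace_mul_channelFun hG hA hA, integral_sub h1 h2]
  ring

lemma trace_channelFun_le (hν : ν ≠ 0) {G A : Matrix (Fin n) (Fin n) ℂ} (hG : G.PosDef)
    (hfix : donaldsonMap ν G = G) (hA : A ∈ hermOps G) :
    (A * channelFun ν G A).trace.re ≤ (A * A).trace.re := by
  have := mul_nonneg (ratio_pos ν (ne_zero_of_measure_ne_zero hν) hν).le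
    (integral_nonneg (μ := ν) fun x : ProjSpace n =>
      quad_div_nonneg hG (A *ᵥ x.rep - (expect G A x : ℂ) • x.rep) x)
  rw [← trace_sub_channelFun hG hfix hA] at this
  linarith

lemma ae_eigenvector_of_channelFun_eq (hν : ν ≠ 0) {G A : Matrix (Fin n) (Fin n) ℂ}
    (hG : G.PosDef) (hfix : donaldsonMap ν G = G) (hA : A ∈ hermOps G)
    (hEA : channelFun ν G A = A) : ∀ᵐ x ∂ν, A *ᵥ x.rep = (expect G A x : ℂ) • x.rep := by
  have h := trace_sub_channelFun hG hfix hA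
  rw [hEA, sub_self] at h
  have hnn := fun x : ProjSpace n =>
    quad_div_nonneg hG (A *ᵥ x.rep - (expect G A x : ℂ) • x.rep) x
  have hc : Continuous fun x : ProjSpace n =>
      quad G⁻¹ (A *ᵥ x.rep - (expect G A x : ℂ) • x.rep) / quad G⁻¹ x.rep := by
    simp only [quad_sub_expect_smul hG hA]
    exact (continuous_quad_mulVec_div hG hA).sub
      ((continuous_expect hG A).mul (continuous_expect hG A))
  have h0 := (mul_eq_zero.1 h.symm).resolve_left
    (ratio_pos ν (ne_zero_of_measure_ne_zero hν) hν).ne'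
  filter_upwards [(integral_eq_zero_iff_of_nonneg hnn (integrable_of_continuous ν hc)).1 h0]
    with x hx
  exact sub_eq_zero.1 (eq_zero_of_quad_div hG hx)

/-- Let μ be an eigenvalue of A. An eigenline of A lies in ker(A - μ) or, if its eigenvalue differs
from μ, in the range of A - μ. Rank-nullity and stability force the kernel to be everything. -/
lemma eq_smul_one_of_channelFun_eq (hs : IsStable ν) (hν : ν ≠ 0) {G A : Matrix (Fin n) (Fin n) ℂ}
    (hG : G.PosDef) (hfix : donaldsonMap ν G = G) (hA : A ∈ hermOps G)
    (hEA : channelFun ν G A = A) : ∃ c : ℝ, A = c • (1 : Matrix (Fin n) (Fin n) ℂ) := by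
  have hae := ae_eigenvector_of_channelFun_eq hν hG hfix hA hEA
  have : Nonempty (Fin n) :=
    Fin.pos_iff_nonempty.1 (Nat.pos_of_ne_zero (ne_zero_of_measure_ne_zero hν))
  obtain ⟨μ, hμ⟩ := Module.End.exists_eigenvalue A.mulVecLin
  obtain ⟨v, hv⟩ := hμ.exists_hasEigenvector
  have hAv : A *ᵥ v = μ • v := hv.apply_eq_smul
  have hmul : ∀ w, (A - μ • (1 : Matrix (Fin n) (Fin n) ℂ)) *ᵥ w = A *ᵥ w - μ • w := fun w => by
    rw [Matrix.sub_mulVec, Matrix.smul_mulVec, Matrix.one_mulVec]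
  have htop : matKer (A - μ • (1 : Matrix (Fin n) (Fin n) ℂ)) = ⊤ := by
    by_contra htop
    refine hs.not_ae_mem_or hν (S := matKer (A - μ • (1 : Matrix (Fin n) (Fin n) ℂ)))
      (S' := LinearMap.range (A - μ • (1 : Matrix (Fin n) (Fin n) ℂ)).mulVecLin) ?_ htop ?_ ?_
    · intro hbot
      have : v ∈ matKer (A - μ • (1 : Matrix (Fin n) (Fin n) ℂ)) := by
        rw [mem_matKer, hmul, hAv, sub_self]
      rw [hbot, Submodule.mem_bot] at this
      exact hv.2 this
    · have := LinearMap.finrank_range_add_finrank_ker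
        (A - μ • (1 : Matrix (Fin n) (Fin n) ℂ)).mulVecLin
      rw [Module.finrank_fin_fun] at this
      rw [add_comm]
      exact this.le
    · filter_upwards [hae] with x hx
      by_cases hc : (expect G A x : ℂ) = μ
      · left
        rw [mem_projSubspace, mem_matKer, hmul, hx, hc, sub_self]
      · right
        rw [mem_projSubspace]
        refine ⟨((expect G A x : ℂ) - μ)⁻¹ • x.rep, ?_⟩
        rw [Matrix.mulVecLin_apply, Matrix.mulVec_smul, hmul, hx, ← sub_smul, smul_smul,
          inv_mul_cancel₀ (sub_ne_zero.2 hc), one_smul]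
  have hAμ : A = μ • (1 : Matrix (Fin n) (Fin n) ℂ) := sub_eq_zero.1 (matKer_eq_top.1 htop)
  have : NeZero ν := ⟨hν⟩
  obtain ⟨x, hx⟩ := hae.exists
  refine ⟨expect G A x, ?_⟩
  have hc : μ = (expect G A x : ℂ) := by
    have h1 : μ • x.rep = (expect G A x : ℂ) • x.rep := by
      rw [← hx, hAμ, Matrix.smul_mulVec, Matrix.one_mulVec]
    exact smul_left_injective ℂ x.rep_nonzero h1
  conv_lhs => rw [hAμ, hc]
  ext i j
  simp

lemma ae_expect_eq_zero (hν : ν ≠ 0) {G A : Matrix (Fin n) (Fin n) ℂ} (hG : G.PosDef)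
    (hA : A ∈ hermOps G) (hEA : channelFun ν G A = 0) : ∀ᵐ x ∂ν, expect G A x = 0 := by
  have h := trace_mul_channelFun (ν := ν) hG hA hA
  rw [hEA, Matrix.mul_zero, Matrix.trace_zero, Complex.zero_re] at h
  have h0 := (mul_eq_zero.1 h.symm).resolve_left
    (ratio_pos ν (ne_zero_of_measure_ne_zero hν) hν).ne'
  filter_upwards [(integral_eq_zero_iff_of_nonneg (fun x => mul_self_nonneg _)
    (integrable_of_continuous ν
      ((continuous_expect hG A).mul (continuous_expect hG A)))).1 h0] with x hx
  exact mul_self_eq_zero.1 hx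

/-! ### Symmetry of the channel, multiplicity of the eigenvalue 1, and the gap. -/

lemma quantumChannel_symm {G : Matrix (Fin n) (Fin n) ℂ} (hG : G.PosDef) (A B : hermOps G) :
    ((B : Matrix (Fin n) (Fin n) ℂ) * (quantumChannel ν G hG A : hermOps G)).trace.re =
      ((quantumChannel ν G hG B : Matrix (Fin n) (Fin n) ℂ) * A).trace.re := by
  rw [Matrix.trace_mul_comm _ (A : Matrix (Fin n) (Fin n) ℂ)]
  change (B.1 * channelFun ν G A.1).trace.re = (A.1 * channelFun ν G B.1).trace.re
  rw [trace_mul_channelFun hG A.2 B.2, trace_mul_channelFun hG B.2 A.2]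
  simp only [mul_comm]

lemma eq_zero_of_trace (hs : IsStable ν) (hν : ν ≠ 0) {G : Matrix (Fin n) (Fin n) ℂ}
    (hG : G.PosDef) (hfix : donaldsonMap ν G = G) {A : hermOps G}
    (h : ((A : Matrix (Fin n) (Fin n) ℂ) * A).trace.re = 0) : A = 0 := by
  by_contra hne
  exact (trace_mul_self_pos hs hν hG hfix A.2 fun h0 => hne (Subtype.ext h0)).ne' h

/-- For the definite trace form, ⟨(E - 1)A, (E - 1)A⟩ = ⟨(E - 1)²A, A⟩ = 0. -/
lemma quantumChannel_sub_sq (hs : IsStable ν) (hν : ν ≠ 0) {G : Matrix (Fin n) (Fin n) ℂ}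
    (hG : G.PosDef) (hfix : donaldsonMap ν G = G) {A : hermOps G}
    (h : (quantumChannel ν G hG - algebraMap ℝ _ 1) ((quantumChannel ν G hG - algebraMap ℝ _ 1) A)
      = 0) : (quantumChannel ν G hG - algebraMap ℝ _ 1) A = 0 := by
  refine eq_zero_of_trace hs hν hG hfix ?_
  have hsymm : ∀ A B : hermOps G, ((B : Matrix (Fin n) (Fin n) ℂ) *
      ((quantumChannel ν G hG - algebraMap ℝ _ 1) A : hermOps G)).trace.re =
      (((quantumChannel ν G hG - algebraMap ℝ _ 1) B : hermOps G) *
        (A : Matrix (Fin n) (Fin n) ℂ)).trace.re := fun A B => by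
    have := quantumChannel_symm (ν := ν) hG A B
    simp only [map_one, LinearMap.sub_apply, Module.End.one_apply, Submodule.coe_sub,
      Matrix.mul_sub, Matrix.sub_mul, Matrix.trace_sub, Complex.sub_re, this]
  rw [hsymm, h]
  simp

lemma maxGenEigenspace_quantumChannel (hs : IsStable ν) (hν : ν ≠ 0)
    {G : Matrix (Fin n) (Fin n) ℂ} (hG : G.PosDef) (hfix : donaldsonMap ν G = G) {A : hermOps G}
    (hA : A ∈ Module.End.maxGenEigenspace (quantumChannel ν G hG) 1) :
    quantumChannel ν G hG A = A := by
  rw [Module.End.mem_maxGenEigenspace] at hA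
  obtain ⟨k, hk⟩ := hA
  have key : ∀ k : ℕ, ((quantumChannel ν G hG - (1 : ℝ) • 1) ^ k) A = 0 →
      (quantumChannel ν G hG - (1 : ℝ) • 1) A = 0 := by
    intro k
    induction k with
    | zero => intro h; rw [pow_zero, Module.End.one_apply] at h; rw [h, map_zero]
    | succ k ih =>
      intro h
      cases k with
      | zero => simpa using h
      | succ k =>
        apply ih
        rw [pow_succ', pow_succ', Module.End.mul_apply, Module.End.mul_apply] at h
        rw [pow_succ', Module.End.mul_apply]
        rw [← Algebra.algebraMap_eq_smul_one] at h ⊢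
        exact quantumChannel_sub_sq hs hν hG hfix h
  have := key k hk
  rw [LinearMap.sub_apply, one_smul, Module.End.one_apply, sub_eq_zero] at this
  exact this

/-- The algebraic multiplicity is the dimension of the generalized eigenspace, which consists of
real multiples of the identity. -/
lemma rootMultiplicity_quantumChannel_le (hs : IsStable ν) (hν : ν ≠ 0)
    {G : Matrix (Fin n) (Fin n) ℂ} (hG : G.PosDef) (hfix : donaldsonMap ν G = G) :
    (quantumChannel ν G hG).charpoly.rootMultiplicity 1 ≤ 1 := by
  rw [← LinearMap.finrank_maxGenEigenspace_eq]
  have hle : (Module.End.maxGenEigenspace (quantumChannel ν G hG) 1).map (hermOps G).subtype ≤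
      Submodule.span ℝ {(1 : Matrix (Fin n) (Fin n) ℂ)} := by
    rintro _ ⟨A, hA, rfl⟩
    have hEA := maxGenEigenspace_quantumChannel hs hν hG hfix hA
    obtain ⟨c, hc⟩ := eq_smul_one_of_channelFun_eq hs hν hG hfix A.2 (congrArg Subtype.val hEA)
    exact Submodule.mem_span_singleton.2 ⟨c, hc.symm⟩
  rw [← Submodule.finrank_map_subtype_eq]
  refine (Submodule.finrank_mono hle).trans ?_
  exact (finrank_span_le_card _).trans (by simp)

lemma root_quantumChannel_le_one (hs : IsStable ν) (hν : ν ≠ 0)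
    {G : Matrix (Fin n) (Fin n) ℂ} (hG : G.PosDef) (hfix : donaldsonMap ν G = G) {μ : ℝ}
    (hμ : μ ∈ (quantumChannel ν G hG).charpoly.roots) : μ ≤ 1 := by
  have hev : Module.End.HasEigenvalue (quantumChannel ν G hG) μ :=
    (Module.End.hasEigenvalue_iff_isRoot_charpoly _ _).2 (Polynomial.isRoot_of_mem_roots hμ)
  obtain ⟨A, hA⟩ := hev.exists_hasEigenvector
  have hEA : channelFun ν G A.1 = μ • A.1 := congrArg Subtype.val hA.apply_eq_smul
  have h1 := trace_channelFun_le hν hG hfix A.2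
  have h2 := trace_mul_self_pos hs hν hG hfix A.2 fun h0 => hA.2 (Subtype.ext h0)
  rw [hEA, Matrix.mul_smul, Matrix.trace_smul, Complex.smul_re, smul_eq_mul] at h1
  by_contra hlt
  push Not at hlt
  nlinarith

/-- A second entry at least 1 would force the first two entries to equal 1. With fewer than two
roots the default value 0 makes the gap 1. -/
lemma spectralGap_pos_of_roots {V : Type*} [AddCommGroup V] [Module ℝ V] [Module.Finite ℝ V]
    (E : V →ₗ[ℝ] V) (h1 : ∀ μ ∈ E.charpoly.roots, μ ≤ 1)
    (h2 : E.charpoly.rootMultiplicity 1 ≤ 1) : 0 < spectralGap E := by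
  rw [← Polynomial.count_roots] at h2
  rw [spectralGap, eigenvalueDesc, sub_pos]
  have hp := E.charpoly.roots.pairwise_sort (fun a b : ℝ => b ≤ a)
  have hmem : ∀ μ, μ ∈ E.charpoly.roots.sort (fun a b : ℝ => b ≤ a) → μ ≤ 1 := fun μ hμ =>
    h1 μ ((Multiset.mem_sort _).1 hμ)
  have hcount : (E.charpoly.roots.sort (fun a b : ℝ => b ≤ a)).count 1 ≤ 1 := by
    rwa [← Multiset.coe_count, Multiset.sort_eq]
  generalize E.charpoly.roots.sort (fun a b : ℝ => b ≤ a) = l at hp hmem hcount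
  match l, hp, hmem, hcount with
  | [], _, _, _ => simp
  | [a], _, _, _ => simp
  | a :: b :: t, hp, hmem, hcount =>
    simp only [List.getD_cons_succ, List.getD_cons_zero]
    by_contra hb
    push Not at hb
    have hab : b ≤ a := (List.pairwise_cons.1 hp).1 b (by simp)
    have ha1 := hmem a (by simp)
    have ha : a = 1 := by linarith
    have hb1 : b = 1 := by linarith
    subst ha
    rw [hb1] at hcount
    simp at hcount

end Spectrum

section Affine

variable {n : ℕ}

/-! ### Euclidean open subsets of irreducible affine varieties are Zariski dense -/

open Polynomial in
/-- A character of `B` extends to an integral extension with a prescribed value at one element,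
which has to be a root of the minimal polynomial. -/
lemma exists_character {A B : Type*} [CommRing B] [IsDomain B] [IsIntegrallyClosed B]
    [CommRing A] [IsDomain A] [Algebra B A] [Module.IsTorsionFree B A] [Algebra.IsIntegral B A]
    [Algebra ℂ A] [Algebra ℂ B] [IsScalarTower ℂ B A] [Algebra.FiniteType ℂ A]
    (e : B →ₐ[ℂ] ℂ) (a : A) {t : ℂ} (ht : ((minpoly B a).map (e : B →+* ℂ)).IsRoot t) :
    ∃ χ : A →ₐ[ℂ] ℂ, (∀ b, χ (algebraMap B A b) = e b) ∧ χ a = t := by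
  have ha : IsIntegral B a := Algebra.IsIntegral.isIntegral a
  have ht' : (minpoly B a).eval₂ (e : B →+* ℂ) t = 0 := by rwa [IsRoot, eval_map] at ht
  -- As B is integrally closed, B[a] is B[X] modulo the minimal polynomial, so a may be sent to any
  -- of its roots.
  let ψ : Algebra.adjoin B {a} →+* ℂ :=
    (AdjoinRoot.lift (e : B →+* ℂ) t ht').comp
      (minpoly.equivAdjoin ha).symm.toRingHom
  have hψb : ∀ b, ψ (algebraMap B _ b) = e b := fun b => by
    change AdjoinRoot.lift (e : B →+* ℂ) t ht'
      ((minpoly.equivAdjoin ha).symm (algebraMap B _ b)) = _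
    rw [AlgEquiv.commutes, AdjoinRoot.algebraMap_eq, AdjoinRoot.lift_of]
    rfl
  have hψa : ψ ⟨a, Algebra.self_mem_adjoin_singleton B a⟩ = t := by
    have h1 : (minpoly.equivAdjoin ha).symm ⟨a, Algebra.self_mem_adjoin_singleton B a⟩ =
        AdjoinRoot.root _ := by
      rw [AlgEquiv.symm_apply_eq, minpoly.coe_equivAdjoin]
      exact Subtype.ext (AdjoinRoot.Minpoly.coe_toAdjoin_mk_X).symm
    change AdjoinRoot.lift (e : B →+* ℂ) t ht' ((minpoly.equivAdjoin ha).symm _) = _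
    rw [h1, AdjoinRoot.lift_root]
  have hsurj : Function.Surjective ψ := fun c => ⟨algebraMap B _ (algebraMap ℂ B c), by
    rw [hψb, AlgHom.commutes]; rfl⟩
  have hmax : (RingHom.ker ψ).IsMaximal := RingHom.ker_isMaximal_of_surjective ψ hsurj
  have : Algebra.IsIntegral (Algebra.adjoin B {a}) A := Algebra.IsIntegral.tower_top B
  -- Lying over extends the kernel of ψ to a maximal ideal Q of A, and the Nullstellensatz
  -- identifies A / Q with ℂ.
  obtain ⟨Q, hQ, hQψ⟩ := Ideal.exists_ideal_over_maximal_of_isIntegral (S := A) (RingHom.ker ψ) (by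
    intro x hx
    have : x = 0 := Subtype.ext (by simpa using hx)
    rw [this]
    exact Ideal.zero_mem _)
  let := Ideal.Quotient.field Q
  have : Module.Finite ℂ (A ⧸ Q) := finite_of_finite_type_of_isJacobsonRing ℂ (A ⧸ Q)
  have hbij : Function.Bijective (algebraMap ℂ (A ⧸ Q)) :=
    IsAlgClosed.algebraMap_bijective_of_isIntegral
  let φ : ℂ ≃ₐ[ℂ] (A ⧸ Q) := AlgEquiv.ofBijective (Algebra.ofId ℂ (A ⧸ Q)) hbij
  let χ : A →ₐ[ℂ] ℂ := φ.symm.toAlgHom.comp (Ideal.Quotient.mkₐ ℂ Q)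
  have hker : ∀ y, y ∈ Q → χ y = 0 := fun y hy => by
    change φ.symm (Ideal.Quotient.mk Q y) = 0
    rw [Ideal.Quotient.eq_zero_iff_mem.2 hy, map_zero]
  have key : ∀ y : Algebra.adjoin B {a}, χ y = ψ y := fun y => by
    have h1 : y - algebraMap B _ (algebraMap ℂ B (ψ y)) ∈ RingHom.ker ψ := by
      rw [RingHom.mem_ker, map_sub, hψb, AlgHom.commutes]
      exact sub_self _
    rw [← hQψ, Ideal.mem_comap] at h1
    have h2 := hker _ h1
    have h3 : algebraMap (Algebra.adjoin B {a}) A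
        (y - algebraMap B _ (algebraMap ℂ B (ψ y))) = (y : A) - algebraMap ℂ A (ψ y) := by
      rw [map_sub, ← IsScalarTower.algebraMap_apply, ← IsScalarTower.algebraMap_apply]
      rfl
    rw [h3, map_sub, AlgHom.commutes, sub_eq_zero] at h2
    exact h2
  refine ⟨χ, fun b => ?_, ?_⟩
  · rw [← hψb, ← key]
    rfl
  · rw [← hψa, ← key]

open Polynomial in
-- Otherwise X could be divided out, contradicting minimality of the degree.
lemma coeff_zero_minpoly_ne_zero {A B : Type*} [CommRing B] [IsDomain B] [CommRing A] [IsDomain A]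
    [Algebra B A] {a : A} (ha : IsIntegral B a) (h0 : a ≠ 0) : (minpoly B a).coeff 0 ≠ 0 := by
  intro hc
  have hX : X ∣ minpoly B a := X_dvd_iff.2 hc
  obtain ⟨Q, hQ⟩ := hX
  have hm : Q.Monic := monic_X.of_mul_monic_left (hQ ▸ minpoly.monic ha)
  have hQ0 : aeval a Q = 0 := by
    have h := minpoly.aeval B a
    rw [hQ, map_mul, aeval_X] at h
    exact (mul_eq_zero.1 h).resolve_left h0
  have h1 := natDegree_le_natDegree (minpoly.min B a hm hQ0)
  rw [hQ, monic_X.natDegree_mul hm, natDegree_X] at h1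
  omega

open Polynomial in
-- Up to sign the constant coefficient is the product of the roots.
lemma exists_root_norm_lt {P : ℂ[X]} (hP : P.Monic) {δ : ℝ} (hδ : 0 ≤ δ)
    (h : ‖P.coeff 0‖ < δ ^ P.natDegree) : ∃ t, P.IsRoot t ∧ ‖t‖ < δ := by
  by_contra hcon
  push Not at hcon
  have hs := IsAlgClosed.splits P
  have h1 : ‖P.coeff 0‖ = (P.roots.map fun t => ‖t‖).prod := by
    rw [hs.coeff_zero_eq_prod_roots_of_monic hP, norm_mul, norm_pow, norm_neg, norm_one, one_pow,
      one_mul]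
    exact (Multiset.prod_hom P.roots (normHom : ℂ →*₀ ℝ)).symm
  have h2 : (P.roots.map fun _ => δ).prod ≤ (P.roots.map fun t => ‖t‖).prod :=
    Multiset.prod_map_le_prod_map₀ _ _ (fun _ _ => hδ)
      fun t ht => hcon t (isRoot_of_mem_roots ht)
  rw [Multiset.map_const', Multiset.prod_replicate, ← hs.natDegree_eq_card_roots] at h2
  linarith

lemma exists_eval_ne_zero {s : ℕ} {c : MvPolynomial (Fin s) ℂ} (hc : c ≠ 0) (y₀ : Fin s → ℂ)
    {O : Set (Fin s → ℂ)} (hO : O ∈ 𝓝 y₀) : ∃ y ∈ O, MvPolynomial.eval y c ≠ 0 := by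
  obtain ⟨ε, hε, hball⟩ := Metric.mem_nhds_iff.1 hO
  by_contra hcon
  push Not at hcon
  refine hc (MvPolynomial.funext_set (fun i => Metric.ball (y₀ i) ε) (fun i => ?_) fun y hy => ?_)
  · exact infinite_of_mem_nhds (y₀ i) (Metric.ball_mem_nhds _ hε)
  · rw [map_zero]
    refine hcon y (hball ?_)
    rw [← ball_pi _ hε] at hy
    exact hy

/-- A polynomial that separates a point from the other points of a finite set. -/
lemma exists_separating {F : Set (Fin n → ℂ)} (hF : F.Finite) (x : Fin n → ℂ) :
    ∃ l : MvPolynomial (Fin n) ℂ, MvPolynomial.eval x l = 0 ∧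
      ∀ y ∈ F, MvPolynomial.eval y l = 0 → y = x := by
  classical
  by_cases hn : IsEmpty (Fin n)
  · exact ⟨0, map_zero _, fun y _ _ => Subsingleton.elim _ _⟩
  have : Nonempty (Fin n) := not_isEmpty_iff.1 hn
  have hex : ∀ y : Fin n → ℂ, y ≠ x → ∃ i, y i ≠ x i := fun y hy => Function.ne_iff.1 hy
  choose! i hi using hex
  -- Q vanishes at the other points of F but not at x; subtracting its value at x reverses the
  -- roles.
  let Q : MvPolynomial (Fin n) ℂ := ∏ y ∈ hF.toFinset.erase x,
    (MvPolynomial.X (i y) - MvPolynomial.C (y (i y)))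
  have hQx : MvPolynomial.eval x Q ≠ 0 := by
    rw [MvPolynomial.eval_prod, Finset.prod_ne_zero_iff]
    intro y hy
    simpa [sub_eq_zero] using (hi y (Finset.ne_of_mem_erase hy)).symm
  refine ⟨Q - MvPolynomial.C (MvPolynomial.eval x Q), by simp, fun y hy h => ?_⟩
  by_contra hyx
  have hQy : MvPolynomial.eval y Q = 0 := by
    rw [MvPolynomial.eval_prod]
    exact Finset.prod_eq_zero (Finset.mem_erase.2 ⟨hyx, hF.mem_toFinset.2 hy⟩) (by simp)
  rw [map_sub, hQy, MvPolynomial.eval_C, zero_sub, neg_eq_zero] at h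
  exact hQx h

lemma monic_map_minpoly {A : Type*} [CommRing A] {s : ℕ} [Algebra (MvPolynomial (Fin s) ℂ) A]
    [Algebra.IsIntegral (MvPolynomial (Fin s) ℂ) A] (y : Fin s → ℂ) (a : A) :
    ((minpoly (MvPolynomial (Fin s) ℂ) a).map (MvPolynomial.eval y)).Monic :=
  (minpoly.monic (Algebra.IsIntegral.isIntegral a)).map _

/-! ### Points of an affine variety as characters of its coordinate ring. -/

variable {A : Type*} [CommRing A] [Algebra ℂ A] {π : MvPolynomial (Fin n) ℂ →ₐ[ℂ] A}

/-- The point of a character of the coordinate ring. -/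
def charPoint (π : MvPolynomial (Fin n) ℂ →ₐ[ℂ] A) (χ : A →ₐ[ℂ] ℂ) : Fin n → ℂ :=
  fun i => χ (π (MvPolynomial.X i))

lemma eval_charPoint (π : MvPolynomial (Fin n) ℂ →ₐ[ℂ] A) (χ : A →ₐ[ℂ] ℂ)
    (p : MvPolynomial (Fin n) ℂ) :
    MvPolynomial.eval (charPoint π χ) p = χ (π p) := by
  have : χ.comp π = MvPolynomial.aeval (charPoint π χ) :=
    MvPolynomial.algHom_ext fun i => by simp [charPoint]
  exact (DFunLike.congr_fun this p).symm

lemma exists_charPoint_eq (hπ : Function.Surjective π) {x : Fin n → ℂ}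
    (hx : ∀ p, π p = 0 → MvPolynomial.eval x p = 0) :
    ∃ χ : A →ₐ[ℂ] ℂ, charPoint π χ = x := by
  let e := Ideal.quotientKerAlgEquivOfSurjective hπ
  refine ⟨(Ideal.Quotient.liftₐ (RingHom.ker π) (MvPolynomial.aeval x) hx).comp e.symm.toAlgHom, ?_⟩
  ext i
  have : e.symm (π (MvPolynomial.X i)) = Ideal.Quotient.mk _ (MvPolynomial.X i) := by
    rw [AlgEquiv.symm_apply_eq]
    rfl
  change Ideal.Quotient.liftₐ (RingHom.ker π) (MvPolynomial.aeval x) hx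
    (e.symm (π (MvPolynomial.X i))) = _
  rw [this]
  change MvPolynomial.aeval x (MvPolynomial.X i) = _
  rw [MvPolynomial.aeval_X]

lemma eval_charPoint_eq_zero (χ : A →ₐ[ℂ] ℂ)
    {p : MvPolynomial (Fin n) ℂ} (hp : π p = 0) : MvPolynomial.eval (charPoint π χ) p = 0 := by
  rw [eval_charPoint, hp, map_zero]

section Normalization

variable {s : ℕ} [Algebra (MvPolynomial (Fin s) ℂ) A]

/-- The image of a character under the projection to affine space. -/
def charProj (χ : A →ₐ[ℂ] ℂ) : Fin s → ℂ :=
  fun i => χ (algebraMap (MvPolynomial (Fin s) ℂ) _ (MvPolynomial.X i))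

lemma charProj_eq {χ : A →ₐ[ℂ] ℂ} {y : Fin s → ℂ}
    (h : ∀ b, χ (algebraMap (MvPolynomial (Fin s) ℂ) _ b) = MvPolynomial.aeval y b) :
    charProj χ = y := by
  ext i
  have := h (MvPolynomial.X i)
  rwa [MvPolynomial.aeval_X] at this

variable [IsScalarTower ℂ (MvPolynomial (Fin s) ℂ) A]

lemma eval_charProj (χ : A →ₐ[ℂ] ℂ) (b : MvPolynomial (Fin s) ℂ) :
    MvPolynomial.eval (charProj χ) b = χ (algebraMap _ _ b) := by
  have : χ.comp (IsScalarTower.toAlgHom ℂ (MvPolynomial (Fin s) ℂ) _) =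
      MvPolynomial.aeval (charProj χ) :=
    MvPolynomial.algHom_ext fun i => by simp [charProj]
  exact (DFunLike.congr_fun this b).symm

lemma isRoot_char (χ : A →ₐ[ℂ] ℂ) (a : A) :
    ((minpoly (MvPolynomial (Fin s) ℂ) a).map
      (MvPolynomial.eval (charProj χ : Fin s → ℂ))).IsRoot (χ a) := by
  have h1 : MvPolynomial.eval (charProj χ : Fin s → ℂ) =
      (χ : A →+* ℂ).comp (algebraMap (MvPolynomial (Fin s) ℂ) A) :=
    RingHom.ext fun b => eval_charProj χ b
  have h2 := congrArg (χ : A →+* ℂ) (minpoly.aeval (MvPolynomial (Fin s) ℂ) a)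
  rw [Polynomial.aeval_def, Polynomial.hom_eval₂, map_zero] at h2
  rw [Polynomial.IsRoot, Polynomial.eval_map, h1]
  exact h2

variable [Algebra.IsIntegral (MvPolynomial (Fin s) ℂ) A]

/-- Each coordinate is a root of a monic polynomial determined by y. -/
lemma finite_fibre (π : MvPolynomial (Fin n) ℂ →ₐ[ℂ] A) (y : Fin s → ℂ) :
    {z : Fin n → ℂ | ∃ χ : A →ₐ[ℂ] ℂ,
      charPoint π χ = z ∧ charProj χ = y}.Finite := by
  refine (Set.Finite.pi fun i => (Multiset.toFinset (((minpoly (MvPolynomial (Fin s) ℂ)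
    (π (MvPolynomial.X i))).map (MvPolynomial.eval y)).roots)).finite_toSet).subset
    ?_
  rintro _ ⟨χ, rfl, rfl⟩ i -
  rw [SetLike.mem_coe, Multiset.mem_toFinset, Polynomial.mem_roots (monic_map_minpoly _ _).ne_zero]
  exact isRoot_char χ _

/-- Roots of a monic polynomial are bounded by its coefficients, which are bounded over the ball:
the finite projection is proper. -/
lemma exists_norm_char_le (y₀ : Fin s → ℂ) (a : A) :
    ∃ C : ℝ, ∀ χ : A →ₐ[ℂ] ℂ,
      charProj χ ∈ Metric.closedBall y₀ 1 → ‖χ a‖ ≤ C := by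
  set P := minpoly (MvPolynomial (Fin s) ℂ) a
  have hj : ∀ j, ∃ C : NNReal, ∀ y ∈ Metric.closedBall y₀ 1,
      ‖MvPolynomial.eval y (P.coeff j)‖₊ ≤ C := fun j => by
    obtain ⟨C, hC⟩ := (isCompact_closedBall y₀ 1).exists_bound_of_continuousOn
      (MvPolynomial.continuous_eval (P.coeff j)).continuousOn
    exact ⟨C.toNNReal, fun y hy => NNReal.le_toNNReal_of_coe_le (hC y hy)⟩
  choose C hC using hj
  refine ⟨((Finset.range P.natDegree).sup C + 1 : NNReal), fun χ hχ => ?_⟩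
  have hm := monic_map_minpoly (charProj χ : Fin s → ℂ) a
  have h1 := (isRoot_char (s := s) χ a).norm_lt_cauchyBound hm.ne_zero
  refine h1.le.trans (NNReal.coe_le_coe.2 ?_)
  rw [Polynomial.cauchyBound, hm.leadingCoeff, nnnorm_one, div_one]
  gcongr
  refine Finset.sup_le fun j hj => ?_
  rw [Polynomial.coeff_map]
  refine (hC j _ hχ).trans (Finset.le_sup (f := C) ?_)
  rw [Finset.mem_range] at hj ⊢
  exact hj.trans_le Polynomial.natDegree_map_le

lemma exists_norm_charPoint_le (π : MvPolynomial (Fin n) ℂ →ₐ[ℂ] A) (y₀ : Fin s → ℂ) :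
    ∃ C : ℝ, ∀ χ : A →ₐ[ℂ] ℂ,
      charProj χ ∈ Metric.closedBall y₀ 1 → charPoint π χ ∈ Metric.closedBall 0 C := by
  choose C hC using fun i : Fin n =>
    exists_norm_char_le y₀ (π (MvPolynomial.X i))
  refine ⟨∑ i, |C i|, fun χ hχ => ?_⟩
  rw [mem_closedBall_zero_iff]
  refine (pi_norm_le_iff_of_nonneg (by positivity)).2 fun i => (hC i χ hχ).trans ?_
  exact (le_abs_self _).trans
    (Finset.single_le_sum (f := fun i => |C i|) (fun _ _ => abs_nonneg _) (Finset.mem_univ i))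

variable [IsDomain A] [Algebra.FiniteType ℂ A]
  [Module.IsTorsionFree (MvPolynomial (Fin s) ℂ) A]

/-- The projection to affine space is open: points near the image of a point `x` lift to points
near `x`. -/
lemma exists_lift_near (hπ : Function.Surjective π) {χ₀ : A →ₐ[ℂ] ℂ} {y : ℕ → Fin s → ℂ}
    (hy : Tendsto y atTop (𝓝 (charProj χ₀))) {O : Set (Fin n → ℂ)} (hO : O ∈ 𝓝 (charPoint π χ₀)) :
    ∃ k, ∃ χ : A →ₐ[ℂ] ℂ, charProj χ = y k ∧ charPoint π χ ∈ O := by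
  -- On the fibre, l vanishes only at the given point, so lifts along which l tends to 0 can
  -- accumulate only there.
  obtain ⟨l, hlx, hl⟩ := exists_separating (finite_fibre π (charProj χ₀ : Fin s → ℂ))
    (charPoint π χ₀)
  set a := π l
  set P := minpoly (MvPolynomial (Fin s) ℂ) a with hP
  have hmon : P.Monic := minpoly.monic (Algebra.IsIntegral.isIntegral a)
  have h0 : MvPolynomial.eval (charProj χ₀) (P.coeff 0) = 0 := by
    have h1 := isRoot_char (s := s) χ₀ a
    rw [← eval_charPoint, hlx, Polynomial.IsRoot, ← Polynomial.coeff_zero_eq_eval_zero,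
      Polynomial.coeff_map] at h1
    exact h1
  have hlim : Tendsto (fun k => ‖MvPolynomial.eval (y k) (P.coeff 0)‖) atTop (𝓝 0) := by
    have := ((MvPolynomial.continuous_eval (P.coeff 0)).norm.tendsto _).comp hy
    rwa [h0, norm_zero] at this
  have hball : ∀ᶠ k in atTop, y k ∈ Metric.closedBall (charProj χ₀) 1 :=
    hy (Metric.closedBall_mem_nhds _ one_pos)
  -- The constant coefficient of the minimal polynomial of l vanishes at the limit, so near it some
  -- root is small; `exists_character` lifts y k to a point where l takes that small value.
  have hex : ∀ j : ℕ, ∃ k ≥ j, ∃ χ : A →ₐ[ℂ] ℂ,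
      charProj χ = y k ∧ y k ∈ Metric.closedBall (charProj χ₀) 1 ∧
        ‖MvPolynomial.eval (charPoint π χ) l‖ < 1 / ((j : ℝ) + 1) := by
    intro j
    have hδ : (0 : ℝ) < 1 / ((j : ℝ) + 1) := by positivity
    obtain ⟨k, hk1, hk2, hk3⟩ := ((hlim.eventually_lt_const (pow_pos hδ P.natDegree)).and
      (hball.and (eventually_ge_atTop j))).exists
    have hPm := monic_map_minpoly (y k) a
    obtain ⟨t, ht, htlt⟩ := exists_root_norm_lt hPm hδ.le (by
      rw [Polynomial.coeff_map, hmon.natDegree_map]; exact hk1)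
    obtain ⟨χ, hχ, hχa⟩ := exists_character (MvPolynomial.aeval (y k)) a ht
    exact ⟨k, hk3, χ, charProj_eq hχ, hk2, by rw [eval_charPoint, hχa]; exact htlt⟩
  choose k hkj χ hχ hχb hχl using hex
  obtain ⟨C, hC⟩ := exists_norm_charPoint_le π (charProj χ₀ : Fin s → ℂ)
  obtain ⟨p, -, φ, hφ, hp⟩ := (isCompact_closedBall (0 : Fin n → ℂ) C).tendsto_subseq
    (x := fun j => charPoint π (χ j)) fun j => hC _ (by rw [hχ]; exact hχb j)
  have hev : ∀ q : MvPolynomial (Fin n) ℂ, Tendsto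
      (fun j => MvPolynomial.eval (charPoint π (χ (φ j))) q) atTop (𝓝 (MvPolynomial.eval p q)) :=
    fun q => ((MvPolynomial.continuous_eval q).tendsto p).comp hp
  have hpI : ∀ q, π q = 0 → MvPolynomial.eval p q = 0 := fun q hq =>
    tendsto_nhds_unique (hev q) (by simp [eval_charPoint_eq_zero (π := π) _ hq])
  obtain ⟨ψ, hψ⟩ := exists_charPoint_eq hπ hpI
  have hky : Tendsto (fun j => y (k (φ j))) atTop (𝓝 (charProj χ₀)) :=
    hy.comp (tendsto_atTop_mono (fun j => hkj (φ j)) hφ.tendsto_atTop)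
  have hψy : charProj ψ = (charProj χ₀ : Fin s → ℂ) := by
    ext i
    obtain ⟨q, hq⟩ := hπ
      (algebraMap (MvPolynomial (Fin s) ℂ) A (MvPolynomial.X i))
    have h1 : charProj ψ i = MvPolynomial.eval p q := by
      rw [← hψ, eval_charPoint, hq]
      rfl
    rw [h1]
    refine tendsto_nhds_unique (hev q) ?_
    refine ((continuous_apply i).tendsto _).comp hky |>.congr fun j => ?_
    rw [eval_charPoint, hq, Function.comp, ← hχ]
    rfl
  have hpl : MvPolynomial.eval p l = 0 := by
    refine tendsto_nhds_unique (hev l) (squeeze_zero_norm (fun j => (hχl (φ j)).le) ?_)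
    exact tendsto_one_div_add_atTop_nhds_zero_nat.comp hφ.tendsto_atTop
  have hpx : p = charPoint π χ₀ := hl p ⟨ψ, hψ, hψy⟩ hpl
  rw [hpx] at hp
  obtain ⟨j, hj⟩ := (hp.eventually hO).exists
  exact ⟨k (φ j), χ (φ j), hχ _, hj⟩

end Normalization

/-- If π h ≠ 0, its minimal polynomial has constant coefficient c ≠ 0, and points y with c(y) ≠ 0
approach the projection of x. One of them lifts close to x, where h vanishes; but then 0 is a root
of the specialized polynomial and c(y) = 0. -/
lemma map_eq_zero_of_eval_near [IsDomain A] [Algebra.FiniteType ℂ A] (s : ℕ)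
    [Algebra (MvPolynomial (Fin s) ℂ) A] [IsScalarTower ℂ (MvPolynomial (Fin s) ℂ) A]
    [Algebra.IsIntegral (MvPolynomial (Fin s) ℂ) A]
    [Module.IsTorsionFree (MvPolynomial (Fin s) ℂ) A] (hπ : Function.Surjective π) {x : Fin n → ℂ}
    (hx : ∀ p, π p = 0 → MvPolynomial.eval x p = 0) {O : Set (Fin n → ℂ)} (hO : O ∈ 𝓝 x)
    {h : MvPolynomial (Fin n) ℂ}
    (hh : ∀ z ∈ O, (∀ p, π p = 0 → MvPolynomial.eval z p = 0) → MvPolynomial.eval z h = 0) :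
    π h = 0 := by
  obtain ⟨χ₀, rfl⟩ := exists_charPoint_eq hπ hx
  by_contra hI
  set a := π h with ha
  set c := (minpoly (MvPolynomial (Fin s) ℂ) a).coeff 0
  have hc : c ≠ 0 := coeff_zero_minpoly_ne_zero (Algebra.IsIntegral.isIntegral a) hI
  have hseq : ∀ j : ℕ, ∃ y : Fin s → ℂ, y ∈ Metric.ball (charProj χ₀) (1 / ((j : ℝ) + 1)) ∧
      MvPolynomial.eval y c ≠ 0 := fun j =>
    exists_eval_ne_zero hc _ (Metric.ball_mem_nhds _ (by positivity))
  choose y hyb hyc using hseq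
  have hy : Tendsto y atTop (𝓝 (charProj χ₀)) := by
    rw [tendsto_iff_dist_tendsto_zero]
    exact squeeze_zero (fun _ => dist_nonneg) (fun j => (Metric.mem_ball.1 (hyb j)).le)
      tendsto_one_div_add_atTop_nhds_zero_nat
  obtain ⟨k, χ, hχ, hχO⟩ := exists_lift_near hπ hy hO
  have h0 : χ a = 0 := by
    rw [ha, ← eval_charPoint]
    exact hh _ hχO fun p hp => eval_charPoint_eq_zero χ hp
  refine hyc k ?_
  have h1 := isRoot_char (s := s) χ a
  rw [h0, Polynomial.IsRoot, ← Polynomial.coeff_zero_eq_eval_zero, Polynomial.coeff_map, hχ] at h1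
  exact h1

/-- A polynomial that vanishes on a Euclidean neighbourhood of a point in an irreducible affine
variety vanishes on the variety. -/
theorem mem_of_eval_eq_zero_near (I : Ideal (MvPolynomial (Fin n) ℂ)) [I.IsPrime] {x : Fin n → ℂ}
    (hx : ∀ p ∈ I, MvPolynomial.eval x p = 0) {O : Set (Fin n → ℂ)} (hO : O ∈ 𝓝 x)
    {h : MvPolynomial (Fin n) ℂ}
    (hh : ∀ z ∈ O, (∀ p ∈ I, MvPolynomial.eval z p = 0) → MvPolynomial.eval z h = 0) : h ∈ I := by
  -- Noether normalization: the variety is finite over an affine space.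
  obtain ⟨s, -, g, hinj, hint⟩ :=
    exists_integral_inj_algHom_of_quotient I (Ideal.IsPrime.ne_top inferInstance)
  let : Algebra (MvPolynomial (Fin s) ℂ) (MvPolynomial (Fin n) ℂ ⧸ I) := g.toRingHom.toAlgebra
  have : IsScalarTower ℂ (MvPolynomial (Fin s) ℂ) (MvPolynomial (Fin n) ℂ ⧸ I) :=
    IsScalarTower.of_algebraMap_eq fun c => (g.commutes c).symm
  have : Algebra.IsIntegral (MvPolynomial (Fin s) ℂ) (MvPolynomial (Fin n) ℂ ⧸ I) := ⟨hint⟩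
  have : FaithfulSMul (MvPolynomial (Fin s) ℂ) (MvPolynomial (Fin n) ℂ ⧸ I) :=
    (faithfulSMul_iff_algebraMap_injective _ _).2 hinj
  refine Ideal.Quotient.eq_zero_iff_mem.1 (map_eq_zero_of_eval_near s
    (π := Ideal.Quotient.mkₐ ℂ I) (Ideal.Quotient.mkₐ_surjective ℂ I)
    (fun p hp => hx p (Ideal.Quotient.eq_zero_iff_mem.1 hp)) hO fun z hz hzI => hh z hz fun p hp =>
      hzI p (Ideal.Quotient.eq_zero_iff_mem.2 hp))

end Affine

section Projective

variable {n : ℕ}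

/-! ### Euclidean open subsets of irreducible projective varieties span them -/

lemma eval_smul_of_isHomogeneous {p : MvPolynomial (Fin n) ℂ} {k : ℕ} (hp : p.IsHomogeneous k)
    (c : ℂ) (v : Fin n → ℂ) :
    MvPolynomial.eval (c • v) p = c ^ k * MvPolynomial.eval v p := by
  rw [MvPolynomial.eval_eq', MvPolynomial.eval_eq', Finset.mul_sum]
  refine Finset.sum_congr rfl fun d hd => ?_
  have hk : ∑ i, d i = k := by
    rw [← hp (MvPolynomial.mem_support_iff.1 hd)]
    simp [Finsupp.weight_apply, Finsupp.sum_fintype]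
  simp only [Pi.smul_apply, smul_eq_mul, mul_pow, Finset.prod_mul_distrib]
  rw [Finset.prod_pow_eq_pow_sum, hk]
  ring

lemma exists_rep_mk (v : Fin n → ℂ) (hv : v ≠ 0) :
    ∃ a : ℂ, a ≠ 0 ∧ (Projectivization.mk ℂ v hv).rep = a • v := by
  obtain ⟨a, ha⟩ := Projectivization.exists_smul_eq_mk_rep ℂ v hv
  exact ⟨a, a.ne_zero, ha.symm⟩

/-- The values of the components at v are the coefficients of the polynomial t ↦ p(tv), which has
every t as a root. -/
lemma eval_homogeneousComponent_eq_zero {p : MvPolynomial (Fin n) ℂ} {v : Fin n → ℂ}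
    (h : ∀ t : ℂ, MvPolynomial.eval (t • v) p = 0) (k : ℕ) :
    MvPolynomial.eval v (MvPolynomial.homogeneousComponent k p) = 0 := by
  by_cases hk : p.totalDegree < k
  · rw [MvPolynomial.homogeneousComponent_eq_zero _ _ hk, map_zero]
  let Q : Polynomial ℂ := ∑ j ∈ Finset.range (p.totalDegree + 1),
    Polynomial.monomial j (MvPolynomial.eval v (MvPolynomial.homogeneousComponent j p))
  have hQ : Q = 0 := Polynomial.funext fun t => by
    have h1 := h t
    rw [← MvPolynomial.sum_homogeneousComponent p, map_sum] at h1
    rw [Polynomial.eval_zero, ← h1, Polynomial.eval_finsetSum]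
    refine Finset.sum_congr rfl fun j _ => ?_
    rw [eval_smul_of_isHomogeneous (MvPolynomial.homogeneousComponent_isHomogeneous j p),
      Polynomial.eval_monomial, mul_comm]
  have h2 := congrArg (fun q => Polynomial.coeff q k) hQ
  simpa [Q, Polynomial.finsetSum_coeff, Polynomial.coeff_monomial, Nat.lt_succ_iff,
    not_lt.1 hk] using h2

/-- The ideal of the affine cone over a subset of the projective space. -/
def coneIdeal (Z : Set (ProjSpace n)) : Ideal (MvPolynomial (Fin n) ℂ) where
  carrier := {p | ∀ x ∈ Z, ∀ c : ℂ, MvPolynomial.eval (c • x.rep) p = 0}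
  zero_mem' x _ c := map_zero _
  add_mem' {p q} hp hq x hx c := by rw [map_add, hp x hx c, hq x hx c, add_zero]
  smul_mem' r p hp x hx c := by rw [smul_eq_mul, map_mul, hp x hx c, mul_zero]

lemma mem_coneIdeal_of_isHomogeneous {Z : Set (ProjSpace n)} {p : MvPolynomial (Fin n) ℂ} {k : ℕ}
    (hp : p.IsHomogeneous k) (h : ∀ x ∈ Z, MvPolynomial.eval x.rep p = 0) : p ∈ coneIdeal Z :=
  fun x hx c => by rw [eval_smul_of_isHomogeneous hp, h x hx, mul_zero]

lemma homogeneousComponent_mem_coneIdeal {Z : Set (ProjSpace n)} {p : MvPolynomial (Fin n) ℂ}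
    (hp : p ∈ coneIdeal Z) (k : ℕ) : MvPolynomial.homogeneousComponent k p ∈ coneIdeal Z :=
  mem_coneIdeal_of_isHomogeneous (MvPolynomial.homogeneousComponent_isHomogeneous k p)
    fun x hx => eval_homogeneousComponent_eq_zero (hp x hx) k

lemma isAlgebraicSet_singleton {p : MvPolynomial (Fin n) ℂ} {k : ℕ} (hp : p.IsHomogeneous k) :
    IsAlgebraicSet {x : ProjSpace n | MvPolynomial.eval x.rep p = 0} :=
  ⟨{p}, fun q hq => ⟨k, Set.mem_singleton_iff.1 hq ▸ hp⟩, by simp⟩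

lemma mk_mem_of_coneIdeal {Z : Set (ProjSpace n)} (hZ : IsAlgebraicSet Z) {v : Fin n → ℂ}
    (hv : v ≠ 0) (h : ∀ p ∈ coneIdeal Z, MvPolynomial.eval v p = 0) :
    Projectivization.mk ℂ v hv ∈ Z := by
  obtain ⟨I, hI, rfl⟩ := hZ
  intro p hp
  obtain ⟨k, hk⟩ := hI p hp
  obtain ⟨a, -, ha⟩ := exists_rep_mk v hv
  rw [ha, eval_smul_of_isHomogeneous hk,
    h p (mem_coneIdeal_of_isHomogeneous hk fun x hx => hx p hp), mul_zero]

attribute [local instance] MvPolynomial.gradedAlgebra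

/-- For a homogeneous ideal, primality need only be tested on homogeneous elements, whose zero loci
are algebraic sets to which irreducibility applies. -/
lemma isPrime_coneIdeal {Z : Set (ProjSpace n)} (hZ : IsIrreducibleVariety Z) :
    (coneIdeal Z).IsPrime := by
  obtain ⟨-, ⟨x₀, hx₀⟩, hirr⟩ := hZ
  have hhom : (coneIdeal Z).IsHomogeneous (MvPolynomial.homogeneousSubmodule (Fin n) ℂ) := by
    intro k p hp
    have := homogeneousComponent_mem_coneIdeal hp k
    rwa [← MvPolynomial.decomposition.decompose'_apply] at this
  refine hhom.isPrime_of_homogeneous_mem_or_mem ?_ ?_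
  · rw [Ne, Ideal.eq_top_iff_one]
    intro h
    simpa using h x₀ hx₀ 1
  · rintro f g ⟨k, hf⟩ ⟨l, hg⟩ hfg
    rw [MvPolynomial.mem_homogeneousSubmodule] at hf hg
    refine (hirr _ _ (isAlgebraicSet_singleton hf) (isAlgebraicSet_singleton hg) ?_).imp
      (fun h => mem_coneIdeal_of_isHomogeneous hf h) (fun h => mem_coneIdeal_of_isHomogeneous hg h)
    intro x hx
    have h := hfg x hx 1
    rw [one_smul, map_mul] at h
    exact mul_eq_zero.1 h

lemma isClosed_of_isAlgebraicSet {Z : Set (ProjSpace n)} (hZ : IsAlgebraicSet Z) :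
    IsClosed Z := by
  obtain ⟨I, hI, rfl⟩ := hZ
  have : {x : ProjSpace n | ∀ p ∈ I, MvPolynomial.eval x.rep p = 0} =
      ⋂ p ∈ I, {x : ProjSpace n | MvPolynomial.eval x.rep p = 0} := by
    ext x
    simp
  rw [this]
  refine isClosed_biInter fun p hp => ?_
  obtain ⟨k, hk⟩ := hI p hp
  rw [← isQuotientMap_mk.isClosed_preimage]
  have h2 : (fun v : {v : Fin n → ℂ // v ≠ 0} => (Projectivization.mk ℂ v.1 v.2 : ProjSpace n)) ⁻¹'
      {x : ProjSpace n | MvPolynomial.eval x.rep p = 0} =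
      {v | MvPolynomial.eval v.1 p = 0} := by
    ext v
    obtain ⟨a, ha0, ha⟩ := exists_rep_mk v.1 v.2
    simp [ha, eval_smul_of_isHomogeneous hk, ha0]
  rw [h2]
  exact isClosed_eq ((MvPolynomial.continuous_eval p).comp continuous_subtype_val)
    continuous_const

lemma isOpen_cone {O : Set (ProjSpace n)} (hO : IsOpen O) :
    IsOpen {v : Fin n → ℂ | ∃ h : v ≠ 0, Projectivization.mk ℂ v h ∈ O} := by
  have h1 := (isQuotientMap_mk (n := n)).isOpen_preimage.2 hO
  have h2 : IsOpen {v : Fin n → ℂ | v ≠ 0} := isOpen_ne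
  convert h2.isOpenMap_subtype_val _ h1 using 1
  ext v
  simp

/-- A linear form that vanishes on a nonempty Euclidean open subset of an irreducible projective
variety vanishes on the variety. -/
theorem linearForm_eq_zero_of_open {Z O : Set (ProjSpace n)} (hZ : IsIrreducibleVariety Z)
    (hO : IsOpen O) (hne : (O ∩ Z).Nonempty) {w : Fin n → ℂ}
    (hw : ∀ x ∈ O ∩ Z, w ⬝ᵥ x.rep = 0) : ∀ x ∈ Z, w ⬝ᵥ x.rep = 0 := by
  obtain ⟨x₀, hx₀O, hx₀⟩ := hne
  have hprime := isPrime_coneIdeal hZ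
  let l : MvPolynomial (Fin n) ℂ := ∑ i, MvPolynomial.C (w i) * MvPolynomial.X i
  have hl : ∀ v, MvPolynomial.eval v l = w ⬝ᵥ v := fun v => by simp [l, dotProduct]
  have hmem : l ∈ coneIdeal Z := by
    refine mem_of_eval_eq_zero_near (coneIdeal Z) (x := x₀.rep)
      (fun p hp => by simpa using hp x₀ hx₀ 1)
      ((isOpen_cone hO).mem_nhds ⟨x₀.rep_nonzero, by rwa [x₀.mk_rep]⟩) ?_
    rintro z ⟨hz0, hzO⟩ hz
    have h := hw _ ⟨hzO, mk_mem_of_coneIdeal hZ.1 hz0 hz⟩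
    obtain ⟨a, ha0, ha⟩ := exists_rep_mk z hz0
    rw [ha, dotProduct_smul, smul_eq_mul] at h
    rw [hl]
    exact (mul_eq_zero.1 h).resolve_left ha0
  intro x hx
  simpa [hl] using hmem x hx 1

end Projective

section Analytic

variable {n d : ℕ}

/-! ### Zero sets of positive measure -/

/-- The zeros of an analytic function that is not identically zero on an interval are discrete,
hence null. -/
lemma eqOn_zero_of_measure_ne_zero {F : ℝ → ℂ} {b r : ℝ} (hr : 0 < r)
    (hF : AnalyticOnNhd ℝ F (Metric.ball b r)) {T : Set ℝ} (hT : T ⊆ Metric.ball b r)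
    (hT0 : volume T ≠ 0) (h : ∀ t ∈ T, F t = 0) : ∀ t ∈ Metric.ball b r, F t = 0 := by
  intro x hx
  by_contra hFx
  have hconn : IsConnected (Metric.ball b r) :=
    ⟨⟨b, Metric.mem_ball_self hr⟩, (convex_ball b r).isPreconnected⟩
  have h1 := hF.preimage_zero_mem_codiscreteWithin hFx hx hconn
  have h2 : F ⁻¹' {0}ᶜ ∈ ae (volume.restrict (Metric.ball b r)) :=
    ae_restrict_le_codiscreteWithin Metric.isOpen_ball.measurableSet h1
  rw [mem_ae_iff, Measure.restrict_apply' Metric.isOpen_ball.measurableSet] at h2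
  refine hT0 (measure_mono_null ?_ h2)
  exact fun t ht => ⟨by simpa using h t ht, hT ht⟩

lemma cons_mem_ball {m : ℕ} {a : Fin (m + 1) → ℝ} {r t : ℝ} (hr : 0 < r) {y : Fin m → ℝ} :
    (Fin.cons t y : Fin (m + 1) → ℝ) ∈ Metric.ball a r ↔
      t ∈ Metric.ball (a 0) r ∧ y ∈ Metric.ball (Fin.tail a) r := by
  simp only [Metric.mem_ball, dist_pi_lt_iff hr, Fin.forall_fin_succ, Fin.cons_zero, Fin.cons_succ,
    Fin.tail]

/-- A separately analytic function on a cube that vanishes on a set of positive measure is zero. -/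
theorem eqOn_zero_of_separately_analytic {m : ℕ} {g : (Fin m → ℝ) → ℂ} {a : Fin m → ℝ} {r : ℝ}
    (hr : 0 < r) (hg : ∀ x ∈ Metric.ball a r, ∀ i,
      AnalyticOnNhd ℝ (fun t => g (Function.update x i t)) (Metric.ball (a i) r))
    {E : Set (Fin m → ℝ)} (hE : MeasurableSet E) (hEa : E ⊆ Metric.ball a r) (hE0 : volume E ≠ 0)
    (h : ∀ x ∈ E, g x = 0) : ∀ x ∈ Metric.ball a r, g x = 0 := by
  induction m with
  | zero =>
    intro x _
    obtain ⟨y, hy⟩ := nonempty_of_measure_ne_zero hE0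
    rw [Subsingleton.elim x y]
    exact h y hy
  | succ m ih =>
    let e := MeasurableEquiv.piFinSuccAbove (fun _ : Fin (m + 1) => ℝ) 0
    have he : ∀ t y, e.symm (t, y) = Fin.cons t y := fun t y => by
      simp [e, MeasurableEquiv.piFinSuccAbove, Fin.insertNthEquiv]
    have hvol : (volume : Measure (ℝ × (Fin m → ℝ))) (e.symm ⁻¹' E) ≠ 0 := by
      rwa [((volume_preserving_piFinSuccAbove (fun _ : Fin (m + 1) => ℝ) 0).symm).measure_preimage
        hE.nullMeasurableSet]
    -- By Fubini the slices of positive measure occur over a set T of positive measure. Induction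
    -- kills g on those slices, and the identity theorem in the remaining variable does the rest.
    let T : Set ℝ := {t | volume (Prod.mk t ⁻¹' (e.symm ⁻¹' E)) ≠ 0}
    have hT0 : volume T ≠ 0 := by
      intro hT
      exact hvol ((Measure.measure_prod_null (e.symm.measurable hE)).2 (mem_ae_iff.2 hT))
    have hTa : T ⊆ Metric.ball (a 0) r := by
      intro t ht
      obtain ⟨y, hy⟩ := nonempty_of_measure_ne_zero ht
      rw [Set.mem_preimage, Set.mem_preimage, he] at hy
      exact ((cons_mem_ball hr).1 (hEa hy)).1
    have hTy : ∀ t ∈ T, ∀ y ∈ Metric.ball (Fin.tail a) r, g (Fin.cons t y) = 0 := by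
      intro t ht
      refine ih (g := fun y => g (Fin.cons t y)) ?_
        (measurable_prodMk_left (e.symm.measurable hE)) ?_ ht ?_
      · intro y hy i
        have := hg (Fin.cons t y) ((cons_mem_ball hr).2 ⟨hTa ht, hy⟩) i.succ
        simp only [Fin.cons_update]
        exact this
      · intro y hy
        rw [Set.mem_preimage, Set.mem_preimage, he] at hy
        exact ((cons_mem_ball hr).1 (hEa hy)).2
      · intro y hy
        rw [Set.mem_preimage, Set.mem_preimage, he] at hy
        exact h _ hy
    intro x hx
    rw [← Fin.cons_self_tail x, cons_mem_ball hr] at hx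
    have hx0 : a 0 ∈ Metric.ball (a 0) r := Metric.mem_ball_self hr
    rw [← Fin.cons_self_tail x]
    refine eqOn_zero_of_measure_ne_zero (F := fun t => g (Fin.cons t (Fin.tail x))) hr ?_ hTa hT0
      (fun t ht => hTy t ht _ hx.2) _ hx.1
    have := hg (Fin.cons (a 0) (Fin.tail x)) ((cons_mem_ball hr).2 ⟨hx0, hx.2⟩) 0
    simpa only [Fin.update_cons_zero] using this

/-! ### Pairings of holomorphic maps: zero sets and polarization. -/

variable {p q : (Fin d → ℂ) → (Fin n → ℂ)} {U : Set (Fin d → ℂ)}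

lemma analyticAt_line (hU : IsOpen U) (hp : DifferentiableOn ℂ p U) (a ξ : Fin d → ℂ) (i : Fin n)
    {s : ℂ} (hs : a + s • ξ ∈ U) : AnalyticAt ℂ (fun s : ℂ => p (a + s • ξ) i) s := by
  have hc : Continuous fun s : ℂ => a + s • ξ := by fun_prop
  have hd : Differentiable ℂ fun s : ℂ => a + s • ξ := by fun_prop
  have h1 : DifferentiableOn ℂ (fun s : ℂ => p (a + s • ξ)) ((fun s : ℂ => a + s • ξ) ⁻¹' U) :=
    hp.comp hd.differentiableOn fun _ h => h
  exact (differentiableOn_pi.1 h1 i).analyticAt ((hU.preimage hc).mem_nhds hs)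

lemma analyticAt_real_line (hU : IsOpen U) (hp : DifferentiableOn ℂ p U)
    (hq : DifferentiableOn ℂ q U) (a ξ : Fin d → ℂ) {t : ℝ} (ht : a + (t : ℂ) • ξ ∈ U) :
    AnalyticAt ℝ (fun t : ℝ => p (a + (t : ℂ) • ξ) ⬝ᵥ star (q (a + (t : ℂ) • ξ))) t := by
  have hof : AnalyticAt ℝ (fun t : ℝ => (t : ℂ)) t := Complex.ofRealCLM.analyticAt t
  simp only [dotProduct, Pi.star_apply]
  refine Finset.analyticAt_fun_sum _ fun i _ => AnalyticAt.fun_mul ?_ ?_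
  · exact ((analyticAt_line hU hp a ξ i ht).restrictScalars (𝕜 := ℝ)).comp hof
  · exact (Complex.conjCLE.toContinuousLinearMap.analyticAt _).comp
      (((analyticAt_line hU hq a ξ i ht).restrictScalars (𝕜 := ℝ)).comp hof)

lemma measurableSet_zeros (hU : IsOpen U) (hp : ContinuousOn p U) (hq : ContinuousOn q U) :
    MeasurableSet {u | u ∈ U ∧ p u ⬝ᵥ star (q u) = 0} := by
  have hc : ContinuousOn (fun u => p u ⬝ᵥ star (q u)) U := by
    simp only [dotProduct, Pi.star_apply]
    exact continuousOn_finsetSum _ fun i _ =>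
      (continuousOn_pi.1 hp i).mul (continuousOn_pi.1 hq i).star
  have h1 : MeasurableSet (U ∩ (fun u => p u ⬝ᵥ star (q u)) ⁻¹' {0}ᶜ) :=
    (hc.isOpen_inter_preimage hU isOpen_compl_singleton).measurableSet
  convert hU.measurableSet.diff h1 using 1
  ext u
  simp

lemma exists_open_zeros (hU : IsOpen U) (hp : DifferentiableOn ℂ p U) (hq : DifferentiableOn ℂ q U)
    (h0 : volume {u | u ∈ U ∧ p u ⬝ᵥ star (q u) = 0} ≠ 0) :
    ∃ W ⊆ U, IsOpen W ∧ W.Nonempty ∧ ∀ u ∈ W, p u ⬝ᵥ star (q u) = 0 := by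
  set E := {u | u ∈ U ∧ p u ⬝ᵥ star (q u) = 0} with hE
  have hEm : MeasurableSet E := measurableSet_zeros hU hp.continuousOn hq.continuousOn
  -- Real coordinates on ℂ^d; they need only preserve the null sets.
  let L : (Fin (Module.finrank ℝ (Fin d → ℂ)) → ℝ) ≃L[ℝ] (Fin d → ℂ) :=
    ContinuousLinearEquiv.ofFinrankEq (by simp)
  have hac : (volume : Measure (Fin d → ℂ)) ≪ volume.map L :=
    Measure.absolutelyContinuous_isAddHaarMeasure _ _
  have hLE : volume (L ⁻¹' E) ≠ 0 := by
    intro h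
    rw [← Measure.map_apply L.continuous.measurable hEm] at h
    exact h0 (hac h)
  -- The ball is centred at a point where the zero set has positive measure in every neighbourhood.
  obtain ⟨x, hx, hxpos⟩ := exists_mem_forall_mem_nhdsWithin_pos_measure hLE
  have hLU : IsOpen (L ⁻¹' U) := hU.preimage L.continuous
  obtain ⟨r, hr, hball⟩ := Metric.isOpen_iff.1 hLU x hx.1
  have hline : ∀ y i (t : ℝ), L (Function.update y i t) =
      L (Function.update y i 0) + (t : ℂ) • L (Pi.single i 1) := by
    intro y i t
    have h1 : Function.update y i t = Function.update y i 0 + t • Pi.single i (1 : ℝ) := by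
      ext j
      by_cases hj : j = i
      · subst hj
        simp
      · simp [hj]
    rw [h1, map_add, map_smul]
    rfl
  have key := eqOn_zero_of_separately_analytic (g := fun y => p (L y) ⬝ᵥ star (q (L y)))
    (a := x) hr ?_ ((hEm.preimage L.continuous.measurable).inter Metric.isOpen_ball.measurableSet)
    Set.inter_subset_right (hxpos _ (inter_mem self_mem_nhdsWithin
      (mem_nhdsWithin_of_mem_nhds (Metric.ball_mem_nhds x hr)))).ne' fun y hy => hy.1.2
  · refine ⟨L '' Metric.ball x r, ?_, L.toHomeomorph.isOpenMap _ Metric.isOpen_ball,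
      ⟨L x, x, Metric.mem_ball_self hr, rfl⟩, ?_⟩
    · rintro _ ⟨y, hy, rfl⟩
      exact hball hy
    · rintro _ ⟨y, hy, rfl⟩
      exact key y hy
  · intro y hy i t ht
    have hmem : Function.update y i t ∈ Metric.ball x r := by
      rw [Metric.mem_ball, dist_pi_lt_iff hr] at hy ⊢
      intro j
      by_cases hj : j = i
      · subst hj
        simpa using ht
      · simpa [hj] using hy j
    have heq : (fun t : ℝ =>
        p (L (Function.update y i t)) ⬝ᵥ star (q (L (Function.update y i t)))) =
        fun t : ℝ => p (L (Function.update y i 0) + (t : ℂ) • L (Pi.single i 1)) ⬝ᵥ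
          star (q (L (Function.update y i 0) + (t : ℂ) • L (Pi.single i 1))) :=
      funext fun t => by rw [hline y i t]
    rw [heq]
    refine analyticAt_real_line hU hp hq _ _ ?_
    rw [← hline]
    exact hball hmem

lemma eqOn_zero_of_real {F : ℂ → ℂ} {r : ℝ} (hr : 0 < r)
    (hF : AnalyticOnNhd ℂ F (Metric.ball 0 r)) (h : ∀ t : ℝ, |t| < r → F t = 0) :
    ∀ z ∈ Metric.ball (0 : ℂ) r, F z = 0 := by
  refine hF.eqOn_zero_of_preconnected_of_frequently_eq_zero (convex_ball 0 r).isPreconnected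
    (Metric.mem_ball_self hr) ?_
  have ht : Tendsto (fun t : ℝ => (t : ℂ)) (𝓝[≠] 0) (𝓝[≠] 0) := by
    refine tendsto_nhdsWithin_iff.2 ⟨?_, ?_⟩
    · exact (Complex.continuous_ofReal.tendsto' 0 0 (by simp)).mono_left nhdsWithin_le_nhds
    · filter_upwards [self_mem_nhdsWithin] with t ht
      simpa using ht
  have he : ∀ᶠ t : ℝ in 𝓝[≠] 0, F t = 0 := by
    filter_upwards [mem_nhdsWithin_of_mem_nhds (Metric.ball_mem_nhds (0 : ℝ) hr)] with t ht
    exact h t (by simpa using ht)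
  exact ht.frequently he.frequently

/-- Polarization: if the pairing of `p` and `q` vanishes on the diagonal near `u`, then it
vanishes on a neighbourhood of `u` in the first variable. -/
lemma polarization {u : Fin d → ℂ} {ρ : ℝ} (hp : DifferentiableOn ℂ p (Metric.ball u ρ))
    (hq : DifferentiableOn ℂ q (Metric.ball u ρ))
    (h : ∀ v ∈ Metric.ball u ρ, p v ⬝ᵥ star (q v) = 0) :
    ∀ v ∈ Metric.ball u (ρ / 4), p v ⬝ᵥ star (q u) = 0 := by
  intro v hv
  set ξ := v - u with hξ
  have hξn : ‖ξ‖ < ρ / 4 := by rwa [hξ, ← dist_eq_norm]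
  have hmem : ∀ s : ℂ, ‖s‖ < 4 → u + s • ξ ∈ Metric.ball u ρ := by
    intro s hs
    rw [Metric.mem_ball, dist_eq_norm, add_sub_cancel_left, norm_smul]
    nlinarith [norm_nonneg s, norm_nonneg ξ]
  have hP : ∀ i, ∀ s : ℂ, ‖s‖ < 4 → AnalyticAt ℂ (fun s : ℂ => p (u + s • ξ) i) s :=
    fun i s hs => analyticAt_line Metric.isOpen_ball hp u ξ i (hmem s hs)
  have hQ : ∀ i, ∀ s : ℂ, ‖s‖ < 4 → AnalyticAt ℂ (fun s : ℂ => star (q (u + star s • ξ) i)) s := by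
    intro i s hs
    have hd : DifferentiableOn ℂ (fun s : ℂ => star (q (u + star s • ξ) i))
        (Metric.ball 0 4) := by
      intro s hs
      have hs' : ‖star s‖ < 4 := by simpa using hs
      have h1 :=
        (analyticAt_line Metric.isOpen_ball hq u ξ i (hmem _ hs')).differentiableAt.conj_conj
      simpa [Function.comp_def] using h1.differentiableWithinAt
    exact hd.analyticAt (Metric.isOpen_ball.mem_nhds (by simpa using hs))
  -- K is holomorphic in x and y separately, and for real x, y both arguments coincide, so K is a
  -- diagonal value and vanishes. Extension from real to complex values is done one variable at a
  -- time.
  let K : ℂ → ℂ → ℂ := fun x y => ∑ i, p (u + (x + Complex.I * y) • ξ) i *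
    star (q (u + star (x - Complex.I * y) • ξ) i)
  have hlt : ∀ x y : ℂ, ‖x‖ < 2 → ‖y‖ < 2 → ‖x + Complex.I * y‖ < 4 ∧ ‖x - Complex.I * y‖ < 4 := by
    intro x y hx hy
    have h1 := norm_add_le x (Complex.I * y)
    have h2 := norm_sub_le x (Complex.I * y)
    rw [norm_mul, Complex.norm_I, one_mul] at h1 h2
    constructor <;> linarith
  have hreal : ∀ x y : ℝ, |x| < 2 → |y| < 2 → K x y = 0 := by
    intro x y hx hy
    have h1 := h _ (hmem _ (hlt x y (by simpa using hx) (by simpa using hy)).1)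
    simp only [K]
    rw [show star ((x : ℂ) - Complex.I * y) = (x : ℂ) + Complex.I * y by simp]
    exact h1
  have hx : ∀ y : ℝ, |y| < 2 → ∀ x ∈ Metric.ball (0 : ℂ) 2, K x y = 0 := by
    intro y hy
    refine eqOn_zero_of_real two_pos (fun x hx => ?_) fun t ht => hreal t y ht hy
    have hb := hlt x y (by simpa using hx) (by simpa using hy)
    refine Finset.analyticAt_fun_sum _ fun i _ => AnalyticAt.fun_mul ?_ ?_
    · exact (hP i _ hb.1).comp (f := fun x : ℂ => x + Complex.I * y) (by fun_prop)
    · exact (hQ i _ hb.2).comp (f := fun x : ℂ => x - Complex.I * y) (by fun_prop)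
  have hy : ∀ x ∈ Metric.ball (0 : ℂ) 2, ∀ y ∈ Metric.ball (0 : ℂ) 2, K x y = 0 := by
    intro x hx'
    refine eqOn_zero_of_real two_pos (fun y hy => ?_) fun t ht => hx t ht x hx'
    have hb := hlt x y (by simpa using hx') (by simpa using hy)
    refine Finset.analyticAt_fun_sum _ fun i _ => AnalyticAt.fun_mul ?_ ?_
    · exact (hP i _ hb.1).comp (f := fun y : ℂ => x + Complex.I * y) (by fun_prop)
    · exact (hQ i _ hb.2).comp (f := fun y : ℂ => x - Complex.I * y) (by fun_prop)
  -- These values solve x + iy = 1 and x - iy = 0: p is evaluated at v and q at u.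
  have hfin := hy (1 / 2) (by norm_num) (-Complex.I / 2) (by norm_num)
  have e1 : (1 / 2 : ℂ) + Complex.I * (-Complex.I / 2) = 1 := by
    linear_combination (-1 / 2 : ℂ) * Complex.I_mul_I
  have e2 : (1 / 2 : ℂ) - Complex.I * (-Complex.I / 2) = 0 := by
    linear_combination (1 / 2 : ℂ) * Complex.I_mul_I
  simp only [K, e1, e2, star_zero, zero_smul, add_zero, one_smul] at hfin
  rw [hξ, add_sub_cancel] at hfin
  exact hfin

end Analytic

section Invertible

variable {n d : ℕ}

/-! ### Invertibility of the channel -/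

lemma expect_mk_eq_zero {G A : Matrix (Fin n) (Fin n) ℂ} (hG : G.PosDef) (hA : A ∈ hermOps G)
    (v : Fin n → ℂ) (hv : v ≠ 0) : expect G A (Projectivization.mk ℂ v hv) = 0 ↔
      ((G⁻¹ * A) *ᵥ v) ⬝ᵥ star v = 0 := by
  have h := dualProd_mulVec_rep hG hA (Projectivization.mk ℂ v hv)
  have hq := (quad_pos hG.inv (Projectivization.mk ℂ v hv).rep_nonzero).ne'
  obtain ⟨a, ha0, ha⟩ := exists_rep_mk v hv
  have h2 : dualProd G (A *ᵥ (a • v)) (a • v) = a * (star a * (((G⁻¹ * A) *ᵥ v) ⬝ᵥ star v)) := by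
    rw [Matrix.mulVec_smul, dualProd_smul_left, dualProd_smul_right, dualProd, herm_eq,
      Matrix.mulVec_mulVec]
  constructor
  · intro h0
    rw [h0, zero_mul, ha, h2] at h
    simpa [ha0] using h
  · intro h0
    nth_rewrite 1 2 [ha] at h
    rw [h2, h0, mul_zero, mul_zero] at h
    have h3 := Complex.ofReal_eq_zero.1 h.symm
    exact (mul_eq_zero.1 h3).resolve_right hq

/-- A linear form that vanishes on the image of a chart of a variety contained in no hyperplane is
zero. -/
lemma linearForm_eq_zero_of_chart {Z : Set (ProjSpace n)} (hZ : IsIrreducibleVariety Z)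
    (hspan : ∀ S : Submodule ℂ (Fin n → ℂ), S ≠ ⊤ → ¬ Z ⊆ projSubspace S)
    {U V : Set (Fin d → ℂ)} {φ : (Fin d → ℂ) → ProjSpace n} (hφ : IsLocalParam Z U φ)
    {f : (Fin d → ℂ) → (Fin n → ℂ)}
    (hf : ∀ u ∈ U, ∃ h : f u ≠ 0, φ u = Projectivization.mk ℂ (f u) h)
    (hVU : V ⊆ U) (hV : IsOpen V) (hne : V.Nonempty) {w : Fin n → ℂ}
    (hw : ∀ v ∈ V, w ⬝ᵥ f v = 0) : w = 0 := by
  obtain ⟨O, hO, hOZ⟩ := hφ.image_open V hVU hV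
  have h1 : ∀ x ∈ O ∩ Z, w ⬝ᵥ x.rep = 0 := by
    rw [← hOZ]
    rintro _ ⟨v, hv, rfl⟩
    obtain ⟨h0, hfv⟩ := hf v (hVU hv)
    obtain ⟨a, -, ha⟩ := exists_rep_mk (f v) h0
    rw [hfv, ha, dotProduct_smul, hw v hv, smul_zero]
  have h2 := linearForm_eq_zero_of_open hZ hO (hOZ ▸ hne.image φ) h1
  let S : Submodule ℂ (Fin n → ℂ) := LinearMap.ker (dotProductBilin ℂ ℂ w)
  have hS : ∀ v, v ∈ S ↔ w ⬝ᵥ v = 0 := fun v => Iff.rfl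
  have htop : S = ⊤ := by
    by_contra htop
    exact hspan S htop fun x hx => mem_projSubspace.2 ((hS _).2 (h2 x hx))
  refine dotProduct_eq_zero _ fun v => ?_
  rw [← hS, htop]
  trivial

/-- Vanishing of ⟨B f, f⟩ spreads to an open set and polarizes; then the spanning property of chart
images is used twice, once for each factor f. -/
lemma eq_zero_of_expect_chart {Z : Set (ProjSpace n)} (hZ : IsIrreducibleVariety Z)
    (hspan : ∀ S : Submodule ℂ (Fin n → ℂ), S ≠ ⊤ → ¬ Z ⊆ projSubspace S)
    {U : Set (Fin d → ℂ)} {φ : (Fin d → ℂ) → ProjSpace n} (hφ : IsLocalParam Z U φ)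
    {f : (Fin d → ℂ) → (Fin n → ℂ)} (hfd : DifferentiableOn ℂ f U)
    (hf : ∀ u ∈ U, ∃ h : f u ≠ 0, φ u = Projectivization.mk ℂ (f u) h)
    {B : Matrix (Fin n) (Fin n) ℂ}
    (hB : volume {u | u ∈ U ∧ (B *ᵥ f u) ⬝ᵥ star (f u) = 0} ≠ 0) : B = 0 := by
  have hBf : DifferentiableOn ℂ (fun u => B *ᵥ f u) U :=
    B.mulVecLin.toContinuousLinearMap.differentiable.comp_differentiableOn hfd
  obtain ⟨W, hWU, hW, hWne, hW0⟩ := exists_open_zeros hφ.isOpen hBf hfd hB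
  have h1 : ∀ u ∈ W, star (f u) ᵥ* B = 0 := by
    intro u hu
    obtain ⟨ρ, hρ, hball⟩ := Metric.isOpen_iff.1 hW u hu
    have hpol := polarization (hBf.mono (hball.trans hWU)) (hfd.mono (hball.trans hWU))
      fun v hv => hW0 v (hball hv)
    have hsub : Metric.ball u (ρ / 4) ⊆ Metric.ball u ρ := Metric.ball_subset_ball (by linarith)
    refine linearForm_eq_zero_of_chart hZ hspan hφ hf (hsub.trans (hball.trans hWU))
      Metric.isOpen_ball ⟨u, Metric.mem_ball_self (by positivity)⟩ fun v hv => ?_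
    rw [← Matrix.dotProduct_mulVec, dotProduct_comm]
    exact hpol v hv
  ext j i
  -- The relation f(u)* B = 0, conjugated, says that the conjugate of column i is a linear form
  -- vanishing on f(W).
  have h2 : (fun j => star (B j i)) = 0 := by
    refine linearForm_eq_zero_of_chart hZ hspan hφ hf hWU hW hWne fun u hu => ?_
    have h3 := congrArg star (congrFun (h1 u hu) i)
    simp only [Matrix.vecMul, dotProduct, Pi.star_apply, star_sum, star_mul', star_star,
      Pi.zero_apply, star_zero] at h3
    rw [← h3]
    exact Finset.sum_congr rfl fun k _ => mul_comm _ _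
  simpa using congrFun h2 j

variable {ν : Measure (ProjSpace n)} [IsFiniteMeasure ν]

theorem eq_zero_of_channelFun_eq_zero (hν : ν ≠ 0) {Z : Set (ProjSpace n)}
    (hZ : IsIrreducibleVariety Z) (hac : IsAbsContOn ν Z) (hZν : 0 < ν Z)
    (hspan : ∀ S : Submodule ℂ (Fin n → ℂ), S ≠ ⊤ → ¬ Z ⊆ projSubspace S)
    {G A : Matrix (Fin n) (Fin n) ℂ} (hG : G.PosDef) (hA : A ∈ hermOps G)
    (hEA : channelFun ν G A = 0) : A = 0 := by
  set N : Set (ProjSpace n) := Z ∩ {x | expect G A x = 0} with hN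
  have hNm : MeasurableSet N := ((isClosed_of_isAlgebraicSet hZ.1).inter
    (isClosed_eq (continuous_expect hG A) continuous_const)).measurableSet
  have hNν : ν N ≠ 0 := by
    rw [hN, measure_inter_conull (t := {x | expect G A x = 0})
      (ae_expect_eq_zero hν hG hA hEA)]
    exact hZν.ne'
  -- The expectation vanishes almost everywhere, so N has the full mass of Z; absolute continuity
  -- then yields a chart in which N is not Lebesgue-null.
  have hnull : ¬ IsNullIn Z N := fun h => hNν (hac N hNm Set.inter_subset_left h)
  simp only [IsNullIn, not_forall] at hnull
  obtain ⟨d, U, φ, hφ, hvol⟩ := hnull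
  obtain ⟨f, hfd, hf, -⟩ := hφ.immersion
  have hsub : U ∩ φ ⁻¹' N ⊆ {u | u ∈ U ∧ ((G⁻¹ * A) *ᵥ f u) ⬝ᵥ star (f u) = 0} := by
    rintro u ⟨hu, -, hu0⟩
    obtain ⟨h0, hfu⟩ := hf u hu
    refine ⟨hu, (expect_mk_eq_zero hG hA (f u) h0).1 ?_⟩
    rw [← hfu]
    exact hu0
  have hB : G⁻¹ * A = 0 :=
    eq_zero_of_expect_chart hZ hspan hφ hfd hf fun h => hvol (measure_mono_null hsub h)
  rw [← Matrix.one_mul A, ← mul_inv_of_posDef hG, Matrix.mul_assoc, hB, Matrix.mul_zero]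

theorem isUnit_quantumChannel (hν : ν ≠ 0) {Z : Set (ProjSpace n)}
    (hZ : IsIrreducibleVariety Z) (hac : IsAbsContOn ν Z) (hZν : 0 < ν Z)
    (hspan : ∀ S : Submodule ℂ (Fin n → ℂ), S ≠ ⊤ → ¬ Z ⊆ projSubspace S)
    {G : Matrix (Fin n) (Fin n) ℂ} (hG : G.PosDef) : IsUnit (quantumChannel ν G hG) := by
  rw [LinearMap.isUnit_iff_ker_eq_bot, LinearMap.ker_eq_bot']
  intro A hA
  exact Subtype.ext (eq_zero_of_channelFun_eq_zero hν hZ hac hZν hspan hG A.2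
    (congrArg Subtype.val hA))

end Invertible

end Donaldson

end

/-! ### Assembly of the statements. -/

theorem theorem4p4 {n : ℕ} (ν : Measure (Donaldson.ProjSpace n)) [IsFiniteMeasure ν] (hν : ν ≠ 0)
    (Y : Set (Donaldson.ProjSpace n)) (hY : Donaldson.IsAlgebraicSet Y) (hsupp : ν Yᶜ = 0)
    (hac : ∀ Z, Donaldson.IsComponent Z Y → Donaldson.IsAbsContOn ν Z)
    -- `ν(Σ) / (dim Σ + 1) < |ν| / n` for all proper projective subspaces `Σ = ℙ(S)`
    (hstab : ∀ S : Submodule ℂ (Fin n → ℂ), S ≠ ⊥ → S ≠ ⊤ →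
      ν.real (Donaldson.projSubspace S) / (Module.finrank ℂ S : ℝ) < ν.real Set.univ / (n : ℝ)) :
    -- `T_ν` preserves the positive Hermitian matrices
    (∀ G : Matrix (Fin n) (Fin n) ℂ, G.PosDef → (Donaldson.donaldsonMap ν G).PosDef) ∧
    -- convergence of the iterations to a fixed point
    (∀ G₀ : Matrix (Fin n) (Fin n) ℂ, G₀.PosDef →
      ∃ G : Matrix (Fin n) (Fin n) ℂ, G.PosDef ∧ Donaldson.donaldsonMap ν G = G ∧
        Tendsto (fun r : ℕ => (Donaldson.donaldsonMap ν)^[r] G₀) atTop (𝓝 G)) ∧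
    -- uniqueness of the fixed point up to scaling
    (∀ G G' : Matrix (Fin n) (Fin n) ℂ, G.PosDef → G'.PosDef →
      Donaldson.donaldsonMap ν G = G → Donaldson.donaldsonMap ν G' = G' →
        ∃ c : ℝ, 0 < c ∧ G' = c • G) ∧
    -- positive spectral gap
    (∀ (G : Matrix (Fin n) (Fin n) ℂ) (hG : G.PosDef), Donaldson.donaldsonMap ν G = G →
      0 < Donaldson.spectralGap (Donaldson.quantumChannel ν G hG)) ∧
    -- invertibility
    ((∃ Z, Donaldson.IsComponent Z Y ∧ 0 < ν Z ∧
        ∀ S : Submodule ℂ (Fin n → ℂ), S ≠ ⊤ → ¬ Z ⊆ Donaldson.projSubspace S) →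
      ∀ (G : Matrix (Fin n) (Fin n) ℂ) (hG : G.PosDef), Donaldson.donaldsonMap ν G = G →
        IsUnit (Donaldson.quantumChannel ν G hG)) := by
  have hs : Donaldson.IsStable ν := hstab
  obtain ⟨P, hP, hfix⟩ := Donaldson.exists_fixed hs hν
  refine ⟨fun G hG => Donaldson.donaldsonMap_posDef hs hν hG,
    fun G₀ hG₀ => Donaldson.exists_tendsto_iterate hs hν hP hfix hG₀,
    fun G G' hG hG' h h' => Donaldson.fixed_unique hs hν hG hG' h h',
    fun G hG h => Donaldson.spectralGap_pos_of_roots _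
      (fun _ hμ => Donaldson.root_quantumChannel_le_one hs hν hG h hμ)
      (Donaldson.rootMultiplicity_quantumChannel_le hs hν hG h), ?_⟩
  rintro ⟨Z, hZ, hZν, hspan⟩ G hG -
  exact Donaldson.isUnit_quantumChannel hν hZ.1 (hac Z hZ) hZν hspan hG
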